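/- Let $\Bbbk$ be a commutative ring with unit. A \emph{dg $\mathbb S$-module} $M$ is a family of chain complexes $M(n)$, $n\ge 0$, of $\Bbbk$-modules ($\mathbb Z$-graded, $\deg \mathrm d=-1$), each with a right $S_n$-action, written $x\mapsto x^\sigma$, commuting with $\mathrm d$; permutations are written as products of cycles and $\sigma\tau$ means "first $\tau$, then $\sigma$", so $x^{\sigma\tau}=(x^\sigma)^\tau$. It is \emph{$\mathbb S$-free} if each $M(n)_r$ is a free $\Bbbk[S_n]$-module. The composite product is $$(M\circ N)(n)=\bigoplus_{m\ge0} M(m)\otimes_{S_m}\Bigl(\bigoplus_{n_1+\dots+n_m=n}\mathrm{Ind}_{S_{n_1}\times\dots\times S_{n_m}}^{S_n}\bigl(N(n_1)\otimes\dots\otimes N(n_m)\bigr)\Bigr)$$ with the Koszul sign rule and with the differential $\mathrm d(\mu\circ(\nu_1,\dots,\nu_m))=\mathrm d\mu\circ(\nu_1,\dots,\nu_m)+\sum_i(-1)^{|\mu|+|\nu_1|+\dots+|\nu_{i-1}|}\mu\circ(\nu_1,\dots,\mathrm d\nu_i,\dots,\nu_m)$; its unit $\mathrm I$ is $\Bbbk$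 in arity $1$ and degree $0$. A \emph{dg cooperad} is a comonoid $(\mathcal C,\Delta,\varepsilon)$ for $\circ$ in dg $\mathbb S$-modules: $\Delta\colon\mathcal C\to\mathcal C\circ\mathcal C$ and $\varepsilon\colon\mathcal C\to\mathrm I$ are $\mathbb S$-equivariant chain maps of degree $0$ with $(\Delta\circ\mathrm{id})\Delta=(\mathrm{id}\circ\Delta)\Delta$ and $(\varepsilon\circ\mathrm{id})\Delta=\mathrm{id}=(\mathrm{id}\circ\varepsilon)\Delta$, modulo the canonical isomorphisms $(\mathcal C\circ\mathcal C)\circ\mathcal C\cong\mathcal C\circ(\mathcal C\circ\mathcal C)$ and $\mathrm I\circ\mathcal C\cong\mathcal C\cong\mathcal C\circ\mathrm I$. Let $LieD_{[3]}$ be the $\mathbb S$-module whose arity-$n$ part is the free $\Bbbk[S_n]$-module on the following generators (it is $0$ for $n=0$ and $n\ge6$). * $n=1$: $\lambda_1=1$ in degree $0$. * $n=2$: $\lambda_2,\ \lambda_{2;1},\ \lambda_{2;1,1},\ \lambda_{2;1,1,1}$ in degrees $1,2,3,4$. * $n=3$: $\lambda_3$ in degree $2$; $\lambda_{3;1},\lambda_{3;2}$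 in degree $3$; $\lambda_{3;1,1},\lambda_{3;1,2},\lambda_{3;2,2}$ in degree $4$. * $n=4$: $\lambda_4$ in degree $3$; $\lambda_{4;1},\lambda_{4;2},\lambda_{4;3}$ in degree $4$. * $n=5$: $\lambda_5$ in degree $4$. Let $\mathrm d$ be the $\mathbb S$-equivariant map of degree $-1$ with $\mathrm d\lambda_n=0$ for $1\le n\le5$ and $$\begin{aligned} \mathrm d\lambda_{2;1}&=-\lambda_2-\lambda_2^{(12)},\qquad \mathrm d\lambda_{2;1,1}=-\lambda_{2;1}+\lambda_{2;1}^{(12)},\qquad \mathrm d\lambda_{2;1,1,1}=-\lambda_{2;1,1}-\lambda_{2;1,1}^{(12)},\\ \mathrm d\lambda_{3;1}&=-\lambda_3-\lambda_3^{(12)},\qquad \mathrm d\lambda_{3;2}=-\lambda_3-\lambda_3^{(23)},\\ \mathrm d\lambda_{3;1,1}&=-\lambda_{3;1}+\lambda_{3;1}^{(12)},\qquad \mathrm d\lambda_{3;2,2}=-\lambda_{3;2}+\lambda_{3;2}^{(23)},\\ \mathrm d\lambda_{3;1,2}&=\lambda_{3;1}+\lambda_{3;1}^{(23)}+\lambda_{3;1}^{(132)}-\lambda_{3;2}-\lambda_{3;2}^{(12)}-\lambda_{3;2}^{(123)},\\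 \mathrm d\lambda_{4;1}&=-\lambda_4-\lambda_4^{(12)},\qquad \mathrm d\lambda_{4;2}=-\lambda_4-\lambda_4^{(23)},\qquad \mathrm d\lambda_{4;3}=-\lambda_4-\lambda_4^{(34)}. \end{aligned}$$ Let $\Delta\colon LieD_{[3]}\to LieD_{[3]}\circ LieD_{[3]}$ be the $\mathbb S$-equivariant map with $\Delta(1)=1\circ(1)$ and $\Delta(g)=1\circ(g)+\bar\Delta(g)+g\circ(1,\dots,1)$ for every other generator $g$, where $\bar\Delta$ vanishes on $\lambda_2,\lambda_{2;1},\lambda_{2;1,1},\lambda_{2;1,1,1}$, is given on $\lambda_n$, $3\le n\le 5$, as in the Koszul dual cooperad of the Leibniz operad by $$\bar\Delta(\lambda_n)=\sum_{1<j<n}\ \sum_{i_1+\dots+i_j=n}\ \sum_{\sigma}(-1)^{(j-1)(n-j)+\sum_{a}(a-1)(i_a-1)}\,\mathrm{sgn}(\sigma)\,\bigl(\lambda_j\circ(\lambda_{i_1},\dots,\lambda_{i_j})\bigr)^{\sigma}$$ (all $i_a\ge1$; $\sigma\in S_n$ such that $\sigma^{-1}$ is increasing on each of the $j$ consecutive blocks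 of lengths $i_1,\dots,i_j$ and $\sigma^{-1}(i_1)<\sigma^{-1}(i_1+i_2)<\dots<\sigma^{-1}(i_1+\dots+i_j)$), and on the other generators by $$\begin{aligned} \bar\Delta(\lambda_{3;1})&=\lambda_2\circ(\lambda_{2;1},1),\\ \bar\Delta(\lambda_{3;2})&=-\lambda_{2;1}\circ(\lambda_2,1)-\lambda_2\circ(1,\lambda_{2;1})-\lambda_{2;1}\circ(1,\lambda_2)^{(12)},\\ \bar\Delta(\lambda_{3;1,1})&=-\lambda_2\circ(\lambda_{2;1,1},1),\\ \bar\Delta(\lambda_{3;1,2})&=-\lambda_{2;1}\circ(\lambda_{2;1},1)-\lambda_{2;1}\circ(1,\lambda_{2;1})-\lambda_{2;1}\circ(1,\lambda_{2;1})^{(12)}+\lambda_{2;1,1}\circ(1,\lambda_2)^{(132)},\\ \bar\Delta(\lambda_{3;2,2})&=-\lambda_{2;1,1}\circ(\lambda_2,1)+\lambda_2\circ(1,\lambda_{2;1,1})-\lambda_{2;1,1}\circ(1,\lambda_2)^{(12)},\\ \bar\Delta(\lambda_{4;1})&=-\lambda_2\circ(\lambda_{3;1},1)-\lambda_2\circ(1,\lambda_{3;1})^{(123)}+\lambda_2\circ(\lambda_{2;1},\lambda_2)+\lambda_3\circ(\lambda_{2;1},1,1)+\lambda_{3;1}\circ(1,1,\lambda_2),\\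 \bar\Delta(\lambda_{4;2})&=-\lambda_2\circ(\lambda_{3;2},1)-\lambda_2\circ(1,\lambda_{3;1})+\lambda_2\circ(\lambda_{2;1},\lambda_2)^{(132)}+\lambda_{3;1}\circ(\lambda_2,1,1)+\lambda_{3;1}\circ(1,\lambda_2,1)^{(12)}\\ &\quad-\lambda_3\circ(1,\lambda_{2;1},1)+\lambda_{3;1}\circ(1,1,\lambda_2)^{(132)},\\ \bar\Delta(\lambda_{4;3})&=\lambda_{2;1}\circ(1,\lambda_3)^{(123)}-\lambda_2\circ(1,\lambda_{3;2})+\lambda_2\circ(1,\lambda_{3;2})^{(12)}+\lambda_{2;1}\circ(\lambda_3,1)-\lambda_2\circ(\lambda_2,\lambda_{2;1})\\ &\quad-\lambda_{2;1}\circ(\lambda_2,\lambda_2)^{(132)}+\lambda_{2;1}\circ(\lambda_2,\lambda_2)^{(23)}+\lambda_{3;2}\circ(\lambda_2,1,1)-\lambda_{3;2}\circ(1,1,\lambda_2)^{(23)}+\lambda_{3;2}\circ(1,1,\lambda_2)^{(132)}\\ &\quad+\lambda_3\circ(1,1,\lambda_{2;1})-\lambda_{3;2}\circ(1,\lambda_2,1)+\lambda_{3;2}\circ(1,\lambda_2,1)^{(12)}.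 \end{aligned}$$ (Here $\mu\circ(\nu_1,\dots,\nu_m)^\sigma$ means $(\mu\circ(\nu_1,\dots,\nu_m))^\sigma$.) Let $\varepsilon\colon LieD_{[3]}\to\mathrm I$ send $\lambda_1=1$ to $1$ and every other generator to $0$. **Lemma.** $(LieD_{[3]},\mathrm d)$ is an $\mathbb S$-free dg $\mathbb S$-module, and with the decomposition map $\Delta$ and the counit $\varepsilon$ it is a dg cooperad. -/

import Mathlib

open Equiv (Perm)

universe u

/-- The Koszul sign of reordering homogeneous symbols `x : ι` of degrees `deg x` from the order given
by `u` to the order given by `v`: a factor `(-1) ^ (deg x * deg y)` for every pair whose order is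
reversed. -/
def koszulSign {ι α β : Type*} [Fintype ι] [LinearOrder α] [LinearOrder β]
    (deg : ι → ℤ) (u : ι → α) (v : ι → β) : ℤˣ :=
  ∏ x, ∏ y, if u x < u y ∧ v y < v x then (deg x * deg y).negOnePow else 1

section KoszulSign

variable {ι α β γ : Type*} [Fintype ι] [LinearOrder α] [LinearOrder β] [LinearOrder γ]

theorem koszulSign_congr {α' β' : Type*} [LinearOrder α'] [LinearOrder β']
    (deg : ι → ℤ) (u : ι → α) (v : ι → β) (u' : ι → α') (v' : ι → β')
    (hu : ∀ x y, u x < u y ↔ u' x < u' y) (hv : ∀ x y, v x < v y ↔ v' x < v' y) :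
    koszulSign deg u v = koszulSign deg u' v' := by
  simp only [koszulSign, hu, hv]

theorem koszulSign_comp {κ : Type*} [Fintype κ] (φ : κ ≃ ι) (deg : ι → ℤ) (u : ι → α) (v : ι → β) :
    koszulSign (fun x => deg (φ x)) (fun x => u (φ x)) (fun x => v (φ x)) = koszulSign deg u v := by
  unfold koszulSign
  rw [← Equiv.prod_comp φ]
  refine Finset.prod_congr rfl fun x _ => ?_
  rw [← Equiv.prod_comp φ]

theorem koszulSign_mul (deg : ι → ℤ) (u : ι → α) (v : ι → β) (w : ι → γ)
    (hu : Function.Injective u) (hv : Function.Injective v) (hw : Function.Injective w) :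
    koszulSign deg u v * koszulSign deg v w = koszulSign deg u w := by
  have key : koszulSign deg v w = ∏ x, ∏ y,
      ((if u x < u y ∧ v x < v y ∧ w y < w x then (deg x * deg y).negOnePow else 1) *
       (if u x < u y ∧ v y < v x ∧ w x < w y then (deg x * deg y).negOnePow else 1)) := by
    simp only [Finset.prod_mul_distrib]
    rw [Finset.prod_comm (f := fun x y =>
      if u x < u y ∧ v y < v x ∧ w x < w y then (deg x * deg y).negOnePow else 1)]
    simp only [← Finset.prod_mul_distrib, koszulSign]
    refine Finset.prod_congr rfl fun x _ => Finset.prod_congr rfl fun y _ => ?_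
    by_cases hxy : x = y
    · subst hxy; simp
    · have h1 : u x ≠ u y := fun h => hxy (hu h)
      rw [mul_comm (deg y) (deg x)]
      rcases lt_or_gt_of_ne h1 with h | h
      · simp [h, h.not_gt]
      · simp [h, h.not_gt]
  rw [key]
  simp only [koszulSign, ← Finset.prod_mul_distrib]
  refine Finset.prod_congr rfl fun x _ => Finset.prod_congr rfl fun y _ => ?_
  by_cases hxy : x = y
  · subst hxy; simp
  · have h1 : u x ≠ u y := fun h => hxy (hu h)
    have h2 : v x ≠ v y := fun h => hxy (hv h)
    have h3 : w x ≠ w y := fun h => hxy (hw h)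
    rcases lt_or_gt_of_ne h1 with h | h
    · rcases lt_or_gt_of_ne h2 with h' | h' <;> rcases lt_or_gt_of_ne h3 with h'' | h'' <;>
        simp [h, h', h'', h'.not_gt, h''.not_gt, Int.units_mul_self]
    · simp [h.not_gt]

theorem koszulSign_self (deg : ι → ℤ) (u : ι → α) : koszulSign deg u u = 1 := by
  unfold koszulSign
  refine Finset.prod_eq_one fun x _ => Finset.prod_eq_one fun y _ => ?_
  rw [if_neg]
  rintro ⟨h, h'⟩
  exact lt_asymm h h'

theorem negOnePow_sum {κ : Type*} (s : Finset κ) (f : κ → ℤ) :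
    (∑ i ∈ s, f i).negOnePow = ∏ i ∈ s, (f i).negOnePow := by
  classical
  induction s using Finset.induction_on with
  | empty => simp
  | insert a s ha ih => rw [Finset.sum_insert ha, Finset.prod_insert ha, Int.negOnePow_add, ih]

/-- Permuting blocks of symbols has the Koszul sign of permuting their total degrees. -/
theorem koszulSign_blocks {l : ℕ} {T : Fin l → Type*} [∀ i, Fintype (T i)]
    (deg : (Σ i, T i) → ℤ) (h : ∀ i, T i → ℕ) (σ : Perm (Fin l)) :
    koszulSign deg (fun x => toLex (x.1, h x.1 x.2)) (fun x => toLex (σ x.1, h x.1 x.2)) =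
      koszulSign (fun i => ∑ t, deg ⟨i, t⟩) (fun i => i) (fun i => σ i) := by
  unfold koszulSign
  rw [Fintype.prod_sigma]
  refine Finset.prod_congr rfl fun i _ => ?_
  simp_rw [Fintype.prod_sigma]
  rw [Finset.prod_comm]
  refine Finset.prod_congr rfl fun j _ => ?_
  by_cases hij : i < j ∧ σ j < σ i
  · rw [if_pos hij, Finset.sum_mul_sum, negOnePow_sum]
    refine Finset.prod_congr rfl fun s _ => ?_
    rw [negOnePow_sum]
    refine Finset.prod_congr rfl fun t _ => ?_
    rw [if_pos]
    exact ⟨Prod.Lex.left _ _ hij.1, Prod.Lex.left _ _ hij.2⟩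
  · rw [if_neg hij]
    refine Finset.prod_eq_one fun s _ => Finset.prod_eq_one fun t _ => ?_
    rw [if_neg]
    rintro ⟨h1, h2⟩
    rw [Prod.Lex.toLex_lt_toLex] at h1 h2
    rcases h1 with h1 | ⟨h1, h1'⟩
    · rcases h2 with h2 | ⟨h2, h2'⟩
      · exact hij ⟨h1, h2⟩
      · exact h1.ne (σ.injective h2).symm
    · dsimp at h1 h1' h2
      subst h1
      rcases h2 with h2 | ⟨h2, h2'⟩
      · exact lt_irrefl _ h2
      · exact lt_asymm h1' h2'

/-- The Koszul sign of permuting symbols inside blocks is the product over the blocks. -/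
theorem koszulSign_inside {l : ℕ} {T : Fin l → Type*} [∀ i, Fintype (T i)]
    (deg : (Σ i, T i) → ℤ) (g h : ∀ i, T i → ℕ) :
    koszulSign deg (fun x => toLex (x.1, g x.1 x.2)) (fun x => toLex (x.1, h x.1 x.2)) =
      ∏ i, koszulSign (fun t => deg ⟨i, t⟩) (g i) (h i) := by
  unfold koszulSign
  rw [Fintype.prod_sigma]
  refine Finset.prod_congr rfl fun i _ => ?_
  refine Finset.prod_congr rfl fun s _ => ?_
  rw [Fintype.prod_sigma, Finset.prod_eq_single i]
  · refine Finset.prod_congr rfl fun t _ => ?_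
    simp [Prod.Lex.toLex_lt_toLex]
  · intro j _ hj
    refine Finset.prod_eq_one fun t _ => ?_
    rw [if_neg]
    rintro ⟨h1, h2⟩
    rw [Prod.Lex.toLex_lt_toLex] at h1 h2
    rcases h1 with h1 | ⟨h1, h1'⟩
    · rcases h2 with h2 | ⟨h2, h2'⟩
      · exact lt_asymm h1 h2
      · exact hj h2
    · exact hj h1.symm
  · simp

/-- A symbol that stays in front does not contribute to the Koszul sign. -/
theorem koszulSign_option {κ : Type*} [Fintype κ] (deg : Option κ → ℤ) (g h : Option κ → ℕ)
    (hg : g none = 0) (hh : h none = 0) :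
    koszulSign deg g h =
      koszulSign (fun t => deg (some t)) (fun t => g (some t)) (fun t => h (some t)) := by
  unfold koszulSign
  simp [Fintype.prod_option, hg, hh]

/-- How the Koszul sign changes with the degree of one symbol. -/
theorem koszulSign_update {m : ℕ} (q : Fin m → ℤ) (σ : Perm (Fin m)) (i : Fin m) :
    (∑ j ∈ Finset.univ.filter (· < i), q j).negOnePow *
        koszulSign (Function.update q i (q i - 1)) (fun j => j) (fun j => σ j) =
      koszulSign q (fun j => j) (fun j => σ j) *
        (∑ j ∈ Finset.univ.filter (· < σ i), q (σ.symm j)).negOnePow := by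
  have e1 : (∑ j ∈ Finset.univ.filter (· < σ i), q (σ.symm j)).negOnePow =
      ∏ j, if σ j < σ i then (q j).negOnePow else 1 := by
    rw [negOnePow_sum, Finset.prod_filter, ← Equiv.prod_comp σ]
    simp
  have e2 : (∑ j ∈ Finset.univ.filter (· < i), q j).negOnePow =
      ∏ j, if j < i then (q j).negOnePow else 1 := by
    rw [negOnePow_sum, Finset.prod_filter]
  have e3 : koszulSign (Function.update q i (q i - 1)) (fun j => j) (fun j => σ j) *
      koszulSign q (fun j => j) (fun j => σ j) =
      (∏ y, if i < y ∧ σ y < σ i then (q y).negOnePow else 1) *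
      (∏ x, if x < i ∧ σ i < σ x then (q x).negOnePow else 1) := by
    have a1 : (∏ y, if i < y ∧ σ y < σ i then (q y).negOnePow else 1) =
        ∏ x, ∏ y, if x = i then (if x < y ∧ σ y < σ x then (q y).negOnePow else 1) else 1 := by
      refine ((Finset.prod_eq_single i ?_ ?_).trans ?_).symm
      · intro b _ hb; simp [hb]
      · simp
      · simp
    have a2 : (∏ x, if x < i ∧ σ i < σ x then (q x).negOnePow else 1) =
        ∏ x, ∏ y, if y = i then (if x < y ∧ σ y < σ x then (q x).negOnePow else 1) else 1 := by
      refine Finset.prod_congr rfl fun x _ => ?_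
      rw [Finset.prod_eq_single i]
      · simp
      · intro b _ hb; simp [hb]
      · simp
    rw [a1, a2]
    simp only [koszulSign, ← Finset.prod_mul_distrib]
    refine Finset.prod_congr rfl fun x _ => Finset.prod_congr rfl fun y _ => ?_
    by_cases hxy : x < y ∧ σ y < σ x
    · have hne : x ≠ y := hxy.1.ne
      simp only [hxy, and_self, if_true]
      by_cases hx : x = i
      · subst hx
        simp [hne.symm]
        rw [← Int.negOnePow_add, show (q x - 1) * q y + q x * q y = 2 * (q x * q y) - q y by ring,
          Int.negOnePow_sub, Int.negOnePow_two_mul, one_mul]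
      · by_cases hy : y = i
        · subst hy
          simp [hne]
          rw [← Int.negOnePow_add, show q x * (q y - 1) + q x * q y = 2 * (q x * q y) - q x by ring,
            Int.negOnePow_sub, Int.negOnePow_two_mul, one_mul]
        · simp [hx, hy, Int.units_mul_self]
    · simp [hxy]
  have e4 : (∏ y, if i < y ∧ σ y < σ i then (q y).negOnePow else 1) *
      (∏ x, if x < i ∧ σ i < σ x then (q x).negOnePow else 1) *
      (∏ j, if j < i then (q j).negOnePow else 1) =
      ∏ j, if σ j < σ i then (q j).negOnePow else 1 := by
    simp only [← Finset.prod_mul_distrib]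
    refine Finset.prod_congr rfl fun j _ => ?_
    by_cases hj : j = i
    · subst hj; simp
    · have hs : σ j ≠ σ i := fun h => hj (σ.injective h)
      rcases lt_or_gt_of_ne hj with h | h <;> rcases lt_or_gt_of_ne hs with h' | h' <;>
        simp [h, h', h.not_gt, h'.not_gt, Int.units_mul_self]
  rw [e1, e2, ← e4, ← e3]
  calc _ = (koszulSign (Function.update q i (q i - 1)) (fun j => j) (fun j => σ j)) *
        (∏ j, if j < i then (q j).negOnePow else 1) * 1 := by rw [mul_one, mul_comm]
    _ = _ := by
      rw [← Int.units_mul_self (koszulSign q (fun j => j) (fun j => σ j))]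
      simp only [mul_comm, mul_left_comm, mul_assoc]

end KoszulSign

/-- A dg `S`-module over `k`: for every arity `n` a chain complex `X n` of `k`-modules, graded by `ℤ`
with differential of degree `-1`, with a right action `act σ x = x ^ σ` of `S_n` that commutes with
the differential. -/
structure DGSMod (k : Type u) [CommRing k] where
  X : ℕ → ℤ → Type u
  [addCommGroup : ∀ n r, AddCommGroup (X n r)]
  [module : ∀ n r, Module k (X n r)]
  act : ∀ {n : ℕ} {r : ℤ}, Perm (Fin n) → X n r →ₗ[k] X n r
  act_one : ∀ {n : ℕ} {r : ℤ} (x : X n r), act 1 x = x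
  act_mul : ∀ {n : ℕ} {r : ℤ} (σ τ : Perm (Fin n)) (x : X n r), act (σ * τ) x = act τ (act σ x)
  d : ∀ {n : ℕ} {r : ℤ}, X n r →ₗ[k] X n (r - 1)
  d_d : ∀ {n : ℕ} {r : ℤ} (x : X n r), d (d x) = 0
  d_act : ∀ {n : ℕ} {r : ℤ} (σ : Perm (Fin n)) (x : X n r), d (act σ x) = act σ (d x)

attribute [instance] DGSMod.addCommGroup DGSMod.module

namespace DGSMod

variable {k : Type u} [CommRing k]

section transport

variable (M : DGSMod k) {n : ℕ}

/-- Transport along an equality of degrees. -/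
def castTo {r s : ℤ} (h : s = r) : M.X n r →ₗ[k] M.X n s := h ▸ LinearMap.id

/-- The differential, with a target degree that is only provably `r - 1`. -/
def dTo {r s : ℤ} (h : s = r - 1) : M.X n r →ₗ[k] M.X n s := M.castTo h ∘ₗ M.d

@[simp] theorem castTo_rfl {r : ℤ} (h : r = r) (x : M.X n r) : M.castTo h x = x := rfl

theorem castTo_castTo {r s t : ℤ} (h : s = r) (h' : t = s) (x : M.X n r) :
    M.castTo h' (M.castTo h x) = M.castTo (h'.trans h) x := by
  subst h h'; rfl

theorem dTo_castTo {r s t : ℤ} (h : s = r) (h' : t = s - 1) (x : M.X n r) :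
    M.dTo h' (M.castTo h x) = M.dTo (h'.trans (by rw [h])) x := by
  subst h h'; rfl

theorem castTo_dTo {r s t : ℤ} (h : s = r - 1) (h' : t = s) (x : M.X n r) :
    M.castTo h' (M.dTo h x) = M.dTo (h'.trans h) x := by
  subst h h'; rfl

theorem dTo_dTo {r s t : ℤ} (h : s = r - 1) (h' : t = s - 1) (x : M.X n r) :
    M.dTo h' (M.dTo h x) = 0 := by
  subst h h'; exact M.d_d x

theorem castTo_act {r s : ℤ} (h : s = r) (σ : Perm (Fin n)) (x : M.X n r) :
    M.castTo h (M.act σ x) = M.act σ (M.castTo h x) := by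
  subst h; rfl

theorem dTo_act {r s : ℤ} (h : s = r - 1) (σ : Perm (Fin n)) (x : M.X n r) :
    M.dTo h (M.act σ x) = M.act σ (M.dTo h x) := by
  subst h; exact M.d_act σ x

end transport

/-- A two-level tree: a formal symbol `top ∘ (bot 0, …, bot (m - 1))` of arity `n` and degree `r`, with
`top ∈ M(m)_p` and `bot i ∈ N(ar i)_{q i}`, whose inputs are labelled by `Fin n`: the `t`-th input of
`bot i` has the label `lab ⟨i, t⟩`. With `lab` the order-preserving labelling `finSigmaFinEquiv` it is
`top ∘ (bot 0, …, bot (m - 1))` itself; with `σ⁻¹` after it, it is the result of acting by `σ`. -/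
structure Tree (M N : DGSMod k) (n : ℕ) (r : ℤ) where
  m : ℕ
  p : ℤ
  top : M.X m p
  ar : Fin m → ℕ
  q : Fin m → ℤ
  bot : ∀ i, N.X (ar i) (q i)
  lab : (Σ i, Fin (ar i)) ≃ Fin n
  deg : p + ∑ i, q i = r

open Finsupp in
/-- The relations of the composite product
`(M ∘ N)(n) = ⨁_m M(m) ⊗_{S_m} ⨁_{n_1 + ⋯ + n_m = n} Ind (N(n_1) ⊗ ⋯ ⊗ N(n_m))`, the induction being
from `S_{n_1} × ⋯ × S_{n_m}` to `S_n`: a tree is multilinear in its entries; `bot i ^ τ_i` is the same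
as a relabelling of the inputs of `bot i` (the induction); and
`μ ^ σ ∘ (ν_1, …, ν_m) = ± μ ∘ (ν_{σ⁻¹(1)}, …, ν_{σ⁻¹(m)})`, with the Koszul sign and with every input
keeping its label (the tensor product over `S_m`). -/
inductive TreeRel (M N : DGSMod k) (n : ℕ) (r : ℤ) : (Tree M N n r →₀ k) → Prop
  | top_add (m p x y ar q bot lab h) : TreeRel M N n r
      (single ⟨m, p, x + y, ar, q, bot, lab, h⟩ 1
        - (single ⟨m, p, x, ar, q, bot, lab, h⟩ 1 + single ⟨m, p, y, ar, q, bot, lab, h⟩ 1))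
  | top_smul (m p) (c : k) (x ar q bot lab h) : TreeRel M N n r
      (single ⟨m, p, c • x, ar, q, bot, lab, h⟩ 1 - c • single ⟨m, p, x, ar, q, bot, lab, h⟩ 1)
  | bot_add (m p top ar q bot i x y lab h) : TreeRel M N n r
      (single ⟨m, p, top, ar, q, Function.update bot i (x + y), lab, h⟩ 1
        - (single ⟨m, p, top, ar, q, Function.update bot i x, lab, h⟩ 1
          + single ⟨m, p, top, ar, q, Function.update bot i y, lab, h⟩ 1))
  | bot_smul (m p top ar q bot i) (c : k) (x lab h) : TreeRel M N n r
      (single ⟨m, p, top, ar, q, Function.update bot i (c • x), lab, h⟩ 1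
        - c • single ⟨m, p, top, ar, q, Function.update bot i x, lab, h⟩ 1)
  | bot_act (m p top ar q bot) (τ : ∀ i, Perm (Fin (ar i))) (lab h) : TreeRel M N n r
      (single ⟨m, p, top, ar, q, fun i => N.act (τ i) (bot i), lab, h⟩ 1
        - single ⟨m, p, top, ar, q, bot,
            (Equiv.sigmaCongrRight fun i => (τ i).symm).trans lab, h⟩ 1)
  | top_act (m p top ar q bot) (σ : Perm (Fin m)) (lab h) : TreeRel M N n r
      (single ⟨m, p, M.act σ top, ar, q, bot, lab, h⟩ 1
        - ((koszulSign q (fun i => i) (fun i => σ i) : ℤ) : k) •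
          single ⟨m, p, top, fun i => ar (σ.symm i), fun i => q (σ.symm i),
            fun i => bot (σ.symm i),
            (Equiv.sigmaCongrLeft (β := fun i => Fin (ar i)) σ.symm).trans lab,
            (by rw [← h]; exact congrArg (p + ·) (Equiv.sum_comp σ.symm q))⟩ 1)

/-- The composite product `(M ∘ N)(n)_r`: linear combinations of trees modulo the relations. -/
def CompX (M N : DGSMod k) (n : ℕ) (r : ℤ) : Type u :=
  (Tree M N n r →₀ k) ⧸ Submodule.span k {z | TreeRel M N n r z}

namespace CompX

variable {M N : DGSMod k} {n : ℕ} {r : ℤ}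

noncomputable instance : AddCommGroup (CompX M N n r) :=
  inferInstanceAs (AddCommGroup ((Tree M N n r →₀ k) ⧸ Submodule.span k {z | TreeRel M N n r z}))

noncomputable instance : Module k (CompX M N n r) :=
  inferInstanceAs (Module k ((Tree M N n r →₀ k) ⧸ Submodule.span k {z | TreeRel M N n r z}))

/-- The class of a tree. -/
noncomputable def mk (t : Tree M N n r) : CompX M N n r :=
  Submodule.Quotient.mk (Finsupp.single t 1)

theorem mk_rel {z : Tree M N n r →₀ k} (hz : TreeRel M N n r z) :
    (Submodule.Quotient.mk z : (Tree M N n r →₀ k) ⧸ Submodule.span k {z | TreeRel M N n r z}) = 0 :=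
  (Submodule.Quotient.mk_eq_zero _).2 (Submodule.subset_span hz)

/-- A function on trees that respects the relations. -/
structure Respects {A : Type*} [AddCommGroup A] [Module k A] (f : Tree M N n r → A) : Prop where
  top_add : ∀ m p x y ar q bot lab h, f ⟨m, p, x + y, ar, q, bot, lab, h⟩ =
    f ⟨m, p, x, ar, q, bot, lab, h⟩ + f ⟨m, p, y, ar, q, bot, lab, h⟩
  top_smul : ∀ m p (c : k) x ar q bot lab h, f ⟨m, p, c • x, ar, q, bot, lab, h⟩ =
    c • f ⟨m, p, x, ar, q, bot, lab, h⟩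
  bot_add : ∀ m p top ar q bot i x y lab h,
    f ⟨m, p, top, ar, q, Function.update bot i (x + y), lab, h⟩ =
      f ⟨m, p, top, ar, q, Function.update bot i x, lab, h⟩ +
      f ⟨m, p, top, ar, q, Function.update bot i y, lab, h⟩
  bot_smul : ∀ m p top ar q bot i (c : k) x lab h,
    f ⟨m, p, top, ar, q, Function.update bot i (c • x), lab, h⟩ =
      c • f ⟨m, p, top, ar, q, Function.update bot i x, lab, h⟩
  bot_act : ∀ m p top ar q bot (τ : ∀ i, Perm (Fin (ar i))) lab h,
    f ⟨m, p, top, ar, q, fun i => N.act (τ i) (bot i), lab, h⟩ =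
      f ⟨m, p, top, ar, q, bot, (Equiv.sigmaCongrRight fun i => (τ i).symm).trans lab, h⟩
  top_act : ∀ m p top ar q bot (σ : Perm (Fin m)) lab h h',
    f ⟨m, p, M.act σ top, ar, q, bot, lab, h⟩ =
      ((koszulSign q (fun i => i) (fun i => σ i) : ℤ) : k) •
        f ⟨m, p, top, fun i => ar (σ.symm i), fun i => q (σ.symm i), fun i => bot (σ.symm i),
          (Equiv.sigmaCongrLeft (β := fun i => Fin (ar i)) σ.symm).trans lab, h'⟩

theorem mk_respects : Respects (mk : Tree M N n r → CompX M N n r) where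
  top_add m p x y ar q bot lab h := sub_eq_zero.1 (mk_rel (.top_add m p x y ar q bot lab h))
  top_smul m p c x ar q bot lab h := sub_eq_zero.1 (mk_rel (.top_smul m p c x ar q bot lab h))
  bot_add m p top ar q bot i x y lab h :=
    sub_eq_zero.1 (mk_rel (.bot_add m p top ar q bot i x y lab h))
  bot_smul m p top ar q bot i c x lab h :=
    sub_eq_zero.1 (mk_rel (.bot_smul m p top ar q bot i c x lab h))
  bot_act m p top ar q bot τ lab h :=
    sub_eq_zero.1 (mk_rel (.bot_act m p top ar q bot τ lab h))
  top_act m p top ar q bot σ lab h _ :=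
    sub_eq_zero.1 (mk_rel (.top_act m p top ar q bot σ lab h))

section lift

variable {A : Type*} [AddCommGroup A] [Module k A]

/-- The universal property of the composite product. -/
noncomputable def lift (f : Tree M N n r → A) (hf : Respects f) : CompX M N n r →ₗ[k] A :=
  Submodule.liftQ _ (Finsupp.linearCombination k f) (by
    rw [Submodule.span_le]
    intro z hz
    rw [SetLike.mem_coe, LinearMap.mem_ker]
    cases hz with
    | top_add m p x y ar q bot lab h => simp [hf.top_add m p x y ar q bot lab h]
    | top_smul m p c x ar q bot lab h => simp [hf.top_smul m p c x ar q bot lab h]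
    | bot_add m p top ar q bot i x y lab h => simp [hf.bot_add m p top ar q bot i x y lab h]
    | bot_smul m p top ar q bot i c x lab h => simp [hf.bot_smul m p top ar q bot i c x lab h]
    | bot_act m p top ar q bot τ lab h => simp [hf.bot_act m p top ar q bot τ lab h]
    | top_act m p top ar q bot σ lab h =>
      rw [map_sub, map_smul, Finsupp.linearCombination_single, Finsupp.linearCombination_single,
        one_smul, one_smul, hf.top_act m p top ar q bot σ lab h
          (by rw [← h]; exact congrArg (p + ·) (Equiv.sum_comp σ.symm q)), sub_self])

@[simp] theorem lift_mk (f : Tree M N n r → A) (hf : Respects f) (t : Tree M N n r) :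
    lift f hf (mk t) = f t := by
  have : lift f hf (mk t) = Finsupp.linearCombination k f (Finsupp.single t 1) := rfl
  rw [this]; simp

theorem hom_ext {f g : CompX M N n r →ₗ[k] A} (h : ∀ t, f (mk t) = g (mk t)) : f = g := by
  refine Submodule.linearMap_qext _ (Finsupp.lhom_ext' fun t => LinearMap.ext_ring ?_)
  exact h t

theorem Respects.hom_comp {B : Type*} [AddCommGroup B] [Module k B] {f : Tree M N n r → A} (hf : Respects f)
    (φ : A →ₗ[k] B) : Respects (fun t => φ (f t)) where
  top_add m p x y ar q bot lab h := by rw [hf.top_add, map_add]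
  top_smul m p c x ar q bot lab h := by rw [hf.top_smul, map_smul]
  bot_add m p top ar q bot i x y lab h := by rw [hf.bot_add, map_add]
  bot_smul m p top ar q bot i c x lab h := by rw [hf.bot_smul, map_smul]
  bot_act m p top ar q bot τ lab h := by rw [hf.bot_act]
  top_act m p top ar q bot σ lab h h' := by rw [hf.top_act, map_smul]

end lift

/-- The class of a tree, as a multilinear function of its bottom entries. -/
noncomputable def node {m : ℕ} {p : ℤ} (top : M.X m p) {ar : Fin m → ℕ} {q : Fin m → ℤ}
    (lab : (Σ i, Fin (ar i)) ≃ Fin n) (h : p + ∑ i, q i = r) :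
    MultilinearMap k (fun i => N.X (ar i) (q i)) (CompX M N n r) where
  toFun bot := mk ⟨m, p, top, ar, q, bot, lab, h⟩
  map_update_add' := by
    intro inst bot i x y
    obtain rfl : inst = instDecidableEqFin m := Subsingleton.elim _ _
    exact mk_respects.bot_add ..
  map_update_smul' := by
    intro inst bot i c x
    obtain rfl : inst = instDecidableEqFin m := Subsingleton.elim _ _
    exact mk_respects.bot_smul ..

theorem node_apply {m : ℕ} {p : ℤ} (top : M.X m p) {ar : Fin m → ℕ} {q : Fin m → ℤ}
    (lab : (Σ i, Fin (ar i)) ≃ Fin n) (h : p + ∑ i, q i = r) (bot : ∀ i, N.X (ar i) (q i)) :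
    node top lab h bot = mk ⟨m, p, top, ar, q, bot, lab, h⟩ := rfl

/-- The right action of `S_n`: an input with label `v` gets the label `σ⁻¹ v`. -/
noncomputable def act (σ : Perm (Fin n)) : CompX M N n r →ₗ[k] CompX M N n r :=
  lift (fun t => mk { t with lab := t.lab.trans σ.symm })
    { top_add := fun _ _ _ _ _ _ _ _ _ => mk_respects.top_add ..
      top_smul := fun _ _ _ _ _ _ _ _ _ => mk_respects.top_smul ..
      bot_add := fun _ _ _ _ _ _ _ _ _ _ _ => mk_respects.bot_add ..
      bot_smul := fun _ _ _ _ _ _ _ _ _ _ _ => mk_respects.bot_smul ..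
      bot_act := fun _ _ _ _ _ _ _ _ _ => mk_respects.bot_act ..
      top_act := fun _ _ _ _ _ _ _ _ _ _ => mk_respects.top_act .. }

theorem act_mk (σ : Perm (Fin n)) (t : Tree M N n r) :
    act σ (mk t) = mk { t with lab := t.lab.trans σ.symm } := lift_mk ..

theorem act_node {m : ℕ} {p : ℤ} (top : M.X m p) {ar : Fin m → ℕ} {q : Fin m → ℤ}
    (lab : (Σ i, Fin (ar i)) ≃ Fin n) (h : p + ∑ i, q i = r) (bot : ∀ i, N.X (ar i) (q i))
    (σ : Perm (Fin n)) : act σ (node top lab h bot) = node top (lab.trans σ.symm) h bot :=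
  act_mk ..

theorem node_add {m : ℕ} {p : ℤ} (x y : M.X m p) {ar : Fin m → ℕ} {q : Fin m → ℤ}
    (lab : (Σ i, Fin (ar i)) ≃ Fin n) (h : p + ∑ i, q i = r) (bot : ∀ i, N.X (ar i) (q i)) :
    node (x + y) lab h bot = node x lab h bot + node y lab h bot := mk_respects.top_add ..

theorem node_smul {m : ℕ} {p : ℤ} (c : k) (x : M.X m p) {ar : Fin m → ℕ} {q : Fin m → ℤ}
    (lab : (Σ i, Fin (ar i)) ≃ Fin n) (h : p + ∑ i, q i = r) (bot : ∀ i, N.X (ar i) (q i)) :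
    node (c • x) lab h bot = c • node x lab h bot := mk_respects.top_smul ..

theorem node_zero {m : ℕ} {p : ℤ} {ar : Fin m → ℕ} {q : Fin m → ℤ}
    (lab : (Σ i, Fin (ar i)) ≃ Fin n) (h : p + ∑ i, q i = r) (bot : ∀ i, N.X (ar i) (q i)) :
    node (0 : M.X m p) lab h bot = 0 := by
  rw [← zero_smul k (0 : M.X m p), node_smul, zero_smul]

theorem node_bot_act {m : ℕ} {p : ℤ} (x : M.X m p) {ar : Fin m → ℕ} {q : Fin m → ℤ}
    (lab : (Σ i, Fin (ar i)) ≃ Fin n) (h : p + ∑ i, q i = r) (bot : ∀ i, N.X (ar i) (q i))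
    (τ : ∀ i, Perm (Fin (ar i))) :
    node x lab h (fun i => N.act (τ i) (bot i)) =
      node x ((Equiv.sigmaCongrRight fun i => (τ i).symm).trans lab) h bot :=
  mk_respects.bot_act ..

theorem node_top_act {m : ℕ} {p : ℤ} (x : M.X m p) {ar : Fin m → ℕ} {q : Fin m → ℤ}
    (lab : (Σ i, Fin (ar i)) ≃ Fin n) (h : p + ∑ i, q i = r) (bot : ∀ i, N.X (ar i) (q i))
    (σ : Perm (Fin m)) :
    node (M.act σ x) lab h bot = ((koszulSign q (fun i => i) (fun i => σ i) : ℤ) : k) •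
      node x (ar := fun i => ar (σ.symm i)) (q := fun i => q (σ.symm i))
        ((Equiv.sigmaCongrLeft (β := fun i => Fin (ar i)) σ.symm).trans lab)
        (by rw [← h]; exact congrArg (p + ·) (Equiv.sum_comp σ.symm q))
        (fun i => bot (σ.symm i)) :=
  mk_respects.top_act ..

/-- Trees with equal data, up to transport of degrees, agree. -/
theorem node_congr {m : ℕ} {p : ℤ} (x : M.X m p) {ar : Fin m → ℕ} {q q' : Fin m → ℤ}
    (lab : (Σ i, Fin (ar i)) ≃ Fin n) (h : p + ∑ i, q i = r) (h' : p + ∑ i, q' i = r)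
    (bot : ∀ i, N.X (ar i) (q i)) (bot' : ∀ i, N.X (ar i) (q' i)) (hq : ∀ i, q' i = q i)
    (hb : ∀ i, bot' i = N.castTo (hq i) (bot i)) :
    node x lab h bot = node x lab h' bot' := by
  obtain rfl : q' = q := funext hq
  obtain rfl : bot' = bot := funext hb
  rfl

theorem node_lab_congr {m : ℕ} {p : ℤ} (x : M.X m p) {ar : Fin m → ℕ} {q : Fin m → ℤ}
    {lab lab' : (Σ i, Fin (ar i)) ≃ Fin n} (h : p + ∑ i, q i = r) (bot : ∀ i, N.X (ar i) (q i))
    (hl : ∀ y, lab y = lab' y) : node x lab h bot = node x lab' h bot := by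
  obtain rfl : lab = lab' := Equiv.ext hl
  rfl

/-- The differential of `N` in the `i`-th place, the identity in the other places. -/
def shift (N : DGSMod k) {m : ℕ} (ar : Fin m → ℕ) (q : Fin m → ℤ) (i j : Fin m) :
    N.X (ar j) (q j) →ₗ[k] N.X (ar j) (Function.update q i (q i - 1) j) :=
  if h : j = i then N.dTo (by subst h; simp) else N.castTo (by simp [h])

theorem sum_update_sub_one {m : ℕ} (q : Fin m → ℤ) (i : Fin m) {p : ℤ} (h : p + ∑ j, q j = r) :
    p + ∑ j, Function.update q i (q i - 1) j = r - 1 := by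
  rw [Finset.sum_update_of_mem (Finset.mem_univ i), ← h,
    ← Finset.add_sum_erase Finset.univ q (Finset.mem_univ i), Finset.sdiff_singleton_eq_erase]
  ring

/-- The sign `(-1) ^ (p + q 0 + ⋯ + q (i - 1))` of moving `d` to the `i`-th place. -/
def prefixSign {m : ℕ} (p : ℤ) (q : Fin m → ℤ) (i : Fin m) : ℤˣ :=
  (p + ∑ j ∈ Finset.univ.filter (· < i), q j).negOnePow

/-- The summand `± μ ∘ (ν_1, …, d ν_i, …, ν_m)` of the differential. -/
noncomputable def dBot {m : ℕ} {p : ℤ} (top : M.X m p) {ar : Fin m → ℕ} {q : Fin m → ℤ}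
    (lab : (Σ i, Fin (ar i)) ≃ Fin n) (h : p + ∑ i, q i = r) (i : Fin m) :
    MultilinearMap k (fun i => N.X (ar i) (q i)) (CompX M N n (r - 1)) :=
  ((prefixSign p q i : ℤ) : k) •
    (node top lab (sum_update_sub_one q i h)).compLinearMap (shift N ar q i)

/-- The Leibniz rule
`d (μ ∘ (ν_1, …, ν_m)) = d μ ∘ (ν_1, …, ν_m) + ∑ i, ± μ ∘ (ν_1, …, d ν_i, …, ν_m)`. -/
noncomputable def dTree (t : Tree M N n r) : CompX M N n (r - 1) :=
  node (M.d t.top) t.lab (by have := t.deg; omega) t.bot + ∑ i, dBot t.top t.lab t.deg i t.bot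

theorem shift_act {m : ℕ} (ar : Fin m → ℕ) (q : Fin m → ℤ) (i j : Fin m) (σ : Perm (Fin (ar j)))
    (x : N.X (ar j) (q j)) : shift N ar q i j (N.act σ x) = N.act σ (shift N ar q i j x) := by
  unfold shift
  split_ifs with h
  · exact N.dTo_act _ σ x
  · exact N.castTo_act _ σ x

theorem dBot_apply {m : ℕ} {p : ℤ} (top : M.X m p) {ar : Fin m → ℕ} {q : Fin m → ℤ}
    (lab : (Σ i, Fin (ar i)) ≃ Fin n) (h : p + ∑ i, q i = r) (i : Fin m)
    (bot : ∀ i, N.X (ar i) (q i)) : dBot top lab h i bot = ((prefixSign p q i : ℤ) : k) •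
      node top lab (sum_update_sub_one q i h) (fun j => shift N ar q i j (bot j)) := rfl

theorem dTree_respects : Respects (dTree : Tree M N n r → CompX M N n (r - 1)) where
  top_add m p x y ar q bot lab h := by
    simp only [dTree, map_add, node_add, dBot_apply, smul_add, Finset.sum_add_distrib]; abel
  top_smul m p c x ar q bot lab h := by
    simp only [dTree, map_smul, node_smul, dBot_apply, smul_add, Finset.smul_sum, smul_comm c]
  bot_add m p top ar q bot i x y lab h := by
    simp only [dTree, MultilinearMap.map_update_add, Finset.sum_add_distrib]; abel
  bot_smul m p top ar q bot i c x lab h := by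
    simp only [dTree, MultilinearMap.map_update_smul, smul_add, Finset.smul_sum]
  bot_act m p top ar q bot τ lab h := by
    simp only [dTree, node_bot_act, dBot_apply, shift_act]
  top_act m p top ar q bot σ lab h h' := by
    simp only [dTree, smul_add, Finset.smul_sum, M.d_act]
    congr 1
    · rw [node_top_act]
    · rw [← Equiv.sum_comp σ (fun i => _ • dBot _ _ _ _ _)]
      refine Finset.sum_congr rfl fun i _ => ?_
      rw [dBot_apply, dBot_apply, node_top_act, smul_smul, smul_smul]
      have hs : prefixSign p q i * koszulSign (Function.update q i (q i - 1)) (fun i => i) (fun i => σ i)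
          = koszulSign q (fun i => i) (fun i => σ i) * prefixSign p (fun j => q (σ.symm j)) (σ i) := by
        unfold prefixSign
        rw [Int.negOnePow_add, Int.negOnePow_add, mul_assoc, koszulSign_update]
        exact mul_left_comm _ _ _
      rw [← Int.cast_mul, ← Int.cast_mul, ← Units.val_mul, ← Units.val_mul, hs]
      congr 1
      have hq : ∀ j, Function.update (fun j => q (σ.symm j)) (σ i) (q (σ.symm (σ i)) - 1) j =
          Function.update q i (q i - 1) (σ.symm j) := by
        intro j
        by_cases hj : σ.symm j = i
        · obtain rfl : j = σ i := by rw [← hj]; simp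
          simp
        · have : j ≠ σ i := by rintro rfl; simp at hj
          simp [hj, this]
      refine node_congr _ _ _ _ _ _ hq fun j => ?_
      unfold shift
      by_cases hj : σ.symm j = i
      · have h2 : j = σ i := by rw [← hj]; simp
        rw [dif_pos hj, dif_pos h2, castTo_dTo]
      · have h2 : j ≠ σ i := by rintro rfl; simp at hj
        rw [dif_neg hj, dif_neg h2, castTo_castTo]

/-- The differential of the composite product. -/
noncomputable def d : CompX M N n r →ₗ[k] CompX M N n (r - 1) := lift dTree dTree_respects

theorem d_mk (t : Tree M N n r) : d (mk t) = dTree t := lift_mk ..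

theorem d_node {m : ℕ} {p : ℤ} (top : M.X m p) {ar : Fin m → ℕ} {q : Fin m → ℤ}
    (lab : (Σ i, Fin (ar i)) ≃ Fin n) (h : p + ∑ i, q i = r) (bot : ∀ i, N.X (ar i) (q i)) :
    d (node top lab h bot) = node (M.d top) lab (by omega) bot + ∑ i, dBot top lab h i bot :=
  d_mk ..

theorem prefixSign_cross {m : ℕ} (p : ℤ) (q : Fin m → ℤ) {i j : Fin m} (hij : i ≠ j) :
    prefixSign p q i * prefixSign p (Function.update q i (q i - 1)) j =
      - (prefixSign p q j * prefixSign p (Function.update q j (q j - 1)) i) := by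
  wlog hlt : i < j generalizing i j
  · rw [this hij.symm (lt_of_le_of_ne (not_lt.1 hlt) hij.symm), neg_neg]
  have e1 : prefixSign p (Function.update q j (q j - 1)) i = prefixSign p q i := by
    unfold prefixSign
    congr 2
    refine Finset.sum_congr rfl fun l hl => ?_
    rw [Function.update_of_ne]
    rintro rfl
    exact lt_asymm hlt (Finset.mem_filter.1 hl).2
  have e2 : prefixSign p (Function.update q i (q i - 1)) j = - prefixSign p q j := by
    unfold prefixSign
    have hi : i ∈ Finset.univ.filter (· < j) := by simp [hlt]
    rw [Finset.sum_update_of_mem hi, ← Finset.add_sum_erase _ q hi,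
      Finset.sdiff_singleton_eq_erase, show ∀ s : ℤ, p + (q i - 1 + s) = p + (q i + s) - 1 by
        intro s; ring, Int.negOnePow_sub, Int.negOnePow_one, mul_neg_one]
  rw [e1, e2, mul_neg, mul_comm]

theorem d_d (x : CompX M N n r) : d (d x) = 0 := by
  suffices h : (d ∘ₗ d : CompX M N n r →ₗ[k] _) = 0 from LinearMap.congr_fun h x
  refine hom_ext fun t => ?_
  obtain ⟨m, p, top, ar, q, bot, lab, h⟩ := t
  rw [LinearMap.comp_apply, d_mk, dTree, map_add, d_node, M.d_d, node_zero, zero_add, map_sum]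
  simp only [dBot_apply, map_smul, d_node, smul_add, Finset.sum_add_distrib]
  rw [← add_assoc, ← Finset.sum_add_distrib]
  have h1 : ∀ i, ((prefixSign (p - 1) q i : ℤ) : k) = - ((prefixSign p q i : ℤ) : k) := by
    intro i
    have : prefixSign (p - 1) q i = - prefixSign p q i := by
      unfold prefixSign
      rw [show p - 1 + ∑ j ∈ Finset.univ.filter (· < i), q j =
        (p + ∑ j ∈ Finset.univ.filter (· < i), q j) - 1 by ring, Int.negOnePow_sub,
        Int.negOnePow_one, mul_neg_one]
    rw [this]; push_cast; rfl
  simp only [h1, neg_smul, neg_add_cancel, Finset.sum_const_zero, zero_add, Finset.smul_sum,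
    smul_smul]
  have hdiag : ∀ i, node top lab (sum_update_sub_one _ i (sum_update_sub_one q i h))
      (fun l => shift N ar _ i l (shift N ar q i l (bot l))) = 0 := by
    intro i
    refine MultilinearMap.map_coord_zero _ i ?_
    unfold shift
    rw [dif_pos rfl, dif_pos rfl, N.dTo_dTo]
  rw [← Finset.sum_product']
  refine Finset.sum_involution (fun x _ => (x.2, x.1)) ?_ ?_ (by simp) (by simp)
  · rintro ⟨i, j⟩ -
    dsimp only
    by_cases hij : i = j
    · subst hij
      rw [hdiag, smul_zero, add_zero]
    · rw [← Int.cast_mul, ← Int.cast_mul, ← Units.val_mul, ← Units.val_mul,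
        prefixSign_cross p q hij, Units.val_neg, Int.cast_neg, neg_smul, neg_add_eq_zero]
      congr 1
      refine node_congr _ _ _ _ _ _ (fun l => ?_) fun l => ?_
      · by_cases hi : l = i
        · subst hi; simp [hij]
        · by_cases hj : l = j
          · subst hj; simp [hi]
          · simp [hi, hj]
      · unfold shift
        by_cases hi : l = i
        · have hj : l ≠ j := fun h => hij (hi.symm.trans h)
          simp only [dif_pos hi, dif_neg hj, dTo_castTo, castTo_dTo]
        · by_cases hj : l = j
          · simp only [dif_pos hj, dif_neg hi, dTo_castTo, castTo_dTo]
          · simp only [dif_neg hi, dif_neg hj, castTo_castTo]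
  · rintro ⟨i, j⟩ - hne heq
    obtain rfl : j = i := (Prod.mk.injEq _ _ _ _ ▸ heq).1
    exact hne (by rw [hdiag, smul_zero])

theorem d_act (σ : Perm (Fin n)) (x : CompX M N n r) : d (act σ x) = act σ (d x) := by
  suffices h : (d ∘ₗ act σ : CompX M N n r →ₗ[k] _) = act σ ∘ₗ d from LinearMap.congr_fun h x
  refine hom_ext fun t => ?_
  obtain ⟨m, p, top, ar, q, bot, lab, h⟩ := t
  simp only [LinearMap.comp_apply, act_mk, d_mk, dTree, map_add, map_sum, dBot_apply, map_smul]
  simp only [act_node]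

theorem act_one (x : CompX M N n r) : act 1 x = x := by
  suffices h : (act 1 : CompX M N n r →ₗ[k] _) = LinearMap.id from LinearMap.congr_fun h x
  refine hom_ext fun t => ?_
  rw [act_mk]; rfl

theorem act_mul (σ τ : Perm (Fin n)) (x : CompX M N n r) : act (σ * τ) x = act τ (act σ x) := by
  suffices h : (act (σ * τ) : CompX M N n r →ₗ[k] _) = act τ ∘ₗ act σ from LinearMap.congr_fun h x
  refine hom_ext fun t => ?_
  rw [LinearMap.comp_apply, act_mk, act_mk, act_mk]; rfl

end CompX

/-- The composite product `M ∘ N` of dg `S`-modules. -/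
@[reducible] noncomputable def comp (M N : DGSMod k) : DGSMod k where
  X := CompX M N
  act := CompX.act
  act_one := CompX.act_one
  act_mul := CompX.act_mul
  d := CompX.d
  d_d := CompX.d_d
  d_act := CompX.d_act

end DGSMod

namespace DGSMod

variable {k : Type u} [CommRing k]

/-- Morphisms of graded `S`-modules, of degree `0`; commuting with `d` is not required here. -/
structure SHom (M N : DGSMod k) where
  map : ∀ {n : ℕ} {r : ℤ}, M.X n r →ₗ[k] N.X n r
  map_act : ∀ {n : ℕ} {r : ℤ} (σ : Perm (Fin n)) (x : M.X n r), map (M.act σ x) = N.act σ (map x)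

/-- The identity. -/
def SHom.id (M : DGSMod k) : SHom M M := ⟨LinearMap.id, fun _ _ => rfl⟩

namespace CompX

variable {M M' N N' : DGSMod k} {n : ℕ} {r : ℤ}

/-- The map `f ∘ g`, sending `μ ∘ (ν_1, …, ν_m)` to `f(μ) ∘ (g(ν_1), …, g(ν_m))`. -/
noncomputable def map (f : SHom M M') (g : SHom N N') : CompX M N n r →ₗ[k] CompX M' N' n r :=
  lift (fun t => node (f.map t.top) t.lab t.deg fun i => g.map (t.bot i))
    { top_add := fun m p x y ar q bot lab h => by simp only [map_add, node_add]
      top_smul := fun m p c x ar q bot lab h => by simp only [map_smul, node_smul]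
      bot_add := fun m p top ar q bot i x y lab h =>
        ((node (f.map top) lab h).compLinearMap fun i => g.map).map_update_add bot i x y
      bot_smul := fun m p top ar q bot i c x lab h =>
        ((node (f.map top) lab h).compLinearMap fun i => g.map).map_update_smul bot i c x
      bot_act := fun m p top ar q bot τ lab h => by simp only [g.map_act, node_bot_act]
      top_act := fun m p top ar q bot σ lab h h' => by simp only [f.map_act, node_top_act] }

theorem map_act (f : SHom M M') (g : SHom N N') (σ : Perm (Fin n)) (x : CompX M N n r) :
    map f g (act σ x) = act σ (map f g x) := by
  suffices h : (map f g ∘ₗ act σ : CompX M N n r →ₗ[k] CompX M' N' n r) = act σ ∘ₗ map f g from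
    LinearMap.congr_fun h x
  refine hom_ext fun t => ?_
  simp only [LinearMap.comp_apply, map, act_mk, lift_mk, act_node]

end CompX

/-- The morphism `f ∘ g : M ∘ N → M' ∘ N'` of the composite products (not the composition of maps). -/
noncomputable def SHom.comp {M M' N N' : DGSMod k} (f : SHom M M') (g : SHom N N') :
    SHom (M.comp N) (M'.comp N') where
  map := CompX.map f g
  map_act := CompX.map_act f g

/-- The unit `I`: `k` in arity `1` and degree `0`, zero elsewhere. -/
@[reducible] noncomputable def unit (k : Type u) [CommRing k] : DGSMod k where
  X n r := ↥(if n = 1 ∧ r = 0 then ⊤ else ⊥ : Submodule k k)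
  act _ := LinearMap.id
  act_one _ := rfl
  act_mul _ _ _ := rfl
  d := 0
  d_d _ := rfl
  d_act _ _ := rfl

/-- The element `1` of the unit `I`. -/
def unit.one : (unit k).X 1 0 := ⟨1, by simp⟩

open CompX in
/-- The canonical isomorphism `M ≅ I ∘ M`, `x ↦ 1 ∘ (x)`. -/
noncomputable def leftUnitorInv (M : DGSMod k) {n : ℕ} {r : ℤ} (x : M.X n r) :
    ((unit k).comp M).X n r :=
  (node (unit.one : (unit k).X 1 0) (ar := fun _ => n) (q := fun _ => r)
    (Equiv.uniqueSigma fun _ : Fin 1 => Fin n) (by simp) fun _ => x : CompX (unit k) M n r)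

open CompX in
/-- The canonical isomorphism `M ≅ M ∘ I`, `x ↦ x ∘ (1, …, 1)`. -/
noncomputable def rightUnitorInv (M : DGSMod k) {n : ℕ} {r : ℤ} (x : M.X n r) :
    (M.comp (unit k)).X n r :=
  (node x (ar := fun _ => 1) (q := fun _ => 0)
    (Equiv.sigmaUnique (Fin n) fun _ => Fin 1) (by simp) fun _ => unit.one : CompX M (unit k) n r)

/-! ### The associator

`(M ∘ N) ∘ P ≅ M ∘ (N ∘ P)`. An element `(μ ∘ (ν_1, …, ν_l)) ∘ (ρ_1, …, ρ_m)`, where the `t`-th input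
of `ν_i` is grafted to `ρ_j` with `j = e ⟨i, t⟩`, goes to `± μ ∘ (ν_1 ∘ (…), …, ν_l ∘ (…))` with the same
underlying tree and the same labels of the inputs. The sign is the Koszul sign of reordering the
symbols from `ν_1, …, ν_l, ρ_1, …, ρ_m` to `ν_1, ρ_{e ⟨1, 1⟩}, …, ν_2, ρ_{e ⟨2, 1⟩}, …`. -/

section assoc

variable {M N P : DGSMod k} {n m : ℕ} {r p : ℤ}

/-- The labels of the inputs after reassociation, when `ε i` numbers the inputs above `ν_i`: they are
such that the underlying labelled tree does not change. -/
def assocLab {l : ℕ} {b : Fin l → ℕ} {a : Fin m → ℕ} (e : (Σ i, Fin (b i)) ≃ Fin m)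
    (lab : (Σ j, Fin (a j)) ≃ Fin n) {c : Fin l → ℕ}
    (ε : ∀ i, (Σ t : Fin (b i), Fin (a (e ⟨i, t⟩))) ≃ Fin (c i)) : (Σ i, Fin (c i)) ≃ Fin n :=
  (Equiv.sigmaCongrRight fun i => (ε i).symm).trans <|
    (Equiv.sigmaAssoc fun i t => Fin (a (e ⟨i, t⟩))).symm.trans <|
      (Equiv.sigmaCongrLeft (β := fun j => Fin (a j)) e).trans lab

theorem assocLab_apply {l : ℕ} {b : Fin l → ℕ} {a : Fin m → ℕ} (e : (Σ i, Fin (b i)) ≃ Fin m)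
    (lab : (Σ j, Fin (a j)) ≃ Fin n) {c : Fin l → ℕ}
    (ε : ∀ i, (Σ t : Fin (b i), Fin (a (e ⟨i, t⟩))) ≃ Fin (c i)) (i : Fin l) (t : Fin (b i))
    (y : Fin (a (e ⟨i, t⟩))) : assocLab e lab ε ⟨i, ε i ⟨t, y⟩⟩ = lab ⟨e ⟨i, t⟩, y⟩ := by
  have : (Equiv.sigmaCongrRight fun i => (ε i).symm) ⟨i, ε i ⟨t, y⟩⟩ = ⟨i, ⟨t, y⟩⟩ := by simp
  rw [assocLab, Equiv.trans_apply, this]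
  rfl

/-- The degrees of the symbols: `⟨i, none⟩` is `ν_i` and `⟨i, some t⟩` is `ρ_{e ⟨i, t⟩}`. -/
def assocDeg {l : ℕ} {b : Fin l → ℕ} (e : (Σ i, Fin (b i)) ≃ Fin m) (w : Fin l → ℤ)
    (q : Fin m → ℤ) : (Σ i, Option (Fin (b i))) → ℤ
  | ⟨i, none⟩ => w i
  | ⟨i, some t⟩ => q (e ⟨i, t⟩)

/-- The order of the symbols before reassociation. -/
def assocBefore {l : ℕ} {b : Fin l → ℕ} (e : (Σ i, Fin (b i)) ≃ Fin m) :
    (Σ i, Option (Fin (b i))) → ℕ ×ₗ ℕ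
  | ⟨i, none⟩ => toLex (0, (i : ℕ))
  | ⟨i, some t⟩ => toLex (1, (e ⟨i, t⟩ : ℕ))

/-- The position of a symbol in its block. -/
def slot {b : ℕ} : Option (Fin b) → ℕ
  | none => 0
  | some t => (t : ℕ) + 1

/-- The order of the symbols after reassociation. -/
def assocAfter {l : ℕ} {b : Fin l → ℕ} (x : Σ i, Option (Fin (b i))) : Fin l ×ₗ ℕ :=
  toLex (x.1, slot x.2)

/-- The Koszul sign of the reassociation. -/
def assocSign {l : ℕ} {b : Fin l → ℕ} (e : (Σ i, Fin (b i)) ≃ Fin m) (w : Fin l → ℤ)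
    (q : Fin m → ℤ) : ℤˣ :=
  koszulSign (assocDeg e w q) (assocBefore e) assocAfter

theorem assoc_deg {l : ℕ} {b : Fin l → ℕ} (e : (Σ i, Fin (b i)) ≃ Fin m) (w : Fin l → ℤ)
    (q : Fin m → ℤ) {p' : ℤ} (h' : p' + ∑ i, w i = p) (h : p + ∑ j, q j = r) :
    p' + ∑ i, (w i + ∑ t, q (e ⟨i, t⟩)) = r := by
  rw [Finset.sum_add_distrib, ← Fintype.sum_sigma' (fun i t => q (e ⟨i, t⟩)), ← add_assoc, h', ← h]
  exact congrArg (p + ·) (Equiv.sum_comp e q)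

open CompX

/-- The reassociated tree `μ ∘ (ν_1 ∘ (ρ, …), …, ν_l ∘ (…, ρ))`, without the sign. -/
noncomputable def assocNode (s : Tree M N m p) {a : Fin m → ℕ} {q : Fin m → ℤ}
    (lab : (Σ j, Fin (a j)) ≃ Fin n) (h : p + ∑ j, q j = r) {c : Fin s.m → ℕ}
    (ε : ∀ i, (Σ t : Fin (s.ar i), Fin (a (s.lab ⟨i, t⟩))) ≃ Fin (c i))
    (ρ : ∀ j, P.X (a j) (q j)) : CompX M (N.comp P) n r :=
  node (N := N.comp P) s.top (assocLab s.lab lab ε) (assoc_deg s.lab s.q q s.deg h) fun i =>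
    (node (s.bot i) (ε i) rfl fun t => ρ (s.lab ⟨i, t⟩) : CompX N P (c i) _)

theorem assocNode_indep (s : Tree M N m p) {a : Fin m → ℕ} {q : Fin m → ℤ}
    (lab : (Σ j, Fin (a j)) ≃ Fin n) (h : p + ∑ j, q j = r) {c c' : Fin s.m → ℕ}
    (ε : ∀ i, (Σ t : Fin (s.ar i), Fin (a (s.lab ⟨i, t⟩))) ≃ Fin (c i))
    (ε' : ∀ i, (Σ t : Fin (s.ar i), Fin (a (s.lab ⟨i, t⟩))) ≃ Fin (c' i))
    (ρ : ∀ j, P.X (a j) (q j)) : assocNode s lab h ε ρ = assocNode s lab h ε' ρ := by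
  obtain rfl : c = c' := funext fun i => by
    simpa using Fintype.card_congr ((ε i).symm.trans (ε' i))
  have key : ∀ i, (node (s.bot i) (ε i) rfl fun t => ρ (s.lab ⟨i, t⟩) : CompX N P (c i) _) =
      (N.comp P).act ((ε i).symm.trans (ε' i))
        (node (s.bot i) (ε' i) rfl fun t => ρ (s.lab ⟨i, t⟩) : CompX N P (c i) _) := by
    intro i
    refine Eq.trans ?_ (act_node (s.bot i) (ε' i) rfl _ _).symm
    exact node_lab_congr _ _ _ fun y => by simp
  unfold assocNode
  simp_rw [key]
  rw [node_bot_act]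
  exact node_lab_congr _ _ _ fun y => by simp [assocLab]

/-- The reassociated tree with its sign, the inputs above `ν_i` being numbered in order. -/
noncomputable def assocTree {a : Fin m → ℕ} {q : Fin m → ℤ}
    (lab : (Σ j, Fin (a j)) ≃ Fin n) (h : p + ∑ j, q j = r) (ρ : ∀ j, P.X (a j) (q j))
    (s : Tree M N m p) : CompX M (N.comp P) n r :=
  ((assocSign s.lab s.q q : ℤ) : k) • assocNode s lab h (fun _ => finSigmaFinEquiv) ρ

theorem assocBefore_injective {l : ℕ} {b : Fin l → ℕ} (e : (Σ i, Fin (b i)) ≃ Fin m) :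
    Function.Injective (assocBefore e) := by
  rintro ⟨i, _ | t⟩ ⟨j, _ | s⟩ h
  · have := congrArg (fun z => (ofLex z).2) h
    simp only [assocBefore, ofLex_toLex] at this
    rw [Fin.ext this]
  · have := congrArg (fun z => (ofLex z).1) h
    simp [assocBefore] at this
  · have := congrArg (fun z => (ofLex z).1) h
    simp [assocBefore] at this
  · have := congrArg (fun z => (ofLex z).2) h
    simp only [assocBefore, ofLex_toLex] at this
    have := e.injective (Fin.ext this)
    rw [Sigma.mk.injEq] at this
    obtain ⟨rfl, h2⟩ := this
    rw [eq_of_heq h2]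

theorem slot_injective {b : ℕ} : Function.Injective (slot (b := b)) := by
  rintro (_ | t) (_ | s) h <;> simp [slot] at h ⊢
  exact Fin.ext h

theorem assocAfter_injective {l : ℕ} {b : Fin l → ℕ} :
    Function.Injective (assocAfter (b := b)) := by
  rintro ⟨i, x⟩ ⟨j, y⟩ h
  have h1 := congrArg (fun z => (ofLex z).1) h
  have h2 := congrArg (fun z => (ofLex z).2) h
  simp only [assocAfter, ofLex_toLex] at h1 h2
  subst h1
  rw [slot_injective h2]

/-- The sign when the inputs of the middle level are permuted. -/
theorem assocSign_bot_act {l : ℕ} {b : Fin l → ℕ} (e : (Σ i, Fin (b i)) ≃ Fin m) (w : Fin l → ℤ)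
    (q : Fin m → ℤ) (τ : ∀ i, Perm (Fin (b i))) :
    assocSign e w q * ∏ i, koszulSign (fun t => q (e ⟨i, t⟩)) (fun t => t) (fun t => τ i t) =
      assocSign ((Equiv.sigmaCongrRight fun i => (τ i).symm).trans e) w q := by
  have hφ := koszulSign_comp (Equiv.sigmaCongrRight fun i => Equiv.optionCongr (τ i))
    (assocDeg ((Equiv.sigmaCongrRight fun i => (τ i).symm).trans e) w q)
    (assocBefore ((Equiv.sigmaCongrRight fun i => (τ i).symm).trans e)) assocAfter
  have h1 : (fun x => assocDeg ((Equiv.sigmaCongrRight fun i => (τ i).symm).trans e) w q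
      ((Equiv.sigmaCongrRight fun i => Equiv.optionCongr (τ i)) x)) = assocDeg e w q := by
    funext ⟨i, x⟩
    cases x <;> simp [assocDeg]
  have h2 : (fun x => assocBefore ((Equiv.sigmaCongrRight fun i => (τ i).symm).trans e)
      ((Equiv.sigmaCongrRight fun i => Equiv.optionCongr (τ i)) x)) = assocBefore e := by
    funext ⟨i, x⟩
    cases x <;> simp [assocBefore]
  rw [h1, h2] at hφ
  rw [assocSign, assocSign, ← hφ, ← koszulSign_mul _ _ assocAfter
    (fun x => assocAfter ((Equiv.sigmaCongrRight fun i => Equiv.optionCongr (τ i)) x))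
    (assocBefore_injective e) assocAfter_injective
    (assocAfter_injective.comp (Equiv.injective _))]
  congr 1
  refine Eq.trans ?_ (koszulSign_inside (assocDeg e w q) (fun i x => slot x)
    (fun i x => slot ((τ i).optionCongr x))).symm
  refine Finset.prod_congr rfl fun i _ => ?_
  rw [koszulSign_option _ _ _ rfl rfl]
  refine koszulSign_congr _ _ _ _ _ ?_ ?_ <;> intro x y <;> simp [slot]

theorem koszulSign_before {l : ℕ} {b : Fin l → ℕ} (D : (Σ i, Option (Fin (b i))) → ℤ)
    (u u' : (Σ i, Option (Fin (b i))) → ℕ ×ₗ ℕ) (g g' : Fin l → ℕ) (f f' : (Σ i, Fin (b i)) → ℕ)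
    (h1 : ∀ i, u ⟨i, none⟩ = toLex (0, g i)) (h2 : ∀ i t, u ⟨i, some t⟩ = toLex (1, f ⟨i, t⟩))
    (h1' : ∀ i, u' ⟨i, none⟩ = toLex (0, g' i))
    (h2' : ∀ i t, u' ⟨i, some t⟩ = toLex (1, f' ⟨i, t⟩)) :
    koszulSign D u u' = koszulSign (fun i => D ⟨i, none⟩) g g' *
      koszulSign (fun x : Σ i, Fin (b i) => D ⟨x.1, some x.2⟩) f f' := by
  unfold koszulSign
  simp only [Fintype.prod_sigma, Fintype.prod_option, Finset.prod_mul_distrib, h1, h2, h1', h2',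
    Prod.Lex.toLex_lt_toLex]
  simp

/-- The sign when the inputs of the top level are permuted. -/
theorem assocSign_top_act {l : ℕ} {b : Fin l → ℕ} (e : (Σ i, Fin (b i)) ≃ Fin m) (w : Fin l → ℤ)
    (q : Fin m → ℤ) (σ : Perm (Fin l)) :
    assocSign e w q * koszulSign (fun i => w i + ∑ t, q (e ⟨i, t⟩)) (fun i => i) (fun i => σ i) =
      koszulSign w (fun i => i) (fun i => σ i) *
        assocSign ((Equiv.sigmaCongrLeft (β := fun i => Fin (b i)) σ.symm).trans e)
          (fun i => w (σ.symm i)) q := by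
  let u' : (Σ i, Option (Fin (b i))) → ℕ ×ₗ ℕ := fun x => match x with
    | ⟨i, none⟩ => toLex (0, (σ i : ℕ))
    | ⟨i, some t⟩ => toLex (1, (e ⟨i, t⟩ : ℕ))
  let v' : (Σ i, Option (Fin (b i))) → Fin l ×ₗ ℕ := fun x => toLex (σ x.1, slot x.2)
  have hu' : Function.Injective u' := by
    have : u' = fun x => assocBefore ((Equiv.sigmaCongrLeft (β := fun i => Fin (b i)) σ.symm).trans e)
        ((Equiv.sigmaCongrLeft (β := fun i => Option (Fin (b i))) σ.symm).symm x) := by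
      funext x
      obtain ⟨x, rfl⟩ := (Equiv.sigmaCongrLeft (β := fun i => Option (Fin (b i))) σ.symm).surjective x
      rw [Equiv.symm_apply_apply]
      obtain ⟨i, _ | t⟩ := x <;> simp [u', assocBefore, Equiv.sigmaCongrLeft]
    rw [this]
    exact (assocBefore_injective _).comp (Equiv.injective _)
  have hv' : Function.Injective v' := by
    rintro ⟨i, x⟩ ⟨j, y⟩ h
    have h1 := congrArg (fun z => (ofLex z).1) h
    have h2 := congrArg (fun z => (ofLex z).2) h
    simp only [v', ofLex_toLex, EmbeddingLike.apply_eq_iff_eq] at h1 h2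
    subst h1
    rw [slot_injective h2]
  have key : assocSign ((Equiv.sigmaCongrLeft (β := fun i => Fin (b i)) σ.symm).trans e)
      (fun i => w (σ.symm i)) q = koszulSign (assocDeg e w q) u' v' := by
    rw [← koszulSign_comp (Equiv.sigmaCongrLeft (β := fun i => Option (Fin (b i))) σ.symm)]
    unfold assocSign
    congr 1
    · funext ⟨i, x⟩
      cases x <;> rfl
    · funext ⟨i, x⟩
      cases x <;> simp [u', assocBefore, Equiv.sigmaCongrLeft]
    · funext ⟨i, x⟩
      simp [v', assocAfter, Equiv.sigmaCongrLeft]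
  have e1 : koszulSign (assocDeg e w q) (assocBefore e) u' =
      koszulSign w (fun i => i) (fun i => σ i) := by
    rw [koszulSign_before _ _ _ (fun i => (i : ℕ)) (fun i => (σ i : ℕ)) (fun x => (e x : ℕ))
      (fun x => (e x : ℕ)) (fun _ => rfl) (fun _ _ => rfl) (fun _ => rfl) (fun _ _ => rfl),
      koszulSign_self, mul_one]
    rfl
  have e2 : koszulSign (assocDeg e w q) assocAfter v' =
      koszulSign (fun i => w i + ∑ t, q (e ⟨i, t⟩)) (fun i => i) (fun i => σ i) := by
    refine (koszulSign_blocks (assocDeg e w q) (fun _ x => slot x) σ).trans ?_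
    simp only [Fintype.sum_option]
    rfl
  rw [key, ← e1, ← e2, assocSign, koszulSign_mul _ _ _ _ (assocBefore_injective e)
    assocAfter_injective hv', koszulSign_mul _ _ _ _ (assocBefore_injective e) hu' hv']

/-- The sign when the bottom level is permuted. -/
theorem assocSign_outer {l : ℕ} {b : Fin l → ℕ} (e : (Σ i, Fin (b i)) ≃ Fin m) (w : Fin l → ℤ)
    (q : Fin m → ℤ) (σ : Perm (Fin m)) :
    assocSign (e.trans σ.symm) w q =
      koszulSign q (fun i => i) (fun i => σ i) * assocSign e w (fun j => q (σ.symm j)) := by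
  have hD : assocDeg (e.trans σ.symm) w q = assocDeg e w (fun j => q (σ.symm j)) := by
    funext ⟨i, x⟩
    cases x <;> rfl
  have e1 : koszulSign (assocDeg e w (fun j => q (σ.symm j))) (assocBefore (e.trans σ.symm))
      (assocBefore e) = koszulSign q (fun i => i) (fun i => σ i) := by
    rw [koszulSign_before _ _ _ (fun i => (i : ℕ)) (fun i => (i : ℕ))
      (fun x => ((e.trans σ.symm) x : ℕ)) (fun x => (e x : ℕ)) (fun _ => rfl) (fun _ _ => rfl)
      (fun _ => rfl) (fun _ _ => rfl), koszulSign_self, one_mul,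
      ← koszulSign_comp (e.trans σ.symm) q]
    refine koszulSign_congr _ _ _ _ _ (fun _ _ => Iff.rfl) fun x y => ?_
    simp
  rw [← e1, assocSign, assocSign, hD, koszulSign_mul _ _ _ _ (assocBefore_injective _)
    (assocBefore_injective _) assocAfter_injective]

theorem castTo_node {l : ℕ} {p' : ℤ} (x : M.X l p') {ar : Fin l → ℕ} {q : Fin l → ℤ} {r' : ℤ}
    (lab : (Σ i, Fin (ar i)) ≃ Fin n) (h : p' + ∑ i, q i = r) (bot : ∀ i, N.X (ar i) (q i))
    (hr : r' = r) : (M.comp N).castTo hr (node x lab h bot : CompX M N n r) =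
      (node x lab (h.trans hr.symm) bot : CompX M N n r') := by
  subst hr; rfl

theorem assocTree_respects {a : Fin m → ℕ} {q : Fin m → ℤ}
    (lab : (Σ j, Fin (a j)) ≃ Fin n) (h : p + ∑ j, q j = r) (ρ : ∀ j, P.X (a j) (q j)) :
    Respects (assocTree lab h ρ : Tree M N m p → CompX M (N.comp P) n r) where
  top_add l p' x y b w ν e h' := by simp only [assocTree, assocNode, node_add, smul_add]
  top_smul l p' c x b w ν e h' := by simp only [assocTree, assocNode, node_smul, smul_comm c]
  bot_add l p' μ b w ν i x y e h' := by
    have hupd : ∀ z, (fun j => (node (Function.update ν i z j) finSigmaFinEquiv rfl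
        fun t => ρ (e ⟨j, t⟩) : CompX N P _ _)) =
        Function.update (fun j => (node (ν j) finSigmaFinEquiv rfl
          fun t => ρ (e ⟨j, t⟩) : CompX N P _ _)) i
          (node z finSigmaFinEquiv rfl fun t => ρ (e ⟨i, t⟩)) := by
      intro z
      funext j
      by_cases hj : j = i
      · subst hj; simp
      · simp [hj]
    simp only [assocTree, assocNode, hupd, node_add, MultilinearMap.map_update_add, smul_add]
  bot_smul l p' μ b w ν i c x e h' := by
    have hupd : ∀ z, (fun j => (node (Function.update ν i z j) finSigmaFinEquiv rfl
        fun t => ρ (e ⟨j, t⟩) : CompX N P _ _)) =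
        Function.update (fun j => (node (ν j) finSigmaFinEquiv rfl
          fun t => ρ (e ⟨j, t⟩) : CompX N P _ _)) i
          (node z finSigmaFinEquiv rfl fun t => ρ (e ⟨i, t⟩)) := by
      intro z
      funext j
      by_cases hj : j = i
      · subst hj; simp
      · simp [hj]
    simp only [assocTree, assocNode, hupd, node_smul, MultilinearMap.map_update_smul, smul_comm c]
  bot_act l p' μ b w ν τ e h' := by
    unfold assocTree
    rw [assocNode_indep ⟨l, p', μ, b, w, ν, (Equiv.sigmaCongrRight fun i => (τ i).symm).trans e, h'⟩
      lab h (fun _ => finSigmaFinEquiv) (fun i =>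
        (Equiv.sigmaCongrLeft (β := fun t => Fin (a (e ⟨i, t⟩))) (τ i).symm).trans finSigmaFinEquiv)]
    unfold assocNode
    simp only [node_top_act]
    rw [MultilinearMap.map_smul_univ, smul_smul, ← assocSign_bot_act]
    push_cast
    congr 1
    have hq : ∀ i, w i + ∑ t, q (e ⟨i, (τ i).symm t⟩) = w i + ∑ t, q (e ⟨i, t⟩) := fun i =>
      congrArg (w i + ·) (Equiv.sum_comp (τ i).symm fun t => q (e ⟨i, t⟩))
    refine Eq.trans (node_lab_congr _ _ _ ?_) (node_congr _ _ _ _ _ _ hq fun i =>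
      (castTo_node _ _ _ _ (hq i)).symm)
    rintro ⟨i, y⟩
    obtain ⟨⟨t, y⟩, rfl⟩ := ((Equiv.sigmaCongrLeft (β := fun t => Fin (a (e ⟨i, t⟩)))
      (τ i).symm).trans finSigmaFinEquiv).surjective y
    exact (assocLab_apply e lab (fun _ => finSigmaFinEquiv) i ((τ i).symm t) y).trans
      (assocLab_apply ((Equiv.sigmaCongrRight fun i => (τ i).symm).trans e) lab (fun i =>
        (Equiv.sigmaCongrLeft (β := fun t => Fin (a (e ⟨i, t⟩))) (τ i).symm).trans
          finSigmaFinEquiv) i t y).symm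
  top_act l p' μ b w ν σ e h' h'' := by
    simp only [assocTree, assocNode, node_top_act, smul_smul]
    rw [← Int.cast_mul, ← Int.cast_mul, ← Units.val_mul, ← Units.val_mul, assocSign_top_act]
    congr 1
    refine node_lab_congr _ _ _ ?_
    rintro ⟨i, x⟩
    rfl

/-- The associator as a function of the lower composite `μ ∘ (ν_1, …, ν_l)`. -/
noncomputable def assocInner {a : Fin m → ℕ} {q : Fin m → ℤ}
    (lab : (Σ j, Fin (a j)) ≃ Fin n) (h : p + ∑ j, q j = r) (ρ : ∀ j, P.X (a j) (q j)) :
    CompX M N m p →ₗ[k] CompX M (N.comp P) n r :=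
  lift (assocTree lab h ρ) (assocTree_respects lab h ρ)

theorem assocNode_update (s : Tree M N m p) {a : Fin m → ℕ} {q : Fin m → ℤ}
    (lab : (Σ j, Fin (a j)) ≃ Fin n) (h : p + ∑ j, q j = r) {c : Fin s.m → ℕ}
    (ε : ∀ i, (Σ t : Fin (s.ar i), Fin (a (s.lab ⟨i, t⟩))) ≃ Fin (c i))
    (ρ : ∀ j, P.X (a j) (q j)) (i : Fin s.m) (t : Fin (s.ar i))
    (z : P.X (a (s.lab ⟨i, t⟩)) (q (s.lab ⟨i, t⟩))) :
    assocNode s lab h ε (Function.update ρ (s.lab ⟨i, t⟩) z) =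
      node (N := N.comp P) s.top (assocLab s.lab lab ε) (assoc_deg s.lab s.q q s.deg h)
        (Function.update (fun i =>
          (node (s.bot i) (ε i) rfl fun t => ρ (s.lab ⟨i, t⟩) : CompX N P (c i) _)) i
          (node (s.bot i) (ε i) rfl (Function.update (fun t => ρ (s.lab ⟨i, t⟩)) t z))) := by
  unfold assocNode
  congr 1
  funext i'
  by_cases hi : i' = i
  · subst hi
    rw [Function.update_self]
    congr 1
    funext t'
    by_cases ht : t' = t
    · subst ht; simp
    · simp [ht]
  · rw [Function.update_of_ne hi]
    congr 1
    funext t'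
    rw [Function.update_of_ne]
    intro h
    exact hi (congrArg Sigma.fst (s.lab.injective h))

theorem assocInner_respects : Respects (fun t : Tree (M.comp N) P n r =>
    (assocInner t.lab t.deg t.bot t.top : CompX M (N.comp P) n r)) where
  top_add m p x y a q ρ lab h := map_add _ _ _
  top_smul m p c x a q ρ lab h := map_smul _ _ _
  bot_add m p x a q ρ j y z lab h := by
    suffices H : (assocInner lab h (Function.update ρ j (y + z)) : CompX M N m p →ₗ[k] _) =
        assocInner lab h (Function.update ρ j y) + assocInner lab h (Function.update ρ j z) from
      LinearMap.congr_fun H x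
    refine hom_ext fun s => ?_
    rw [LinearMap.add_apply]
    simp only [assocInner, lift_mk, assocTree]
    obtain ⟨⟨i, t⟩, rfl⟩ := s.lab.surjective j
    simp only [assocNode_update, MultilinearMap.map_update_add, smul_add]
  bot_smul m p x a q ρ j c y lab h := by
    suffices H : (assocInner lab h (Function.update ρ j (c • y)) : CompX M N m p →ₗ[k] _) =
        c • assocInner lab h (Function.update ρ j y) from
      LinearMap.congr_fun H x
    refine hom_ext fun s => ?_
    rw [LinearMap.smul_apply]
    simp only [assocInner, lift_mk, assocTree]
    obtain ⟨⟨i, t⟩, rfl⟩ := s.lab.surjective j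
    simp only [assocNode_update, MultilinearMap.map_update_smul, smul_comm c]
  bot_act m p x a q ρ τ lab h := by
    suffices H : (assocInner lab h (fun j => P.act (τ j) (ρ j)) : CompX M N m p →ₗ[k] _) =
        assocInner ((Equiv.sigmaCongrRight fun i => (τ i).symm).trans lab) h ρ from
      LinearMap.congr_fun H x
    refine hom_ext fun s => ?_
    simp only [assocInner, lift_mk, assocTree]
    congr 1
    rw [assocNode_indep s ((Equiv.sigmaCongrRight fun i => (τ i).symm).trans lab) h _
      (fun i => (Equiv.sigmaCongrRight fun t => (τ (s.lab ⟨i, t⟩)).symm).trans finSigmaFinEquiv)]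
    unfold assocNode
    simp only [node_bot_act]
    refine node_lab_congr _ _ _ ?_
    rintro ⟨i, y⟩
    obtain ⟨⟨t, y⟩, rfl⟩ := finSigmaFinEquiv.surjective y
    have hassoc : ∀ y, (Equiv.sigmaAssoc fun i t => Fin (a (s.lab ⟨i, t⟩))).symm ⟨i, ⟨t, y⟩⟩ =
      ⟨⟨i, t⟩, y⟩ := fun _ => rfl
    simp [assocLab, Equiv.sigmaCongrLeft, hassoc]
  top_act m p x a q ρ σ lab h h' := by
    suffices H : (assocInner lab h ρ : CompX M N m p →ₗ[k] _) ∘ₗ CompX.act σ =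
        ((koszulSign q (fun i => i) (fun i => σ i) : ℤ) : k) •
        assocInner ((Equiv.sigmaCongrLeft (β := fun i => Fin (a i)) σ.symm).trans lab) h'
          (fun j => ρ (σ.symm j)) from
      LinearMap.congr_fun H x
    refine hom_ext fun s => ?_
    rw [LinearMap.comp_apply, LinearMap.smul_apply, act_mk]
    simp only [assocInner, lift_mk, assocTree, assocSign_outer, smul_smul]
    push_cast
    congr 1
    refine node_lab_congr _ _ _ ?_
    rintro ⟨i, y⟩
    rfl

/-- The associator `(M ∘ N) ∘ P → M ∘ (N ∘ P)`. -/
noncomputable def associator (M N P : DGSMod k) {n : ℕ} {r : ℤ} :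
    ((M.comp N).comp P).X n r →ₗ[k] (M.comp (N.comp P)).X n r :=
  lift _ assocInner_respects

end assoc
end DGSMod

namespace DGSMod

/-- The generators of `LieD[3]`, indexed by arity and degree: `l1` is `1`, `ln` is `λ_n`, and
`l312`, for example, is `λ_{3;1,2}`. -/
inductive LieGen : ℕ → ℤ → Type
  | l1 : LieGen 1 0
  | l2 : LieGen 2 1
  | l21 : LieGen 2 2
  | l211 : LieGen 2 3
  | l2111 : LieGen 2 4
  | l3 : LieGen 3 2
  | l31 : LieGen 3 3
  | l32 : LieGen 3 3
  | l311 : LieGen 3 4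
  | l312 : LieGen 3 4
  | l322 : LieGen 3 4
  | l4 : LieGen 4 3
  | l41 : LieGen 4 4
  | l42 : LieGen 4 4
  | l43 : LieGen 4 4
  | l5 : LieGen 5 4

namespace LieGen

/-- The cycle `(c_1 c_2 … c_s)`, with entries counted from `1`: it sends `c_1` to `c_2`, and so on. -/
def cyc {n : ℕ} [NeZero n] (c : List ℕ) : Perm (Fin n) :=
  (c.map fun i => Fin.ofNat n (i - 1)).formPerm

variable (k : Type u) [CommRing k]

/-- `LieD[3](n)_r`, the free `k[S_n]`-module on the generators: the basis element `(g, σ)` is `g ^ σ`. -/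
abbrev FreeX (n : ℕ) (r : ℤ) : Type u := LieGen n r × Perm (Fin n) →₀ k

variable {k} {n : ℕ} {r : ℤ}

/-- The basis element `g ^ σ`. -/
noncomputable def el (g : LieGen n r) (σ : Perm (Fin n)) : FreeX k n r := Finsupp.single (g, σ) 1

/-- The right action, `(g ^ τ) ^ σ = g ^ (τ σ)`. -/
noncomputable def freeAct (σ : Perm (Fin n)) : FreeX k n r →ₗ[k] FreeX k n r :=
  Finsupp.lmapDomain k k fun x => (x.1, x.2 * σ)

theorem freeAct_el (σ τ : Perm (Fin n)) (g : LieGen n r) :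
    freeAct σ (el g τ : FreeX k n r) = el g (τ * σ) := by
  simp [freeAct, el]

theorem freeAct_mul (σ τ : Perm (Fin n)) (x : FreeX k n r) :
    freeAct (σ * τ) x = freeAct τ (freeAct σ x) := by
  suffices h : (freeAct (σ * τ) : FreeX k n r →ₗ[k] _) = freeAct τ ∘ₗ freeAct σ from
    LinearMap.congr_fun h x
  refine Finsupp.lhom_ext' fun ⟨g, ρ⟩ => LinearMap.ext_ring ?_
  change freeAct (σ * τ) (el g ρ) = freeAct τ (freeAct σ (el g ρ))
  simp only [freeAct_el, mul_assoc]

theorem freeAct_one (x : FreeX k n r) : freeAct 1 x = x := by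
  simp only [freeAct, mul_one]
  exact Finsupp.mapDomain_id

/-- The differential on generators. -/
noncomputable def dGen : ∀ {n : ℕ} {r : ℤ}, LieGen n r → FreeX k n (r - 1)
  | _, _, l1 | _, _, l2 | _, _, l3 | _, _, l4 | _, _, l5 => 0
  | _, _, l21 => -el l2 1 - el l2 (cyc [1, 2])
  | _, _, l211 => -el l21 1 + el l21 (cyc [1, 2])
  | _, _, l2111 => -el l211 1 - el l211 (cyc [1, 2])
  | _, _, l31 => -el l3 1 - el l3 (cyc [1, 2])
  | _, _, l32 => -el l3 1 - el l3 (cyc [2, 3])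
  | _, _, l311 => -el l31 1 + el l31 (cyc [1, 2])
  | _, _, l312 => el l31 1 + el l31 (cyc [2, 3]) + el l31 (cyc [1, 3, 2])
      - el l32 1 - el l32 (cyc [1, 2]) - el l32 (cyc [1, 2, 3])
  | _, _, l322 => -el l32 1 + el l32 (cyc [2, 3])
  | _, _, l41 => -el l4 1 - el l4 (cyc [1, 2])
  | _, _, l42 => -el l4 1 - el l4 (cyc [2, 3])
  | _, _, l43 => -el l4 1 - el l4 (cyc [3, 4])

/-- The differential, the `S`-equivariant extension of its values on generators. -/
noncomputable def freeD : FreeX k n r →ₗ[k] FreeX k n (r - 1) :=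
  Finsupp.linearCombination k fun x => freeAct x.2 (dGen x.1)

theorem freeD_el (g : LieGen n r) (σ : Perm (Fin n)) :
    freeD (el g σ : FreeX k n r) = freeAct σ (dGen g) := by
  simp [freeD, el]

theorem freeD_act (σ : Perm (Fin n)) (x : FreeX k n r) :
    freeD (freeAct σ x) = freeAct σ (freeD x) := by
  suffices h : (freeD ∘ₗ freeAct σ : FreeX k n r →ₗ[k] _) = freeAct σ ∘ₗ freeD from
    LinearMap.congr_fun h x
  refine Finsupp.lhom_ext' fun ⟨g, ρ⟩ => LinearMap.ext_ring ?_
  change freeD (freeAct σ (el g ρ)) = freeAct σ (freeD (el g ρ))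
  rw [freeAct_el, freeD_el, freeD_el, freeAct_mul]

theorem freeD_dGen (g : LieGen n r) : freeD (dGen g : FreeX k n (r - 1)) = 0 := by
  have h2 : (cyc [1, 2] * cyc [1, 2] : Perm (Fin 2)) = 1 := by decide
  have h3 : (cyc [1, 2] * cyc [1, 2] : Perm (Fin 3)) = 1 := by decide
  have h3' : (cyc [2, 3] * cyc [2, 3] : Perm (Fin 3)) = 1 := by decide
  have e1 : (cyc [1, 2] * cyc [2, 3] : Perm (Fin 3)) = cyc [1, 2, 3] := by decide
  have e3 : (cyc [2, 3] * cyc [1, 2] : Perm (Fin 3)) = cyc [1, 3, 2] := by decide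
  have e4 : (cyc [2, 3] * cyc [1, 2, 3] : Perm (Fin 3)) = cyc [1, 3] := by decide
  have e2 : (cyc [1, 2] * cyc [1, 3, 2] : Perm (Fin 3)) = cyc [1, 3] := by decide
  cases g <;>
    simp only [dGen, map_zero, map_add, map_sub, map_neg, freeD_el, freeAct_el, one_mul, mul_one, h2, h3,
      h3', e1, e2, e3, e4]
  all_goals abel

theorem freeD_freeD (x : FreeX k n r) : freeD (freeD x) = 0 := by
  suffices h : (freeD ∘ₗ freeD : FreeX k n r →ₗ[k] _) = 0 from LinearMap.congr_fun h x
  refine Finsupp.lhom_ext' fun ⟨g, ρ⟩ => LinearMap.ext_ring ?_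
  change freeD (freeD (el g ρ)) = 0
  rw [freeD_el, freeD_act, freeD_dGen, map_zero]

end LieGen

open LieGen

/-- The `S`-free dg `S`-module `LieD[3]`. -/
@[reducible] noncomputable def LieD3 (k : Type u) [CommRing k] : DGSMod k where
  X := FreeX k
  act := freeAct
  act_one := freeAct_one
  act_mul := freeAct_mul
  d := freeD
  d_d := freeD_freeD
  d_act := freeD_act

namespace LieD3

variable {k : Type u} [CommRing k] {n m : ℕ} {r p : ℤ}

/-- A generator together with its arity and degree. -/
def S {n : ℕ} {r : ℤ} (g : LieGen n r) : Σ (n : ℕ) (r : ℤ), LieGen n r := ⟨n, r, g⟩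

/-- The element `(μ ∘ (ν_1, …, ν_m)) ^ σ`, for generators `μ` and `ν_i`. -/
noncomputable def tm (μ : LieGen m p) (ν : Fin m → Σ (n : ℕ) (r : ℤ), LieGen n r)
    (σ : Perm (Fin n)) (hn : ∑ i, (ν i).1 = n := by decide)
    (hr : p + ∑ i, (ν i).2.1 = r := by decide) : CompX (LieD3 k) (LieD3 k) n r :=
  CompX.act σ (CompX.node (M := LieD3 k) (N := LieD3 k) (el μ 1) (ar := fun i => (ν i).1)
    (q := fun i => (ν i).2.1) (finSigmaFinEquiv.trans (finCongr hn)) hr fun i => el (ν i).2.2 1)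

/-- The reduced decomposition of the generators. On `λ_n` it is that of the Koszul dual cooperad of the
Leibniz operad: the sum of
`(-1)^((j-1)(n-j) + ∑ (a-1)(i_a - 1)) sgn(σ) (λ_j ∘ (λ_{i_1}, …, λ_{i_j})) ^ σ` over `1 < j < n`, all
`i_1 + ⋯ + i_j = n`, and all `σ` such that `σ⁻¹` is increasing on each of the `j` blocks and the values
at the last places of the blocks increase from block to block. -/
noncomputable def redDecomp : ∀ {n : ℕ} {r : ℤ}, LieGen n r → CompX (LieD3 k) (LieD3 k) n r
  | _, _, .l1 => 0
  | _, _, .l2 => 0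
  | _, _, .l21 => 0
  | _, _, .l211 => 0
  | _, _, .l2111 => 0
  | _, _, .l3 =>
    -tm .l2 ![S .l2, S .l1] 1 + tm .l2 ![S .l1, S .l2] 1 - tm .l2 ![S .l1, S .l2] (cyc [1, 2])
  | _, _, .l31 =>
    tm .l2 ![S .l21, S .l1] 1
  | _, _, .l32 =>
    -tm .l21 ![S .l2, S .l1] 1 - tm .l2 ![S .l1, S .l21] 1 - tm .l21 ![S .l1, S .l2] (cyc [1, 2])
  | _, _, .l311 =>
    -tm .l2 ![S .l211, S .l1] 1
  | _, _, .l312 =>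
    -tm .l21 ![S .l21, S .l1] 1 - tm .l21 ![S .l1, S .l21] 1 - tm .l21 ![S .l1, S .l21] (cyc [1, 2])
    + tm .l211 ![S .l1, S .l2] (cyc [1, 3, 2])
  | _, _, .l322 =>
    -tm .l211 ![S .l2, S .l1] 1 + tm .l2 ![S .l1, S .l211] 1 - tm .l211 ![S .l1, S .l2] (cyc [1, 2])
  | _, _, .l4 =>
    tm .l2 ![S .l3, S .l1] 1 + tm .l2 ![S .l1, S .l3] 1 - tm .l2 ![S .l1, S .l3] (cyc [1, 2]) +
    tm .l2 ![S .l1, S .l3] (cyc [1, 2, 3]) - tm .l2 ![S .l2, S .l2] 1 +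
    tm .l2 ![S .l2, S .l2] (cyc [2, 3]) - tm .l2 ![S .l2, S .l2] (cyc [1, 3, 2]) +
    tm .l3 ![S .l2, S .l1, S .l1] 1 - tm .l3 ![S .l1, S .l2, S .l1] 1 +
    tm .l3 ![S .l1, S .l2, S .l1] (cyc [1, 2]) + tm .l3 ![S .l1, S .l1, S .l2] 1 -
    tm .l3 ![S .l1, S .l1, S .l2] (cyc [2, 3]) + tm .l3 ![S .l1, S .l1, S .l2] (cyc [1, 3, 2])
  | _, _, .l41 =>
    -tm .l2 ![S .l31, S .l1] 1 - tm .l2 ![S .l1, S .l31] (cyc [1, 2, 3]) + tm .l2 ![S .l21, S .l2] 1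
    + tm .l3 ![S .l21, S .l1, S .l1] 1 + tm .l31 ![S .l1, S .l1, S .l2] 1
  | _, _, .l42 =>
    -tm .l2 ![S .l32, S .l1] 1 - tm .l2 ![S .l1, S .l31] 1 + tm .l2 ![S .l21, S .l2] (cyc [1, 3, 2])
    + tm .l31 ![S .l2, S .l1, S .l1] 1 + tm .l31 ![S .l1, S .l2, S .l1] (cyc [1, 2]) -
    tm .l3 ![S .l1, S .l21, S .l1] 1 + tm .l31 ![S .l1, S .l1, S .l2] (cyc [1, 3, 2])
  | _, _, .l43 =>
    tm .l21 ![S .l1, S .l3] (cyc [1, 2, 3]) - tm .l2 ![S .l1, S .l32] 1 +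
    tm .l2 ![S .l1, S .l32] (cyc [1, 2]) + tm .l21 ![S .l3, S .l1] 1 - tm .l2 ![S .l2, S .l21] 1 -
    tm .l21 ![S .l2, S .l2] (cyc [1, 3, 2]) + tm .l21 ![S .l2, S .l2] (cyc [2, 3]) +
    tm .l32 ![S .l2, S .l1, S .l1] 1 - tm .l32 ![S .l1, S .l1, S .l2] (cyc [2, 3]) +
    tm .l32 ![S .l1, S .l1, S .l2] (cyc [1, 3, 2]) + tm .l3 ![S .l1, S .l1, S .l21] 1 -
    tm .l32 ![S .l1, S .l2, S .l1] 1 + tm .l32 ![S .l1, S .l2, S .l1] (cyc [1, 2])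
  | _, _, .l5 =>
    -tm .l2 ![S .l4, S .l1] 1 + tm .l2 ![S .l3, S .l2] 1 - tm .l2 ![S .l3, S .l2] (cyc [3, 4]) +
    tm .l2 ![S .l3, S .l2] (cyc [2, 4, 3]) - tm .l2 ![S .l3, S .l2] (cyc [1, 4, 3, 2]) -
    tm .l2 ![S .l2, S .l3] 1 + tm .l2 ![S .l2, S .l3] (cyc [2, 3]) -
    tm .l2 ![S .l2, S .l3] (cyc [2, 3, 4]) - tm .l2 ![S .l2, S .l3] (cyc [1, 3, 2]) +
    tm .l2 ![S .l2, S .l3] (cyc [1, 3, 4, 2]) - tm .l2 ![S .l2, S .l3] (cyc [1, 3] * cyc [2, 4]) +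
    tm .l2 ![S .l1, S .l4] 1 - tm .l2 ![S .l1, S .l4] (cyc [1, 2]) +
    tm .l2 ![S .l1, S .l4] (cyc [1, 2, 3]) - tm .l2 ![S .l1, S .l4] (cyc [1, 2, 3, 4]) +
    tm .l3 ![S .l3, S .l1, S .l1] 1 - tm .l3 ![S .l2, S .l2, S .l1] 1 +
    tm .l3 ![S .l2, S .l2, S .l1] (cyc [2, 3]) - tm .l3 ![S .l2, S .l2, S .l1] (cyc [1, 3, 2]) +
    tm .l3 ![S .l2, S .l1, S .l2] 1 + tm .l3 ![S .l2, S .l1, S .l2] (cyc [2, 4, 3]) -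
    tm .l3 ![S .l2, S .l1, S .l2] (cyc [3, 4]) - tm .l3 ![S .l2, S .l1, S .l2] (cyc [1, 4, 3, 2]) +
    tm .l3 ![S .l1, S .l3, S .l1] 1 - tm .l3 ![S .l1, S .l3, S .l1] (cyc [1, 2]) +
    tm .l3 ![S .l1, S .l3, S .l1] (cyc [1, 2, 3]) - tm .l3 ![S .l1, S .l2, S .l2] 1 +
    tm .l3 ![S .l1, S .l2, S .l2] (cyc [3, 4]) - tm .l3 ![S .l1, S .l2, S .l2] (cyc [2, 4, 3]) +
    tm .l3 ![S .l1, S .l2, S .l2] (cyc [1, 2]) -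
    tm .l3 ![S .l1, S .l2, S .l2] (cyc [1, 2] * cyc [3, 4]) +
    tm .l3 ![S .l1, S .l2, S .l2] (cyc [1, 2, 4, 3]) - tm .l3 ![S .l1, S .l2, S .l2] (cyc [1, 4, 3])
    + tm .l3 ![S .l1, S .l2, S .l2] (cyc [1, 4, 3, 2]) + tm .l3 ![S .l1, S .l1, S .l3] 1 -
    tm .l3 ![S .l1, S .l1, S .l3] (cyc [2, 3]) + tm .l3 ![S .l1, S .l1, S .l3] (cyc [2, 3, 4]) +
    tm .l3 ![S .l1, S .l1, S .l3] (cyc [1, 3, 2]) - tm .l3 ![S .l1, S .l1, S .l3] (cyc [1, 3, 4, 2])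
    + tm .l3 ![S .l1, S .l1, S .l3] (cyc [1, 3] * cyc [2, 4]) -
    tm .l4 ![S .l2, S .l1, S .l1, S .l1] 1 + tm .l4 ![S .l1, S .l2, S .l1, S .l1] 1 -
    tm .l4 ![S .l1, S .l2, S .l1, S .l1] (cyc [1, 2]) - tm .l4 ![S .l1, S .l1, S .l2, S .l1] 1 +
    tm .l4 ![S .l1, S .l1, S .l2, S .l1] (cyc [2, 3]) -
    tm .l4 ![S .l1, S .l1, S .l2, S .l1] (cyc [1, 3, 2]) + tm .l4 ![S .l1, S .l1, S .l1, S .l2] 1 -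
    tm .l4 ![S .l1, S .l1, S .l1, S .l2] (cyc [3, 4]) +
    tm .l4 ![S .l1, S .l1, S .l1, S .l2] (cyc [2, 4, 3]) -
    tm .l4 ![S .l1, S .l1, S .l1, S .l2] (cyc [1, 4, 3, 2])

/-- The full decomposition of the generators: `Δ(1) = 1 ∘ (1)`, and otherwise
`Δ(g) = 1 ∘ (g) + Δ̄(g) + g ∘ (1, …, 1)`. -/
noncomputable def decompGen : ∀ {n : ℕ} {r : ℤ}, LieGen n r → CompX (LieD3 k) (LieD3 k) n r
  | _, _, .l1 => tm .l1 ![S .l1] 1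
  | _, _, g => tm .l1 (fun _ => S g) 1 (by simp [S]) (by simp [S]) + redDecomp g
      + tm g (fun _ => S .l1) 1 (by simp [S]) (by simp [S])

/-- The decomposition map as a linear map: the `S`-equivariant extension of `decompGen`. -/
noncomputable def decompLin : FreeX k n r →ₗ[k] CompX (LieD3 k) (LieD3 k) n r :=
  Finsupp.linearCombination k fun x => CompX.act x.2 (decompGen x.1)

theorem decompLin_el (g : LieGen n r) (σ : Perm (Fin n)) :
    decompLin (el g σ : FreeX k n r) = CompX.act σ (decompGen g) := by
  simp [decompLin, el]

/-- The decomposition map `Δ : LieD[3] → LieD[3] ∘ LieD[3]`. -/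
noncomputable def decomp : SHom (LieD3 k) ((LieD3 k).comp (LieD3 k)) where
  map := decompLin
  map_act {n r} σ x := by
    suffices h : (decompLin ∘ₗ freeAct σ : FreeX k n r →ₗ[k] CompX (LieD3 k) (LieD3 k) n r) =
        CompX.act σ ∘ₗ decompLin from LinearMap.congr_fun h x
    refine Finsupp.lhom_ext' fun ⟨g, ρ⟩ => LinearMap.ext_ring ?_
    change decompLin (freeAct σ (el g ρ)) = CompX.act σ (decompLin (el g ρ))
    rw [freeAct_el, decompLin_el, decompLin_el, CompX.act_mul]

/-- The counit on generators: `1 ↦ 1`, and every other generator goes to `0`. -/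
def counitGen : ∀ {n : ℕ} {r : ℤ}, LieGen n r → (unit k).X n r
  | _, _, .l1 => unit.one
  | _, _, _ => 0

/-- The counit `ε : LieD[3] → I`, the projection onto arity `1`. -/
noncomputable def counit : SHom (LieD3 k) (unit k) where
  map {n r} := (Finsupp.linearCombination k fun x => counitGen x.1 : FreeX k n r →ₗ[k] _)
  map_act {n r} σ x := by
    suffices h : (Finsupp.linearCombination k (fun x => counitGen x.1) ∘ₗ freeAct σ :
        FreeX k n r →ₗ[k] (unit k).X n r) = Finsupp.linearCombination k fun x => counitGen x.1 from
      LinearMap.congr_fun h x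
    refine Finsupp.lhom_ext' fun ⟨g, ρ⟩ => LinearMap.ext_ring ?_
    simp [freeAct]

end LieD3

/-- A dg `S`-module is `S`-free if, in every arity `n` and degree `r`, it is a free `k[S_n]`-module:
it has a `k`-basis `b (i, σ)`, with `i` in some index set and `σ ∈ S_n`, on which `S_n` acts by
`b (i, σ) ^ τ = b (i, σ τ)`. -/
def IsSFree {k : Type u} [CommRing k] (M : DGSMod k) : Prop :=
  ∀ (n : ℕ) (r : ℤ), ∃ (ι : Type) (b : Module.Basis (ι × Perm (Fin n)) k (M.X n r)),
    ∀ i σ τ, M.act τ (b (i, σ)) = b (i, σ * τ)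

/-- `(C, Δ, ε)` is a dg cooperad: a comonoid, for the composite product, in dg `S`-modules. The
maps `Δ` and `ε` are `S`-equivariant of degree `0` by their type. -/
structure IsDGCooperad {k : Type u} [CommRing k] (C : DGSMod k) (Δ : SHom C (C.comp C))
    (ε : SHom C (unit k)) : Prop where
  /-- `Δ` is a chain map. -/
  decomp_d : ∀ {n : ℕ} {r : ℤ} (x : C.X n r), Δ.map (C.d x) = (C.comp C).d (Δ.map x)
  /-- `ε` is a chain map. -/
  counit_d : ∀ {n : ℕ} {r : ℤ} (x : C.X n r), ε.map (C.d x) = (unit k).d (ε.map x)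
  /-- `(Δ ∘ id) Δ = (id ∘ Δ) Δ`, up to the associator `(C ∘ C) ∘ C ≅ C ∘ (C ∘ C)`. -/
  coassoc : ∀ {n : ℕ} {r : ℤ} (x : C.X n r),
    associator C C C ((Δ.comp (SHom.id C)).map (Δ.map x)) = ((SHom.id C).comp Δ).map (Δ.map x)
  /-- `(ε ∘ id) Δ` is the canonical isomorphism `C ≅ I ∘ C`. -/
  counit_left : ∀ {n : ℕ} {r : ℤ} (x : C.X n r),
    (ε.comp (SHom.id C)).map (Δ.map x) = leftUnitorInv C x
  /-- `(id ∘ ε) Δ` is the canonical isomorphism `C ≅ C ∘ I`. -/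
  counit_right : ∀ {n : ℕ} {r : ℤ} (x : C.X n r),
    ((SHom.id C).comp ε).map (Δ.map x) = rightUnitorInv C x

end DGSMod

/-! `LieD[3]` is `S`-free because its defining basis consists of the elements `g ^ σ`. Each cooperad
axiom is an identity between linear `S`-equivariant maps out of `LieD[3]`, so by `freeX_ext` it
suffices to check it on the sixteen generators.

The counit axioms hold for reasons of arity. The unit `I` lives in arity `1`, and every term of the
reduced decomposition has a top vertex of arity different from `1` and from `n` (`redDecomp_mem`).
Hence `ε ∘ id` keeps only `1 ∘ (g)`, and `id ∘ ε` keeps only `g ∘ (1, …, 1)`.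

The compatibility of `Δ` with `d` and coassociativity are finite computations. Every expression is
brought to an integer combination of labelled trees whose vertices are bare generators. A
permutation acting on the top generator is moved onto the entries by the tensor product over `S_m`,
at the cost of a Koszul sign; a permutation acting on a lower generator is absorbed into the labels
by the induction. As `LieD[3]` is `S`-free, such trees form a basis of the composite product, which
is why comparing coefficients can succeed; the argument itself only uses that equal coefficients
give equal elements, so no independence has to be proved.

Trees are therefore encoded by lists of natural numbers. `dGen_rep` and `decompGen_rep` translate
the definitions of `d` and `Δ` into tables of codes. `d_eval2`, `associator_eval2` and
`map_decomp_eval2` show that explicit operations on codes compute the differential of `LieD[3] ∘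
LieD[3]` and the two iterated decompositions, signs included. `sameTerms_diff` and
`sameTerms_decomp` compare the resulting formal sums. All coefficients are integers, so one
computation serves every ring `k`. -/

namespace DGSMod

open CompX LieGen

/-! ### Trees as grafts of labelled elements -/

section graft

variable {k : Type u} [CommRing k] {M N P : DGSMod k} {n m : ℕ} {r p : ℤ}

/-- A homogeneous element of a dg `S`-module whose inputs are labelled by natural numbers. -/
structure LElt (N : DGSMod k) where
  ar : ℕ
  deg : ℤ
  val : N.X ar deg
  lab : Fin ar → ℕ

/-- The labels of the inputs of the elements `y i` are those given by `e`. -/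
def Labels (y : Fin m → LElt N) (e : (Σ i, Fin (y i).ar) ≃ Fin n) : Prop :=
  ∀ i t, (e ⟨i, t⟩ : ℕ) = (y i).lab t

/-- The elements `y i` can be grafted on a vertex of degree `p`, with a result of arity `n` and
degree `r`. -/
def Fits (n : ℕ) (r p : ℤ) (y : Fin m → LElt N) : Prop :=
  (∃ e : (Σ i, Fin (y i).ar) ≃ Fin n, Labels y e) ∧ p + ∑ i, (y i).deg = r

namespace CompX

/-- The class of a tree, as a linear function of its top entry. -/
noncomputable def nodeTop {ar : Fin m → ℕ} {q : Fin m → ℤ} (lab : (Σ i, Fin (ar i)) ≃ Fin n)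
    (h : p + ∑ i, q i = r) (bot : ∀ i, N.X (ar i) (q i)) : M.X m p →ₗ[k] CompX M N n r where
  toFun x := node x lab h bot
  map_add' x y := node_add x y lab h bot
  map_smul' c x := node_smul c x lab h bot

end CompX

open Classical in
/-- The tree `x ∘ (y 0, …, y (m - 1))`, with the labels of the inputs carried by the `y i`. -/
noncomputable def graft (n : ℕ) (r : ℤ) (y : Fin m → LElt N) : M.X m p →ₗ[k] CompX M N n r :=
  -- The labels determine the chosen equivalence, so the choice is harmless. The value `0` otherwise
  -- makes grafting total, so that codes of trees can be evaluated without proofs that they are well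
  -- formed.
  if h : Fits n r p y then nodeTop h.1.choose h.2 fun i => (y i).val else 0

/-- `Labels` fixes the value of the equivalence at every input, so the chosen equivalence has the
same values as `e`. -/
theorem graft_eq {y : Fin m → LElt N} {e : (Σ i, Fin (y i).ar) ≃ Fin n} (he : Labels y e)
    (h : p + ∑ i, (y i).deg = r) (x : M.X m p) :
    graft n r y x = node x e h fun i => (y i).val := by
  have hf : Fits n r p y := ⟨⟨e, he⟩, h⟩
  rw [graft, dif_pos hf]
  refine node_lab_congr _ _ _ ?_
  rintro ⟨i, t⟩
  exact Fin.ext ((hf.1.choose_spec i t).trans (he i t).symm)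

/-- The entries of a tree as labelled elements. -/
def entries {ar : Fin m → ℕ} {q : Fin m → ℤ} (lab : (Σ i, Fin (ar i)) ≃ Fin n)
    (bot : ∀ i, N.X (ar i) (q i)) (i : Fin m) : LElt N :=
  ⟨ar i, q i, bot i, fun t => lab ⟨i, t⟩⟩

theorem node_eq_graft (x : M.X m p) {ar : Fin m → ℕ} {q : Fin m → ℤ}
    (lab : (Σ i, Fin (ar i)) ≃ Fin n) (h : p + ∑ i, q i = r) (bot : ∀ i, N.X (ar i) (q i)) :
    node x lab h bot = graft n r (entries lab bot) x :=
  (graft_eq (y := entries lab bot) (e := lab) (fun _ _ => rfl) h x).symm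

theorem entries_fits {ar : Fin m → ℕ} {q : Fin m → ℤ} (lab : (Σ i, Fin (ar i)) ≃ Fin n)
    (h : p + ∑ i, q i = r) (bot : ∀ i, N.X (ar i) (q i)) : Fits n r p (entries lab bot) :=
  ⟨⟨lab, fun _ _ => rfl⟩, h⟩

/-- Labelled elements that differ by the action of a permutation and a relabelling of the inputs. -/
inductive LElt.Rel : LElt N → LElt N → Prop
  | act (a : ℕ) (q : ℤ) (v : N.X a q) (τ : Perm (Fin a)) (l : Fin a → ℕ) :
      LElt.Rel ⟨a, q, N.act τ v, l⟩ ⟨a, q, v, fun t => l (τ.symm t)⟩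

theorem LElt.Rel.refl (y : LElt N) : LElt.Rel y y := by
  obtain ⟨a, q, v, l⟩ := y
  have := LElt.Rel.act a q v 1 l
  rwa [N.act_one] at this

/-- This is the relation `bot_act` in all places at once: each permutation leaves its entry and
becomes a relabelling of the inputs. No sign arises, since no symbols change their order. -/
theorem graft_rel {y z : Fin m → LElt N} (h : ∀ i, (y i).Rel (z i)) (hy : Fits n r p y)
    (x : M.X m p) : Fits n r p z ∧ graft n r y x = graft n r z x := by
  have h1 : ∀ i, ∃ (a : ℕ) (q : ℤ) (v : N.X a q) (τ : Perm (Fin a)) (l : Fin a → ℕ),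
      y i = ⟨a, q, N.act τ v, l⟩ ∧ z i = ⟨a, q, v, fun t => l (τ.symm t)⟩ := by
    intro i
    have hi := h i
    -- The two elements become variables, so that `Rel` can be destructed although arity and degree
    -- are part of its indices.
    generalize y i = y', z i = z' at hi
    obtain ⟨a, q, v, τ, l⟩ := hi
    exact ⟨a, q, v, τ, l, rfl, rfl⟩
  choose a q v τ l hy' hz' using h1
  obtain rfl : y = fun i => ⟨a i, q i, N.act (τ i) (v i), l i⟩ := funext hy'
  obtain rfl : z = fun i => ⟨a i, q i, v i, fun t => l i ((τ i).symm t)⟩ := funext hz'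
  obtain ⟨⟨e, he⟩, hd⟩ := hy
  have he' : Labels (fun i => (⟨a i, q i, v i, fun t => l i ((τ i).symm t)⟩ : LElt N))
      ((Equiv.sigmaCongrRight fun i => (τ i).symm).trans e) := fun i t => he i ((τ i).symm t)
  refine ⟨⟨⟨_, he'⟩, hd⟩, ?_⟩
  rw [graft_eq he hd, graft_eq he' hd]
  exact node_bot_act x e hd v τ

/-- The relation `top_act`, with an integer sign. It turns a top entry `g ^ σ` into `g`; the entries
are permuted together with their labels. -/
theorem graft_top_act {y : Fin m → LElt N} (hy : Fits n r p y) (σ : Perm (Fin m)) (x : M.X m p) :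
    Fits n r p (fun i => y (σ.symm i)) ∧ graft n r y (M.act σ x) =
      (koszulSign (fun i => (y i).deg) (fun i => i) (fun i => σ i) : ℤ) •
        graft n r (fun i => y (σ.symm i)) x := by
  obtain ⟨⟨e, he⟩, hd⟩ := hy
  have he' : Labels (fun i => y (σ.symm i))
      ((Equiv.sigmaCongrLeft (β := fun i => Fin (y i).ar) σ.symm).trans e) := fun i t =>
    he (σ.symm i) t
  have hd' : p + ∑ i, (y (σ.symm i)).deg = r := by
    rw [← hd]; exact congrArg (p + ·) (Equiv.sum_comp σ.symm fun i => (y i).deg)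
  refine ⟨⟨⟨_, he'⟩, hd'⟩, ?_⟩
  rw [graft_eq he hd, graft_eq he' hd', node_top_act, Int.cast_smul_eq_zsmul]

/-- The labels of an element, changed by a function. -/
def LElt.relabel (f : ℕ → ℕ) (y : LElt N) : LElt N := ⟨y.ar, y.deg, y.val, fun t => f (y.lab t)⟩

/-- Labels are natural numbers, so `σ⁻¹` enters through a function `f` on `ℕ` that only has to agree
with it below `n`. -/
theorem act_graft {y : Fin m → LElt N} (hy : Fits n r p y) (x : M.X m p) (σ : Perm (Fin n))
    (f : ℕ → ℕ) (hf : ∀ t : Fin n, f t = σ.symm t) :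
    Fits n r p (fun i => (y i).relabel f) ∧
      CompX.act σ (graft n r y x) = graft n r (fun i => (y i).relabel f) x := by
  obtain ⟨⟨e, he⟩, hd⟩ := hy
  have he' : Labels (fun i => (y i).relabel f) (e.trans σ.symm) := fun i t => by
    simp only [LElt.relabel, ← he i t, hf]; rfl
  refine ⟨⟨⟨_, he'⟩, hd⟩, ?_⟩
  rw [graft_eq he hd, graft_eq he' hd, act_node]
  rfl

/-- The composite `x ∘ (y 0, …, y (b - 1))` as a labelled element. -/
noncomputable def corolla {b : ℕ} {w : ℤ} (x : N.X b w) (y : Fin b → LElt P) : LElt (N.comp P) where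
  ar := ∑ t, (y t).ar
  deg := w + ∑ t, (y t).deg
  val := (node x finSigmaFinEquiv rfl fun t => (y t).val : CompX N P _ _)
  lab z := (y (finSigmaFinEquiv.symm z).1).lab (finSigmaFinEquiv.symm z).2

theorem corolla_lab {b : ℕ} {w : ℤ} (x : N.X b w) (y : Fin b → LElt P) (t : Fin b)
    (s : Fin (y t).ar) : (corolla x y).lab (finSigmaFinEquiv ⟨t, s⟩) = (y t).lab s := by
  -- The label is read as one function of the pair `⟨t, s⟩`, because the type of `s` depends on `t`.
  change (fun u : Σ t, Fin (y t).ar => (y u.1).lab u.2) (finSigmaFinEquiv.symm _) = _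
  rw [Equiv.symm_apply_apply]

/-- A graft may number its inputs in any way, while a corolla numbers them in order. The two
numberings differ by a permutation, which `Rel` absorbs into the labels. This allows a decomposed
bottom entry to be replaced by a corolla whose labels are read off through `f`. -/
theorem graft_rel_corolla {b : ℕ} {w : ℤ} {c : ℕ} {s : ℤ} (x : N.X b w) {y : Fin b → LElt P}
    (hy : Fits c s w y) (f : ℕ → ℕ) :
    LElt.Rel (⟨c, s, (graft c s y x : CompX N P c s), fun t => f t⟩ : LElt (N.comp P))
      (corolla x fun t => (y t).relabel f) := by
  obtain ⟨⟨e, he⟩, rfl⟩ := hy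
  obtain rfl : c = ∑ t, (y t).ar := by
    simpa using (Fintype.card_congr e).symm
  have key := LElt.Rel.act (N := N.comp P) _ _
    (node x finSigmaFinEquiv rfl fun t => (y t).val : CompX N P _ _)
    (e.symm.trans finSigmaFinEquiv) (fun t => f t)
  have h1 : (N.comp P).act (e.symm.trans finSigmaFinEquiv)
      (node x finSigmaFinEquiv rfl fun t => (y t).val : CompX N P _ _) = graft _ _ y x := by
    rw [graft_eq he rfl]
    refine (act_node x finSigmaFinEquiv rfl _ _).trans ?_
    exact node_lab_congr _ _ _ fun z => by simp
  rw [h1] at key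
  convert key using 1
  unfold corolla
  congr 1
  funext z
  simp only [LElt.relabel, ← he _ _]
  rfl

/-- Linearity in one place holds as long as the arity, degree and labels there stay fixed. Packaging
it as a linear map `F` lets a formal sum be substituted in that place. -/
theorem graft_update_linear {y : Fin m → LElt N} {i : Fin m} {z : LElt N}
    (hy : Fits n r p (Function.update y i z)) (x : M.X m p) :
    ∃ F : N.X z.ar z.deg →ₗ[k] CompX M N n r, ∀ v,
      Fits n r p (Function.update y i ⟨_, _, v, z.lab⟩) ∧
      F v = graft n r (Function.update y i ⟨_, _, v, z.lab⟩) x := by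
  -- Taking `z` to be already the `i`-th entry of `y` avoids transport between the types of the two
  -- entries.
  suffices H : ∀ y : Fin m → LElt N, Fits n r p y → ∃ F : N.X (y i).ar (y i).deg →ₗ[k] CompX M N n r,
      ∀ v, Fits n r p (Function.update y i ⟨_, _, v, (y i).lab⟩) ∧
        F v = graft n r (Function.update y i ⟨_, _, v, (y i).lab⟩) x by
    have h := H _ hy
    simp only [Function.update_idem] at h
    rwa [Function.update_self] at h
  rintro y ⟨⟨e, he⟩, hd⟩
  have key : ∀ v, entries e (Function.update (fun j => (y j).val) i v) =
      Function.update y i ⟨_, _, v, (y i).lab⟩ := by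
    intro v
    funext j
    have hl : (fun t => (e ⟨j, t⟩ : ℕ)) = (y j).lab := funext (he j)
    by_cases hj : j = i
    · subst hj
      simp only [entries, Function.update_self, hl]
    · simp only [entries, Function.update_of_ne hj, hl]
  refine ⟨(node x e hd).toLinearMap (fun j => (y j).val) i, fun v => ?_⟩
  rw [MultilinearMap.toLinearMap_apply, node_eq_graft, ← key]
  exact ⟨entries_fits e hd _, rfl⟩

/-- The labels of the inner tree are the indices of the outer entries: an input of `z i` with label
`j` carries `y j`. Indexing `y` by `ℕ` makes these labels directly usable. The corollas number their
inputs by `finSigmaFinEquiv`, as `assocTree` does, so the only correction is the Koszul sign. -/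
theorem associator_graft {l : ℕ} {p' : ℤ} (x : M.X l p') {z : Fin l → LElt N}
    {e : (Σ i, Fin (z i).ar) ≃ Fin m} (he : Labels z e) (hd : p' + ∑ i, (z i).deg = p)
    {y : ℕ → LElt P} (hy : Fits n r p fun j : Fin m => y j) :
    associator M N P (graft (M := M.comp N) n r (fun j : Fin m => y j)
        (graft m p z x : CompX M N m p)) =
      (assocSign e (fun i => (z i).deg) (fun j => (y j).deg) : ℤ) •
        graft (N := N.comp P) n r (fun i => corolla (z i).val fun t => y ((z i).lab t)) x := by
  obtain ⟨⟨e', he'⟩, hd'⟩ := hy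
  have hz : (fun i => corolla (z i).val fun t => y ((z i).lab t)) =
      fun i => corolla (z i).val fun t => y (e ⟨i, t⟩) := by
    funext i
    exact congrArg (corolla (z i).val) (funext fun t => by rw [he])
  rw [hz, graft_eq he hd, graft_eq he' hd']
  have hl : Labels (fun i => corolla (z i).val fun t => y (e ⟨i, t⟩))
      (assocLab e e' fun i => finSigmaFinEquiv) := fun i t => by
    obtain ⟨⟨t, s⟩, rfl⟩ := finSigmaFinEquiv.surjective t
    refine (congrArg Fin.val (assocLab_apply e e' (fun i => finSigmaFinEquiv) i t s)).trans ?_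
    exact (he' _ _).trans (corolla_lab (z i).val (fun t => y (e ⟨i, t⟩)) t s).symm
  rw [graft_eq hl (assoc_deg e (fun i => (z i).deg) (fun j => (y j).deg) hd hd'), node_apply,
    node_apply]
  refine (lift_mk _ assocInner_respects _).trans ?_
  refine (lift_mk _ (assocTree_respects e' hd' _) _).trans ?_
  rw [assocTree, Int.cast_smul_eq_zsmul]
  rfl

theorem map_node {M' N' : DGSMod k} (f : SHom M M') (g : SHom N N') (x : M.X m p) {ar : Fin m → ℕ}
    {q : Fin m → ℤ} (lab : (Σ i, Fin (ar i)) ≃ Fin n) (h : p + ∑ i, q i = r)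
    (bot : ∀ i, N.X (ar i) (q i)) : CompX.map f g (node x lab h bot) =
      node (f.map x) lab h fun i => g.map (bot i) :=
  lift_mk ..

theorem map_graft {M' N' : DGSMod k} (f : SHom M M') (g : SHom N N') {y : Fin m → LElt N}
    (hy : Fits n r p y) (x : M.X m p) : CompX.map f g (graft n r y x) =
      graft n r (fun i => ⟨(y i).ar, (y i).deg, g.map (y i).val, (y i).lab⟩) (f.map x) := by
  obtain ⟨⟨e, he⟩, hd⟩ := hy
  rw [graft_eq he hd, map_node]
  exact (graft_eq (y := fun i => ⟨(y i).ar, (y i).deg, g.map (y i).val, (y i).lab⟩)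
    (e := e) he hd _).symm

/-- The differential of a labelled element. -/
def LElt.diff (y : LElt N) : LElt N := ⟨y.ar, y.deg - 1, N.d y.val, y.lab⟩

/-- The degree is part of the data of a labelled element, so the transports along equalities of
degrees inside `shift` disappear. -/
theorem entries_shift {y : Fin m → LElt N} {e : (Σ i, Fin (y i).ar) ≃ Fin n} (he : Labels y e)
    (i : Fin m) : entries (q := Function.update (fun j => (y j).deg) i ((y i).deg - 1)) e
      (fun j => shift N (fun j => (y j).ar) (fun j => (y j).deg) i j (y j).val) =
      Function.update y i (y i).diff := by
  funext j
  have hl : (fun t => (e ⟨j, t⟩ : ℕ)) = (y j).lab := funext (he j)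
  have hc : ∀ {s t : ℤ} (h : s = t) (v : N.X (y j).ar t) (l : Fin (y j).ar → ℕ),
      (⟨(y j).ar, s, N.castTo h v, l⟩ : LElt N) = ⟨(y j).ar, t, v, l⟩ := by
    rintro s t rfl v l; rfl
  by_cases hj : j = i
  · subst hj
    rw [Function.update_self, entries, hl, shift, dif_pos rfl, dTo]
    exact hc _ _ _
  · rw [Function.update_of_ne hj, entries, hl, shift, dif_neg hj]
    exact hc _ _ _

theorem update_diff_fits {y : Fin m → LElt N} (hy : Fits n r p y) (i : Fin m) :
    Fits n (r - 1) p (Function.update y i (y i).diff) := by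
  obtain ⟨⟨e, he⟩, hd⟩ := hy
  have h := entries_fits (N := N) e (sum_update_sub_one (fun j => (y j).deg) i hd)
    (fun j => shift N (fun j => (y j).ar) (fun j => (y j).deg) i j (y j).val)
  rwa [entries_shift he] at h

theorem d_graft {y : Fin m → LElt N} (hy : Fits n r p y) (x : M.X m p) :
    CompX.d (graft n r y x) = graft n (r - 1) y (M.d x) +
      ∑ i, (prefixSign p (fun i => (y i).deg) i : ℤ) •
        graft n (r - 1) (Function.update y i (y i).diff) x := by
  obtain ⟨⟨e, he⟩, hd⟩ := hy
  rw [graft_eq he hd, d_node, graft_eq he (by omega)]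
  congr 1
  refine Finset.sum_congr rfl fun i _ => ?_
  rw [dBot_apply, node_eq_graft, Int.cast_smul_eq_zsmul]
  congr 3
  exact entries_shift he i

end graft

/-! ### Formal integer combinations -/

section LinComb

variable {A B V W : Type*} [AddCommGroup V] [AddCommGroup W]

/-- The value `∑ c • f a` of a formal sum of terms `(c, a)`. -/
def linComb (f : A → V) (L : List (ℤ × A)) : V := (L.map fun q => q.1 • f q.2).sum

@[simp] theorem linComb_nil (f : A → V) : linComb f [] = 0 := rfl

@[simp] theorem linComb_cons (f : A → V) (q : ℤ × A) (L : List (ℤ × A)) :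
    linComb f (q :: L) = q.1 • f q.2 + linComb f L := by simp [linComb]

@[simp] theorem linComb_append (f : A → V) (L L' : List (ℤ × A)) :
    linComb f (L ++ L') = linComb f L + linComb f L' := by simp [linComb]

theorem map_linComb (φ : V →+ W) (f : A → V) (L : List (ℤ × A)) :
    φ (linComb f L) = linComb (fun a => φ (f a)) L := by
  induction L with
  | nil => simp
  | cons q L ih => simp [ih]

theorem linComb_congr {f g : A → V} {L : List (ℤ × A)} (h : ∀ q ∈ L, f q.2 = g q.2) :
    linComb f L = linComb g L := by
  induction L with
  | nil => rfl
  | cons q L ih =>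
    rw [linComb_cons, linComb_cons, h q (by simp), ih fun q hq => h q (by simp [hq])]

/-- The product of two formal sums, the terms of the second being modified by `h`. -/
def mulTerms (h : A → B) (c : ℤ) (L : List (ℤ × A)) : List (ℤ × B) :=
  L.map fun q => (c * q.1, h q.2)

theorem linComb_mulTerms (f : B → V) (h : A → B) (c : ℤ) (L : List (ℤ × A)) :
    linComb f (mulTerms h c L) = c • linComb (fun a => f (h a)) L := by
  induction L with
  | nil => simp [mulTerms]
  | cons q L ih =>
    rw [linComb_cons, smul_add, ← ih, mulTerms, List.map_cons, linComb_cons, mul_smul]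
    rfl

/-- Substitution of formal sums into a formal sum. -/
def bindTerms (L : List (ℤ × A)) (T : A → List (ℤ × B)) : List (ℤ × B) :=
  L.flatMap fun q => mulTerms id q.1 (T q.2)

theorem linComb_bindTerms (f : B → V) (L : List (ℤ × A)) (T : A → List (ℤ × B)) :
    linComb f (bindTerms L T) = linComb (fun a => linComb f (T a)) L := by
  induction L with
  | nil => rfl
  | cons q L ih =>
    rw [bindTerms, List.flatMap_cons, linComb_append, linComb_mulTerms, linComb_cons, ← ih]
    rfl

/-- `X` is the value of the formal sum `L`, all of whose terms are subject to `Q`. -/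
def Rep (f : A → V) (Q : A → Prop) (X : V) (L : List (ℤ × A)) : Prop :=
  X = linComb f L ∧ ∀ q ∈ L, Q q.2

namespace Rep

variable {f : A → V} {Q : A → Prop} {X Y : V} {L L' : List (ℤ × A)}

theorem zero : Rep f Q 0 [] := ⟨rfl, by simp⟩

theorem single {a : A} (ha : Q a) (hX : X = f a) : Rep f Q X [(1, a)] := by
  refine ⟨by simp [hX], fun q hq => ?_⟩
  rw [List.mem_singleton.1 hq]
  exact ha

theorem add (hX : Rep f Q X L) (hY : Rep f Q Y L') : Rep f Q (X + Y) (L ++ L') := by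
  refine ⟨by rw [hX.1, hY.1, linComb_append], fun q hq => ?_⟩
  exact (List.mem_append.1 hq).elim (hX.2 q) (hY.2 q)

theorem neg (hX : Rep f Q X L) : Rep f Q (-X) (mulTerms id (-1) L) := by
  refine ⟨by rw [linComb_mulTerms, hX.1, neg_smul, one_smul]; rfl, fun q hq => ?_⟩
  obtain ⟨q', hq', rfl⟩ := List.mem_map.1 hq
  exact hX.2 q' hq'

theorem sub (hX : Rep f Q X L) (hY : Rep f Q Y L') :
    Rep f Q (X - Y) (L ++ mulTerms id (-1) L') := by
  rw [sub_eq_add_neg]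
  exact hX.add hY.neg

/-- The list built by following the shape of a sum is separated here from the list in a table: what
remains is a decidable equality of lists. -/
theorem congr (hX : Rep f Q X L) (h : L = L') : Rep f Q X L' := h ▸ hX

end Rep

/-! ### Comparison of formal sums by collecting coefficients -/

/-- A search tree for collecting the coefficients of a formal sum. -/
inductive Coeffs (A : Type*)
  | nil : Coeffs A
  | node (l : Coeffs A) (key : ℕ) (a : A) (c : ℤ) (r : Coeffs A) : Coeffs A

namespace Coeffs

/-- The value of the collected sum. -/
def value (f : A → V) : Coeffs A → V
  | nil => 0
  | node l _ a c r => value f l + c • f a + value f r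

/-- Add the term `(c, a)`. -/
def insert [DecidableEq A] (key : ℕ) (a : A) (c : ℤ) : Coeffs A → Coeffs A
  | nil => node nil key a c nil
  | node l key' a' c' r =>
    bif Nat.blt key key' then node (insert key a c l) key' a' c' r
    else bif Nat.blt key' key then node l key' a' c' (insert key a c r)
    else if a = a' then node l key' a' (c' + c) r
    else node (insert key a c l) key' a' c' r

/-- The key only guides the search. Coefficients are merged only when `a = a'`, so neither
injectivity of the key nor an ordering of the tree is required. -/
theorem value_insert [DecidableEq A] (f : A → V) (key : ℕ) (a : A) (c : ℤ) (t : Coeffs A) :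
    value f (insert key a c t) = c • f a + value f t := by
  induction t with
  | nil => simp [insert, value]
  | node l key' a' c' r ihl ihr =>
    rw [insert]
    cases Nat.blt key key'
    · cases Nat.blt key' key
      · by_cases h : a = a'
        · subst h; simp only [cond_false, if_true, value, add_smul]; abel
        · simp only [cond_false, if_neg h, value, ihl]; abel
      · simp only [cond_false, cond_true, value, ihr]; abel
    · simp only [cond_true, value, ihl]; abel

/-- All collected coefficients vanish. -/
def vanishes : Coeffs A → Bool
  | nil => true
  | node l _ _ c r => decide (c = 0) && (vanishes l && vanishes r)

theorem value_eq_zero (f : A → V) {t : Coeffs A} (h : vanishes t = true) : value f t = 0 := by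
  induction t with
  | nil => rfl
  | node l key a c r ihl ihr =>
    simp only [vanishes, Bool.and_eq_true, decide_eq_true_eq] at h
    rw [value, h.1, ihl h.2.1, ihr h.2.2]
    simp

/-- Collect the terms of a formal sum multiplied by `s`. -/
def collect [DecidableEq A] (key : A → ℕ) (s : ℤ) : List (ℤ × A) → Coeffs A → Coeffs A
  | [], t => t
  | q :: L, t => collect key s L (insert (key q.2) q.2 (s * q.1) t)

theorem value_collect [DecidableEq A] (f : A → V) (key : A → ℕ) (s : ℤ) (L : List (ℤ × A))
    (t : Coeffs A) : value f (collect key s L t) = s • linComb f L + value f t := by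
  induction L generalizing t with
  | nil => simp [collect]
  | cons q L ih => rw [collect, ih, value_insert, linComb_cons, smul_add, mul_smul]; abel

end Coeffs

/-- The formal sums have equal coefficients. -/
def sameTerms [DecidableEq A] (key : A → ℕ) (L L' : List (ℤ × A)) : Bool :=
  (Coeffs.collect key (-1) L' (Coeffs.collect key 1 L .nil)).vanishes

/-- The collected sum is `L - L'`; if each of its coefficients vanishes, so does its value under
every `f`. -/
theorem linComb_eq_of_sameTerms [DecidableEq A] (f : A → V) (key : A → ℕ) {L L' : List (ℤ × A)}
    (h : sameTerms key L L' = true) : linComb f L = linComb f L' := by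
  have := Coeffs.value_eq_zero f h
  rw [Coeffs.value_collect, Coeffs.value_collect, Coeffs.value, one_smul, neg_smul, one_smul,
    add_zero, neg_add_eq_zero] at this
  exact this.symm

/-! ### Expansion of multilinear maps on formal sums -/

/-- All ways of choosing one term from each of the formal sums `T x`, for `x` in a list. -/
def choices (T : A → List (ℤ × B)) : List A → List (ℤ × List B)
  | [] => [(1, [])]
  | x :: xs => (choices T xs).flatMap fun q => mulTerms (fun b => b :: q.2) q.1 (T x)

/-- It traces each entry of a chosen list back to a term of the corresponding formal sum, so that
properties of the terms carry over to the entries. -/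
theorem choices_spec (T : A → List (ℤ × B)) (a : A) (b : B) (xs : List A) :
    ∀ q ∈ choices T xs, q.2.length = xs.length ∧
      ∀ i < xs.length, ∃ c, (c, q.2.getD i b) ∈ T (xs.getD i a) := by
  induction xs with
  | nil => simp [choices]
  | cons x xs ih =>
    intro q hq
    obtain ⟨q', hq', hq⟩ := List.mem_flatMap.1 hq
    obtain ⟨t, ht, rfl⟩ := List.mem_map.1 hq
    refine ⟨by simp [(ih q' hq').1], fun i hi => ?_⟩
    cases i with
    | zero => exact ⟨t.1, by simpa using ht⟩
    | succ i => simpa using (ih q' hq').2 i (by simpa using hi)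

/-- Induction on the number of arguments: currying the first argument gives a linear map `Φ` into
multilinear maps in the others. The induction hypothesis expands these, and additivity expands the
first argument afterwards. -/
theorem multilinear_choices {k : Type*} [CommRing k] [Module k W] {U : A → Type*}
    [∀ x, AddCommGroup (U x)] [∀ x, Module k (U x)] (T : A → List (ℤ × B)) (a : A) (b : B)
    (ev : ∀ x, B → U x) (xs : List A) {m : ℕ} (hm : xs.length = m)
    (φ : MultilinearMap k (fun i : Fin m => U (xs.getD i a)) W) :
    φ (fun i => linComb (ev _) (T (xs.getD i a))) =
      linComb (fun l => φ fun i => ev _ (l.getD i b)) (choices T xs) := by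
  induction xs generalizing m with
  | nil =>
    subst hm
    simp only [choices, linComb_cons, one_smul, linComb_nil, add_zero]
    congr 1
    funext i
    exact i.elim0
  | cons x xs ih =>
    subst hm
    obtain ⟨Φ, hΦ⟩ : ∃ Φ : U x →ₗ[k] MultilinearMap k (fun i : Fin xs.length => U (xs.getD i a)) W,
        ∀ u v, Φ u v = φ (Fin.cons (α := fun i => U ((x :: xs).getD i a)) u v) :=
      ⟨φ.curryLeft, fun _ _ => rfl⟩
    have key := fun u : U x => ih rfl (Φ u)
    have h1 : φ (fun i => linComb (ev _) (T ((x :: xs).getD i a))) =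
        Φ (linComb (ev x) (T x)) fun i => linComb (ev _) (T (xs.getD i a)) := by
      rw [hΦ]
      congr 1
      funext i
      refine Fin.cases ?_ (fun i => ?_) i <;> rfl
    refine (h1.trans (key _)).trans ?_
    -- Stated for an arbitrary list `L` in place of `choices T xs`, so that it can be proved by
    -- induction on `L` alone.
    have h2 : ∀ L : List (ℤ × List B),
        linComb (fun l => Φ (linComb (ev x) (T x)) fun i => ev (xs.getD i a) (l.getD i b)) L =
        linComb (fun l => φ fun i => ev _ (l.getD i b))
          (L.flatMap fun q => mulTerms (fun b => b :: q.2) q.1 (T x)) := by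
      intro L
      induction L with
      | nil => rfl
      | cons q L ihL =>
        rw [linComb_cons, List.flatMap_cons, linComb_append, ihL, linComb_mulTerms]
        congr 2
        let ψ : U x →+ W :=
          { toFun := fun u => Φ u fun i => ev (xs.getD i a) (q.2.getD i b)
            map_zero' := by simp
            map_add' := by simp }
        refine (map_linComb ψ (ev x) (T x)).trans (linComb_congr fun t _ => ?_)
        change Φ (ev x t.2) _ = _
        rw [hΦ]
        congr 1
        funext i
        refine Fin.cases ?_ (fun i => ?_) i <;> rfl
    exact h2 _

end LinComb

/-! ### Koszul signs as parities of lists -/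

section Sign

/-- The sign with the given parity. -/
def sgn (b : Bool) : ℤˣ := bif b then -1 else 1

theorem sgn_xor (a b : Bool) : sgn (a ^^ b) = sgn a * sgn b := by
  cases a <;> cases b <;> simp [sgn]

/-- The parity of an integer. -/
def odd (z : ℤ) : Bool := !(decide (z % 2 = 0))

theorem negOnePow_eq_sgn (z : ℤ) : z.negOnePow = sgn (odd z) := by
  rcases Int.even_or_odd z with h | h
  · rw [Int.negOnePow_even z h]
    simp [sgn, odd, Int.even_iff.1 h]
  · rw [Int.negOnePow_odd z h]
    simp [sgn, odd, Int.odd_iff.1 h]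

/-- The sum of the values of `f` modulo `2`. -/
def xorSum {A : Type*} (f : A → Bool) (L : List A) : Bool := L.foldr (fun a b => f a ^^ b) false

theorem sgn_xorSum {A : Type*} (f : A → Bool) (L : List A) :
    sgn (xorSum f L) = (L.map fun a => sgn (f a)).prod := by
  induction L with
  | nil => rfl
  | cons a L ih => rw [List.map_cons, List.prod_cons, ← ih, ← sgn_xor]; rfl

theorem and_xorSum {A : Type*} (b : Bool) (f : A → Bool) (L : List A) :
    (b && xorSum f L) = xorSum (fun a => b && f a) L := by
  cases b <;> simp [xorSum]

/-- The lexicographic order. -/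
def lexLt (x y : ℕ × ℕ) : Bool := Nat.blt x.1 y.1 || (Nat.beq x.1 y.1 && Nat.blt x.2 y.2)

theorem lexLt_iff (x y : ℕ × ℕ) : lexLt x y = true ↔ x.1 < y.1 ∨ x.1 = y.1 ∧ x.2 < y.2 := by
  simp [lexLt, Nat.blt_eq, Nat.beq_eq]

/-- A symbol, with its degree and its places in two orders. -/
abbrev Symb := ℤ × (ℕ × ℕ) × (ℕ × ℕ)

/-- The parity of the Koszul sign of reordering the symbols of a list. -/
def koszulParity (L : List Symb) : Bool :=
  xorSum (fun x => odd x.1 && xorSum (fun y =>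
    odd y.1 && (lexLt x.2.1 y.2.1 && lexLt y.2.2 x.2.2)) L) L

/-- A reversed pair contributes `-1` exactly when both degrees are odd, so the product over pairs is
an exclusive or of conjunctions. The list `E` enumerates the symbols, and both orders are modelled
by lexicographically ordered pairs of natural numbers. -/
theorem koszulSign_eq_sgn {ι α β : Type*} [Fintype ι] [LinearOrder α] [LinearOrder β]
    (deg : ι → ℤ) (u : ι → α) (v : ι → β) (E : List ι)
    (hE : ∀ F : ι → ℤˣ, ∏ x, F x = (E.map F).prod) (s : ι → Symb) (hd : ∀ x, (s x).1 = deg x)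
    (hu : ∀ x y, u x < u y ↔ lexLt (s x).2.1 (s y).2.1 = true)
    (hv : ∀ x y, v x < v y ↔ lexLt (s x).2.2 (s y).2.2 = true) :
    koszulSign deg u v = sgn (koszulParity (E.map s)) := by
  have hp : ∀ x y : ι, (if u x < u y ∧ v y < v x then (deg x * deg y).negOnePow else 1) =
      sgn (odd (s x).1 && (odd (s y).1 &&
        (lexLt (s x).2.1 (s y).2.1 && lexLt (s y).2.2 (s x).2.2))) := by
    intro x y
    have ho : odd (deg x * deg y) = (odd (deg x) && odd (deg y)) := by
      simp only [odd, ← Int.even_iff, Int.even_mul]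
      by_cases h1 : Even (deg x) <;> by_cases h2 : Even (deg y) <;> simp [h1, h2]
    simp only [negOnePow_eq_sgn, ho, hd, hu, hv]
    cases lexLt (s x).2.1 (s y).2.1 <;> cases lexLt (s y).2.2 (s x).2.2 <;> simp [sgn]
  simp only [koszulSign, hp, hE, koszulParity, and_xorSum, sgn_xorSum, List.map_map]
  rfl

end Sign

/-! ### The signs of the associator, of permutations and of the differential -/

section Signs

/-- It supplies the enumeration needed for `assocSign`: block by block, each middle vertex followed
by the entries grafted on it. -/
theorem prod_sigma_option {l : ℕ} {b : Fin l → ℕ} (F : (Σ i, Option (Fin (b i))) → ℤˣ) :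
    ∏ x, F x = (((List.finRange l).flatMap fun i =>
      (⟨i, none⟩ : Σ i, Option (Fin (b i))) ::
        (List.finRange (b i)).map fun t => ⟨i, some t⟩).map F).prod := by
  rw [Fintype.prod_sigma, Fin.prod_univ_def]
  simp only [Fintype.prod_option, Fin.prod_univ_def]
  generalize List.finRange l = L
  induction L with
  | nil => rfl
  | cons i L ih => simp [ih, mul_assoc, Function.comp_def]

theorem assocSign_eq_sgn {l m : ℕ} {b : Fin l → ℕ} (e : (Σ i, Fin (b i)) ≃ Fin m) (w : Fin l → ℤ)
    (q : Fin m → ℤ) : assocSign e w q = sgn (koszulParity ((List.finRange l).flatMap fun i =>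
      (w i, (0, (i : ℕ)), ((i : ℕ), 0)) :: (List.finRange (b i)).map fun t =>
        (q (e ⟨i, t⟩), (1, (e ⟨i, t⟩ : ℕ)), ((i : ℕ), (t : ℕ) + 1)))) := by
  refine (koszulSign_eq_sgn (assocDeg e w q) (assocBefore e) assocAfter _ prod_sigma_option
    (fun x => (assocDeg e w q x, ofLex (assocBefore e x), ((x.1 : ℕ), slot x.2)))
    (fun _ => rfl) (fun x y => ?_) fun x y => ?_).trans ?_
  · rw [lexLt_iff, Prod.Lex.lt_iff]
  · rw [lexLt_iff, assocAfter, assocAfter, Prod.Lex.toLex_lt_toLex]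
    simp [Fin.ext_iff]
  · congr 2
    simp only [List.map_flatMap, List.map_cons, List.map_map]
    rfl

/-- Reindexing by `σ⁻¹` expresses the sign through the values of `σ⁻¹`, which are what a code
records. -/
theorem koszulSign_perm_eq_sgn {m : ℕ} (q : Fin m → ℤ) (σ : Perm (Fin m)) :
    koszulSign q (fun i => i) (fun i => σ i) = sgn (koszulParity ((List.finRange m).map fun j =>
      (q (σ.symm j), (0, (σ.symm j : ℕ)), (0, (j : ℕ))))) := by
  rw [← koszulSign_comp σ.symm]
  refine koszulSign_eq_sgn _ _ _ _ (fun F => Fin.prod_univ_def F) _ (fun _ => rfl) (fun x y => ?_)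
    fun x y => ?_ <;> simp [lexLt_iff]

theorem prefixSign_eq_sgn {m : ℕ} (p : ℤ) (q : Fin m → ℤ) (i : Fin m) :
    prefixSign p q i = sgn (odd (p + (((List.finRange m).filter (· < i)).map q).sum)) := by
  rw [prefixSign, negOnePow_eq_sgn]
  congr 3

end Signs

/-! ### Numerical codes of trees, and the tables of `d` and `Δ` -/

section Codes

/-- A generator with labels for its inputs; generators are numbered as in `genOf`. -/
abbrev Leaf := ℕ × List ℕ

/-- A two-level tree of generators. -/
abbrev Tree2 := ℕ × List Leaf

/-- A three-level tree of generators. -/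
abbrev Tree3 := ℕ × List Tree2

/-- The generator with a given number. -/
def genOf (a : ℕ) : Σ (n : ℕ) (r : ℤ), LieGen n r :=
  [⟨1, 0, .l1⟩, ⟨2, 1, .l2⟩, ⟨2, 2, .l21⟩, ⟨2, 3, .l211⟩, ⟨2, 4, .l2111⟩, ⟨3, 2, .l3⟩, ⟨3, 3, .l31⟩,
    ⟨3, 3, .l32⟩, ⟨3, 4, .l311⟩, ⟨3, 4, .l312⟩, ⟨3, 4, .l322⟩, ⟨4, 3, .l4⟩, ⟨4, 4, .l41⟩,
    ⟨4, 4, .l42⟩, ⟨4, 4, .l43⟩, ⟨5, 4, .l5⟩].getD a ⟨1, 0, .l1⟩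

/-- The number of a generator. -/
def LieGen.idx : ∀ {n : ℕ} {r : ℤ}, LieGen n r → ℕ
  | _, _, .l1 => 0
  | _, _, .l2 => 1
  | _, _, .l21 => 2
  | _, _, .l211 => 3
  | _, _, .l2111 => 4
  | _, _, .l3 => 5
  | _, _, .l31 => 6
  | _, _, .l32 => 7
  | _, _, .l311 => 8
  | _, _, .l312 => 9
  | _, _, .l322 => 10
  | _, _, .l4 => 11
  | _, _, .l41 => 12
  | _, _, .l42 => 13
  | _, _, .l43 => 14
  | _, _, .l5 => 15

theorem genOf_idx {n : ℕ} {r : ℤ} (g : LieGen n r) : genOf g.idx = ⟨n, r, g⟩ := by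
  cases g <;> rfl

/-- The degree of the generator with a given number. -/
def degOf (a : ℕ) : ℤ := (genOf a).2.1

/-- The `i`-th entry of a tree. -/
def Tree2.child (c : Tree2) (i : ℕ) : Leaf := c.2.getD i (0, [])

/-- The labels of a leaf, changed by a function. -/
def Leaf.relabel (l : List ℕ) (x : Leaf) : Leaf := (x.1, x.2.map fun t => l.getD t 0)

/-- The labels of a tree, changed by a function. -/
def Tree2.relabel (l : List ℕ) (c : Tree2) : Tree2 := (c.1, c.2.map (Leaf.relabel l))

/-- The terms of the differential of a generator; the labels are those of the inverse permutation. -/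
def diffTerms : ∀ {n : ℕ} {r : ℤ}, LieGen n r → List (ℤ × Leaf)
  | _, _, .l21 => [(-1, (1, [0, 1])), (-1, (1, [1, 0]))]
  | _, _, .l211 => [(-1, (2, [0, 1])), (1, (2, [1, 0]))]
  | _, _, .l2111 => [(-1, (3, [0, 1])), (-1, (3, [1, 0]))]
  | _, _, .l31 => [(-1, (5, [0, 1, 2])), (-1, (5, [1, 0, 2]))]
  | _, _, .l32 => [(-1, (5, [0, 1, 2])), (-1, (5, [0, 2, 1]))]
  | _, _, .l311 => [(-1, (6, [0, 1, 2])), (1, (6, [1, 0, 2]))]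
  | _, _, .l312 =>
    -- The inverse of `(132)` is `(123)`, with values `[1, 2, 0]` when counted from `0`; likewise
    -- `(123)` gives `[2, 0, 1]`.
    [(1, (6, [0, 1, 2])), (1, (6, [0, 2, 1])), (1, (6, [1, 2, 0])), (-1, (7, [0, 1, 2])),
     (-1, (7, [1, 0, 2])), (-1, (7, [2, 0, 1]))]
  | _, _, .l322 => [(-1, (7, [0, 1, 2])), (1, (7, [0, 2, 1]))]
  | _, _, .l41 => [(-1, (11, [0, 1, 2, 3])), (-1, (11, [1, 0, 2, 3]))]
  | _, _, .l42 => [(-1, (11, [0, 1, 2, 3])), (-1, (11, [0, 2, 1, 3]))]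
  | _, _, .l43 => [(-1, (11, [0, 1, 2, 3])), (-1, (11, [0, 1, 3, 2]))]
  | _, _, _ => []

/-- The terms of the reduced decomposition of a generator. -/
def redTerms : ∀ {n : ℕ} {r : ℤ}, LieGen n r → List (ℤ × Tree2)
  | _, _, .l3 =>
    [(-1, 1, [(1, [0, 1]), (0, [2])]), (1, 1, [(0, [0]), (1, [1, 2])]),
     (-1, 1, [(0, [1]), (1, [0, 2])])]
  | _, _, .l31 =>
    [(1, 1, [(2, [0, 1]), (0, [2])])]
  | _, _, .l32 =>
    [(-1, 2, [(1, [0, 1]), (0, [2])]), (-1, 1, [(0, [0]), (2, [1, 2])]),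
     (-1, 2, [(0, [1]), (1, [0, 2])])]
  | _, _, .l311 =>
    [(-1, 1, [(3, [0, 1]), (0, [2])])]
  | _, _, .l312 =>
    [(-1, 2, [(2, [0, 1]), (0, [2])]), (-1, 2, [(0, [0]), (2, [1, 2])]),
     (-1, 2, [(0, [1]), (2, [0, 2])]), (1, 3, [(0, [1]), (1, [2, 0])])]
  | _, _, .l322 =>
    [(-1, 3, [(1, [0, 1]), (0, [2])]), (1, 1, [(0, [0]), (3, [1, 2])]),
     (-1, 3, [(0, [1]), (1, [0, 2])])]
  | _, _, .l4 =>
    [(1, 1, [(5, [0, 1, 2]), (0, [3])]), (1, 1, [(0, [0]), (5, [1, 2, 3])]),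
     (-1, 1, [(0, [1]), (5, [0, 2, 3])]), (1, 1, [(0, [2]), (5, [0, 1, 3])]),
     (-1, 1, [(1, [0, 1]), (1, [2, 3])]), (1, 1, [(1, [0, 2]), (1, [1, 3])]),
     (-1, 1, [(1, [1, 2]), (1, [0, 3])]), (1, 5, [(1, [0, 1]), (0, [2]), (0, [3])]),
     (-1, 5, [(0, [0]), (1, [1, 2]), (0, [3])]), (1, 5, [(0, [1]), (1, [0, 2]), (0, [3])]),
     (1, 5, [(0, [0]), (0, [1]), (1, [2, 3])]), (-1, 5, [(0, [0]), (0, [2]), (1, [1, 3])]),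
     (1, 5, [(0, [1]), (0, [2]), (1, [0, 3])])]
  | _, _, .l41 =>
    [(-1, 1, [(6, [0, 1, 2]), (0, [3])]), (-1, 1, [(0, [2]), (6, [0, 1, 3])]),
     (1, 1, [(2, [0, 1]), (1, [2, 3])]), (1, 5, [(2, [0, 1]), (0, [2]), (0, [3])]),
     (1, 6, [(0, [0]), (0, [1]), (1, [2, 3])])]
  | _, _, .l42 =>
    [(-1, 1, [(7, [0, 1, 2]), (0, [3])]), (-1, 1, [(0, [0]), (6, [1, 2, 3])]),
     (1, 1, [(2, [1, 2]), (1, [0, 3])]), (1, 6, [(1, [0, 1]), (0, [2]), (0, [3])]),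
     (1, 6, [(0, [1]), (1, [0, 2]), (0, [3])]), (-1, 5, [(0, [0]), (2, [1, 2]), (0, [3])]),
     (1, 6, [(0, [1]), (0, [2]), (1, [0, 3])])]
  | _, _, .l43 =>
    [(1, 2, [(0, [2]), (5, [0, 1, 3])]), (-1, 1, [(0, [0]), (7, [1, 2, 3])]),
     (1, 1, [(0, [1]), (7, [0, 2, 3])]), (1, 2, [(5, [0, 1, 2]), (0, [3])]),
     (-1, 1, [(1, [0, 1]), (2, [2, 3])]), (-1, 2, [(1, [1, 2]), (1, [0, 3])]),
     (1, 2, [(1, [0, 2]), (1, [1, 3])]), (1, 7, [(1, [0, 1]), (0, [2]), (0, [3])]),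
     (-1, 7, [(0, [0]), (0, [2]), (1, [1, 3])]), (1, 7, [(0, [1]), (0, [2]), (1, [0, 3])]),
     (1, 5, [(0, [0]), (0, [1]), (2, [2, 3])]), (-1, 7, [(0, [0]), (1, [1, 2]), (0, [3])]),
     (1, 7, [(0, [1]), (1, [0, 2]), (0, [3])])]
  | _, _, .l5 =>
    -- The condition on `σ` orders the blocks by their largest labels, so the terms correspond to
    -- the partitions of the five labels into `j` blocks: `15`, `25` and `10` of them for `j = 2, 3,
    -- 4`.
    [(-1, 1, [(11, [0, 1, 2, 3]), (0, [4])]), (1, 1, [(5, [0, 1, 2]), (1, [3, 4])]),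
     (-1, 1, [(5, [0, 1, 3]), (1, [2, 4])]), (1, 1, [(5, [0, 2, 3]), (1, [1, 4])]),
     (-1, 1, [(5, [1, 2, 3]), (1, [0, 4])]), (-1, 1, [(1, [0, 1]), (5, [2, 3, 4])]),
     (1, 1, [(1, [0, 2]), (5, [1, 3, 4])]), (-1, 1, [(1, [0, 3]), (5, [1, 2, 4])]),
     (-1, 1, [(1, [1, 2]), (5, [0, 3, 4])]), (1, 1, [(1, [1, 3]), (5, [0, 2, 4])]),
     (-1, 1, [(1, [2, 3]), (5, [0, 1, 4])]), (1, 1, [(0, [0]), (11, [1, 2, 3, 4])]),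
     (-1, 1, [(0, [1]), (11, [0, 2, 3, 4])]), (1, 1, [(0, [2]), (11, [0, 1, 3, 4])]),
     (-1, 1, [(0, [3]), (11, [0, 1, 2, 4])]), (1, 5, [(5, [0, 1, 2]), (0, [3]), (0, [4])]),
     (-1, 5, [(1, [0, 1]), (1, [2, 3]), (0, [4])]), (1, 5, [(1, [0, 2]), (1, [1, 3]), (0, [4])]),
     (-1, 5, [(1, [1, 2]), (1, [0, 3]), (0, [4])]), (1, 5, [(1, [0, 1]), (0, [2]), (1, [3, 4])]),
     (1, 5, [(1, [0, 2]), (0, [3]), (1, [1, 4])]), (-1, 5, [(1, [0, 1]), (0, [3]), (1, [2, 4])]),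
     (-1, 5, [(1, [1, 2]), (0, [3]), (1, [0, 4])]), (1, 5, [(0, [0]), (5, [1, 2, 3]), (0, [4])]),
     (-1, 5, [(0, [1]), (5, [0, 2, 3]), (0, [4])]), (1, 5, [(0, [2]), (5, [0, 1, 3]), (0, [4])]),
     (-1, 5, [(0, [0]), (1, [1, 2]), (1, [3, 4])]), (1, 5, [(0, [0]), (1, [1, 3]), (1, [2, 4])]),
     (-1, 5, [(0, [0]), (1, [2, 3]), (1, [1, 4])]), (1, 5, [(0, [1]), (1, [0, 2]), (1, [3, 4])]),
     (-1, 5, [(0, [1]), (1, [0, 3]), (1, [2, 4])]), (1, 5, [(0, [2]), (1, [0, 3]), (1, [1, 4])]),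
     (-1, 5, [(0, [2]), (1, [1, 3]), (1, [0, 4])]), (1, 5, [(0, [1]), (1, [2, 3]), (1, [0, 4])]),
     (1, 5, [(0, [0]), (0, [1]), (5, [2, 3, 4])]), (-1, 5, [(0, [0]), (0, [2]), (5, [1, 3, 4])]),
     (1, 5, [(0, [0]), (0, [3]), (5, [1, 2, 4])]), (1, 5, [(0, [1]), (0, [2]), (5, [0, 3, 4])]),
     (-1, 5, [(0, [1]), (0, [3]), (5, [0, 2, 4])]), (1, 5, [(0, [2]), (0, [3]), (5, [0, 1, 4])]),
     (-1, 11, [(1, [0, 1]), (0, [2]), (0, [3]), (0, [4])]),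
     (1, 11, [(0, [0]), (1, [1, 2]), (0, [3]), (0, [4])]),
     (-1, 11, [(0, [1]), (1, [0, 2]), (0, [3]), (0, [4])]),
     (-1, 11, [(0, [0]), (0, [1]), (1, [2, 3]), (0, [4])]),
     (1, 11, [(0, [0]), (0, [2]), (1, [1, 3]), (0, [4])]),
     (-1, 11, [(0, [1]), (0, [2]), (1, [0, 3]), (0, [4])]),
     (1, 11, [(0, [0]), (0, [1]), (0, [2]), (1, [3, 4])]),
     (-1, 11, [(0, [0]), (0, [1]), (0, [3]), (1, [2, 4])]),
     (1, 11, [(0, [0]), (0, [2]), (0, [3]), (1, [1, 4])]),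
     (-1, 11, [(0, [1]), (0, [2]), (0, [3]), (1, [0, 4])])]
  | _, _, _ => []

/-- The terms of the decomposition of a generator. -/
def decompTerms : ∀ {n : ℕ} {r : ℤ}, LieGen n r → List (ℤ × Tree2)
  | _, _, .l1 => [(1, 0, [(0, [0])])]
  | n, _, g => [(1, 0, [(g.idx, List.range n)])] ++ redTerms g ++
      [(1, g.idx, (List.range n).map fun i => (0, [i]))]

end Codes

/-! ### Values of codes, and correctness of the tables -/

section Values

variable (k : Type u) [CommRing k]

/-- A generator with labels, as a labelled element. -/
noncomputable def genElt (g : Σ (n : ℕ) (r : ℤ), LieGen n r) (l : List ℕ) : LElt (LieD3 k) :=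
  ⟨g.1, g.2.1, el g.2.2 1, fun t => l.getD t 0⟩

/-- The value of a leaf. -/
noncomputable def leafElt (x : Leaf) : LElt (LieD3 k) := genElt k (genOf x.1) x.2

/-- The labelled elements `y i` grafted on a generator. -/
noncomputable def graftGen {N : DGSMod k} (n : ℕ) (r : ℤ) (g : Σ (n : ℕ) (r : ℤ), LieGen n r)
    (y : ℕ → LElt N) : CompX (LieD3 k) N n r :=
  graft (M := LieD3 k) n r (fun i : Fin g.1 => y i) (el g.2.2 1)

/-- The value of a two-level tree. -/
noncomputable def eval2 (n : ℕ) (r : ℤ) (c : Tree2) : CompX (LieD3 k) (LieD3 k) n r :=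
  graftGen k n r (genOf c.1) fun i => leafElt k (c.child i)

/-- The value of a two-level tree with one more level below it. -/
noncomputable def corollaElt (c : Tree2) : LElt ((LieD3 k).comp (LieD3 k)) :=
  corolla (N := LieD3 k) (el (genOf c.1).2.2 1) fun t : Fin (genOf c.1).1 => leafElt k (c.child t)

/-- The value of a three-level tree. -/
noncomputable def eval3 (n : ℕ) (r : ℤ) (c : Tree3) :
    CompX (LieD3 k) ((LieD3 k).comp (LieD3 k)) n r :=
  graftGen k n r (genOf c.1) fun i => corollaElt k (c.2.getD i (0, []))

/-- The tree has arity `n` and degree `r`, and its labels are those of the `n` inputs. -/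
structure Tree2.Good (n : ℕ) (r : ℤ) (c : Tree2) : Prop where
  fits : Fits n r (genOf c.1).2.1 fun i : Fin (genOf c.1).1 => leafElt k (c.child i)
  length : c.2.length = (genOf c.1).1
  length_lab : ∀ x ∈ c.2, x.2.length = (genOf x.1).1

variable {k}

/-- The tree of `tm`. -/
def tmCode {n m : ℕ} {p : ℤ} (μ : LieGen m p) (ν : Fin m → Σ (n : ℕ) (r : ℤ), LieGen n r)
    (σ : Perm (Fin n)) (hn : ∑ i, (ν i).1 = n) : Tree2 :=
  (μ.idx, List.ofFn fun i => ((ν i).2.2.idx,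
    List.ofFn fun t => (σ.symm (finCongr hn (finSigmaFinEquiv ⟨i, t⟩)) : ℕ)))

/-- Acting by `σ` on a tree with inputs numbered in order gives them the labels `σ⁻¹`. Hence `tm` is
the value of a single code with coefficient `1`. -/
theorem tm_rep {n m : ℕ} {p r : ℤ} (μ : LieGen m p) (ν : Fin m → Σ (n : ℕ) (r : ℤ), LieGen n r)
    (σ : Perm (Fin n)) (hn : ∑ i, (ν i).1 = n) (hr : p + ∑ i, (ν i).2.1 = r) :
    Rep (eval2 k n r) (Tree2.Good k n r) (LieD3.tm μ ν σ hn hr) [(1, tmCode μ ν σ hn)] := by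
  have hc : ∀ i : Fin m, leafElt k ((tmCode μ ν σ hn).child i) =
      entries (N := LieD3 k) (((finSigmaFinEquiv.trans (finCongr hn))).trans σ.symm)
        (fun i => (el (ν i).2.2 1 : FreeX k (ν i).1 (ν i).2.1)) i := by
    intro i
    have : (tmCode μ ν σ hn).child i = ((ν i).2.2.idx,
        List.ofFn fun t => (σ.symm (finCongr hn (finSigmaFinEquiv ⟨i, t⟩)) : ℕ)) := by
      simp [Tree2.child, tmCode]
    rw [this, leafElt, genOf_idx]
    unfold genElt entries
    congr 1
    funext t
    simp
  refine Rep.single ⟨?_, ?_, ?_⟩ ?_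
  · have h := entries_fits (N := LieD3 k)
      (((finSigmaFinEquiv.trans (finCongr hn))).trans σ.symm) hr
      (fun i => (el (ν i).2.2 1 : FreeX k (ν i).1 (ν i).2.1))
    -- The vertex read back from its number agrees with `μ` only propositionally; it is made a
    -- variable `g`, because its arity occurs in types.
    have key : ∀ g : Σ (n : ℕ) (r : ℤ), LieGen n r, g = ⟨m, p, μ⟩ →
        Fits n r g.2.1 fun i : Fin g.1 => leafElt k ((tmCode μ ν σ hn).child i) := by
      rintro g rfl
      rwa [show (fun i : Fin m => leafElt k ((tmCode μ ν σ hn).child i)) = _ from funext hc]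
    exact key _ (genOf_idx μ)
  · simp [tmCode, genOf_idx]
  · intro x hx
    obtain ⟨i, rfl⟩ := (List.mem_ofFn ..).1 hx
    simp [genOf_idx]
  · have h1 : eval2 k n r (tmCode μ ν σ hn) =
        graftGen k n r ⟨m, p, μ⟩ fun i => leafElt k ((tmCode μ ν σ hn).child i) := by
      rw [eval2, show genOf (tmCode μ ν σ hn).1 = _ from genOf_idx μ]
    rw [h1, LieD3.tm, act_node, node_eq_graft, graftGen]
    congr 2
    exact (funext hc).symm

/-- The value of a labelled generator as an element of `LieD[3]`. -/
noncomputable def leafVal (n : ℕ) (r : ℤ) (x : Leaf) : FreeX k n r :=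
  open Classical in
  if h : ∃ y : LieGen n r × Perm (Fin n),
    x = (y.1.idx, List.ofFn fun t => (y.2.symm t : ℕ)) then el h.choose.1 h.choose.2 else 0

/-- The number determines the generator and the list determines `σ⁻¹`, so the chosen preimage of the
code is the given one. -/
theorem leafVal_eq {n : ℕ} {r : ℤ} (g : LieGen n r) (σ : Perm (Fin n)) :
    (leafVal n r (g.idx, List.ofFn fun t => (σ.symm t : ℕ)) : FreeX k n r) = el g σ := by
  have h : ∃ y : LieGen n r × Perm (Fin n), ((g.idx, List.ofFn fun t => (σ.symm t : ℕ)) : Leaf) =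
    (y.1.idx, List.ofFn fun t => (y.2.symm t : ℕ)) := ⟨(g, σ), rfl⟩
  rw [leafVal, dif_pos h]
  obtain ⟨h1, h2⟩ := Prod.mk.inj h.choose_spec
  have e1 : g = h.choose.1 := by
    have := (genOf_idx g).symm.trans ((congrArg genOf h1).trans (genOf_idx h.choose.1))
    simpa using this
  have e2 : σ = h.choose.2 := by
    rw [← inv_inj]
    refine Equiv.ext fun t => Fin.ext ?_
    exact congrFun (List.ofFn_injective h2) t
  rw [← e1, ← e2]

/-- The leaf is a generator of arity `n` and degree `r` acted on by a permutation. -/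
def Leaf.Good (n : ℕ) (r : ℤ) (x : Leaf) : Prop :=
  ∃ (g : LieGen n r) (σ : Perm (Fin n)), x = (g.idx, List.ofFn fun t => (σ.symm t : ℕ))

theorem el_rep {n : ℕ} {r : ℤ} (g : LieGen n r) (σ : Perm (Fin n)) :
    Rep (leafVal n r) (Leaf.Good n r) (el g σ : FreeX k n r)
      [(1, g.idx, List.ofFn fun t => (σ.symm t : ℕ))] :=
  Rep.single ⟨g, σ, rfl⟩ (leafVal_eq g σ).symm

/-- The `Rep` lemmas follow the shape of the sum in `dGen` and produce its list of codes; the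
equality of this list with the table is computed. -/
theorem dGen_rep {n : ℕ} {r : ℤ} (g : LieGen n r) :
    Rep (leafVal n (r - 1)) (Leaf.Good n (r - 1)) (dGen g : FreeX k n (r - 1)) (diffTerms g) := by
  cases g <;> apply Rep.congr
  all_goals first
    | (simp only [dGen]
       repeat first
         | apply Rep.zero | apply Rep.add | apply Rep.sub | apply Rep.neg | apply el_rep)
    | skip
  all_goals decide +kernel

-- As for `dGen_rep`. This verifies every sign and every label in the table against the definition
-- of `Δ`, so the table is not an additional assumption.
set_option maxHeartbeats 1000000 in
theorem decompGen_rep {n : ℕ} {r : ℤ} (g : LieGen n r) :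
    Rep (eval2 k n r) (Tree2.Good k n r) (LieD3.decompGen g) (decompTerms g) := by
  cases g <;> apply Rep.congr
  all_goals first
    | (delta LieD3.decompGen LieD3.redDecomp
       dsimp only
       repeat first
         | with_reducible apply Rep.zero | with_reducible apply Rep.add
         | with_reducible apply Rep.sub | with_reducible apply Rep.neg
         | with_reducible apply tm_rep)
    | skip
  all_goals decide +kernel

end Values

/-! ### Operations on codes: relabelling, differential, iterated decompositions -/

section Operations

variable {k : Type u} [CommRing k]

/-- The entries of a tree, given as a list. -/
noncomputable def leafElts (k : Type u) [CommRing k] (m : ℕ) (ch : List Leaf) (i : Fin m) :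
    LElt (LieD3 k) :=
  leafElt k (ch.getD i (0, []))

theorem eval2_idx {n m : ℕ} {r p : ℤ} (g : LieGen m p) (ch : List Leaf) :
    eval2 k n r (g.idx, ch) = graft (M := LieD3 k) n r (leafElts k m ch) (el g 1) := by
  rw [eval2, genOf_idx]
  rfl

theorem getD_map_lt {A B : Type*} (f : A → B) (L : List A) (i : ℕ) (a : A) (b : B)
    (h : i < L.length) : (L.map f).getD i b = f (L.getD i a) := by
  simp [List.getD_eq_getElem?_getD, h]

theorem getD_ofFn {A : Type*} {m : ℕ} (f : Fin m → A) (i : Fin m) (a : A) :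
    (List.ofFn f).getD i a = f i := by
  simp

/-- The length condition keeps every index inside the list: beyond it the default label `0` would be
read without being relabelled. -/
theorem leafElt_relabel {x : Leaf} (hx : x.2.length = (genOf x.1).1) (l : List ℕ) :
    leafElt k (x.relabel l) = (leafElt k x).relabel fun t => l.getD t 0 := by
  have : ∀ t : Fin (genOf x.1).1, (x.relabel l).2.getD t 0 = l.getD (x.2.getD t 0) 0 := fun t =>
    getD_map_lt _ _ _ _ _ (by rw [hx]; exact t.2)
  simp only [leafElt, genElt, LElt.relabel, ← this]
  rfl

theorem Tree2.Good.child_mem {n : ℕ} {r : ℤ} {c : Tree2} (hc : c.Good k n r)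
    (i : Fin (genOf c.1).1) : c.child i ∈ c.2 := by
  have hi : (i : ℕ) < c.2.length := by rw [hc.length]; exact i.2
  rw [Tree2.child, List.getD_eq_getElem _ _ hi]
  exact List.getElem_mem hi

theorem Tree2.Good.child_relabel {n : ℕ} {r : ℤ} {c : Tree2} (hc : c.Good k n r) (l : List ℕ)
    (i : Fin (genOf c.1).1) : leafElt k ((c.relabel l).child i) =
      (leafElt k (c.child i)).relabel fun t => l.getD t 0 := by
  have hi : (i : ℕ) < c.2.length := by rw [hc.length]; exact i.2
  rw [← leafElt_relabel (hc.length_lab _ (hc.child_mem i))]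
  exact congrArg _ (getD_map_lt _ _ _ _ _ hi)

theorem act_eval2 {n : ℕ} {r : ℤ} {c : Tree2} (hc : c.Good k n r) (σ : Perm (Fin n)) :
    CompX.act σ (eval2 k n r c) = eval2 k n r (c.relabel (List.ofFn fun t => (σ.symm t : ℕ))) := by
  have h := (act_graft (M := LieD3 k) hc.fits (el (genOf c.1).2.2 1) σ
    (fun t => (List.ofFn fun t => (σ.symm t : ℕ)).getD t 0) (fun t => by simp)).2
  refine h.trans ?_
  rw [eval2, graftGen]
  congr 2
  exact funext fun i => (hc.child_relabel _ i).symm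

/-! ### The differential -/

/-- The terms in which the differential acts on the top generator. -/
def diffTop {m : ℕ} {p : ℤ} (g : LieGen m p) (ch : List Leaf) : List (ℤ × Tree2) :=
  (diffTerms g).map fun q =>
    (q.1 * sgn (koszulParity ((List.finRange m).map fun j : Fin m =>
        (degOf (ch.getD (q.2.2.getD j 0) (0, [])).1, (0, q.2.2.getD j 0), (0, (j : ℕ))))),
      q.2.1, (List.finRange m).map fun j : Fin m => ch.getD (q.2.2.getD j 0) (0, []))

/-- The element `d g` is a sum of terms `g' ^ σ`. By `graft_top_act` each `σ` moves from the vertex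
onto the entries, which produces the permuted list and the Koszul sign in `diffTop`. -/
theorem graft_dGen {n m : ℕ} {r p : ℤ} (g : LieGen m p) (ch : List Leaf)
    (h : Fits n r (p - 1) (leafElts k m ch)) :
    graft (M := LieD3 k) n r (leafElts k m ch) (dGen g : FreeX k m (p - 1)) =
      linComb (eval2 k n r) (diffTop g ch) := by
  obtain ⟨h1, h2⟩ := dGen_rep (k := k) g
  rw [h1]
  refine (map_linComb (graft (M := LieD3 k) n r (leafElts k m ch)).toAddMonoidHom _ _).trans ?_
  rw [diffTop]
  generalize diffTerms g = L at h2
  induction L with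
  | nil => rfl
  | cons q L ih =>
    rw [List.map_cons, linComb_cons, linComb_cons, ih fun q hq => h2 q (by simp [hq]), mul_smul]
    congr 2
    obtain ⟨s, x⟩ := q
    obtain ⟨g', σ, rfl⟩ := h2 (s, x) (by simp)
    dsimp only
    -- Writing `g' ^ σ` as the action of `σ` on the bare generator makes `graft_top_act` applicable.
    rw [leafVal_eq, ← one_mul σ, ← freeAct_el]
    refine (graft_top_act (M := LieD3 k) h σ (el g' 1)).2.trans ?_
    rw [koszulSign_perm_eq_sgn, eval2_idx]
    have hσ : ∀ j : Fin m, (List.ofFn fun t => (σ.symm t : ℕ)).getD j 0 = σ.symm j := fun j => by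
      simp
    simp only [one_mul, hσ]
    congr 3
    funext j
    simp [leafElts]

/-- The terms in which the differential acts on the bottom entries. -/
def diffBots (m : ℕ) (p : ℤ) (ch : List Leaf) : List (ℤ × List Leaf) :=
  (List.finRange m).flatMap fun i : Fin m =>
    mulTerms (fun x => ch.set i (Leaf.relabel (ch.getD i (0, [])).2 x))
      (sgn (odd (p + (((List.finRange m).filter (· < i)).map fun j : Fin m =>
        degOf (ch.getD j (0, [])).1).sum)))
      (diffTerms (genOf (ch.getD i (0, [])).1).2.2)

theorem linComb_flatMap {A B V : Type*} [AddCommGroup V] (f : B → V) (L : List A)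
    (T : A → List (ℤ × B)) : linComb f (L.flatMap T) = (L.map fun a => linComb f (T a)).sum := by
  induction L with
  | nil => rfl
  | cons a L ih => rw [List.flatMap_cons, linComb_append, ih, List.map_cons, List.sum_cons]

/-- The graft is linear in the `i`-th entry, whose differential is a sum of terms `g' ^ σ`. Here `σ`
only permutes the inputs of one entry, so it becomes a relabelling without sign. -/
theorem graft_update_diff {n m : ℕ} {r p : ℤ} (x : (LieD3 k).X m p) (ch : List Leaf)
    (hlen : ch.length = m) (i : Fin m)
    (h : Fits n r p (Function.update (leafElts k m ch) i (leafElts k m ch i).diff)) :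
    graft n r (Function.update (leafElts k m ch) i (leafElts k m ch i).diff) x =
      linComb (fun y => graft n r (leafElts k m (ch.set i (Leaf.relabel (ch.getD i (0, [])).2 y))) x)
        (diffTerms (genOf (ch.getD i (0, [])).1).2.2) := by
  obtain ⟨F, hF⟩ := graft_update_linear h x
  have hz : (leafElts k m ch i).diff.val = dGen (genOf (ch.getD i (0, [])).1).2.2 := by
    exact (freeD_el _ _).trans (freeAct_one _)
  refine (hF (leafElts k m ch i).diff.val).2.symm.trans ?_
  obtain ⟨h1, h2⟩ := dGen_rep (k := k) (genOf (ch.getD i (0, [])).1).2.2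
  rw [hz, h1]
  refine (map_linComb F.toAddMonoidHom _ _).trans (linComb_congr fun q hq => ?_)
  obtain ⟨g', σ, hx⟩ := h2 q hq
  rw [hx, leafVal_eq]
  refine (hF (el g' σ)).2.trans ?_
  refine (graft_rel (fun j => ?_) (hF (el g' σ)).1 x).2
  by_cases hj : j = i
  · subst hj
    have e1 : leafElts k m (ch.set j (Leaf.relabel (ch.getD j (0, [])).2
        (g'.idx, List.ofFn fun t => (σ.symm t : ℕ)))) j =
        ⟨_, _, el g' 1, fun t => (leafElts k m ch j).lab (σ.symm t)⟩ := by
      have hj : (j : ℕ) < ch.length := by rw [hlen]; exact j.2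
      have e2 : ∀ y, (ch.set j y).getD j (0, []) = y := fun y => by
        simp [List.getD_eq_getElem?_getD, hj]
      rw [leafElts, e2, leafElt_relabel (by simp [genOf_idx]), leafElt, genOf_idx]
      have hσ : ∀ t : Fin (genOf (ch.getD j (0, [])).1).1,
          (List.ofFn fun t => (σ.symm t : ℕ)).getD t 0 = σ.symm t := fun t => getD_ofFn _ t 0
      simp only [genElt, LElt.relabel, hσ]
      rfl
    rw [e1, Function.update_self]
    have := LElt.Rel.act (N := LieD3 k) _ _ (el g' 1) σ (leafElts k m ch j).lab
    rwa [show (LieD3 k).act σ (el g' 1) = el g' σ from (freeAct_el ..).trans (by rw [one_mul])]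
      at this
  · rw [Function.update_of_ne hj]
    have : leafElts k m (ch.set i (Leaf.relabel (ch.getD i (0, [])).2
        (g'.idx, List.ofFn fun t => (σ.symm t : ℕ)))) j = leafElts k m ch j := by
      have hij : (i : ℕ) ≠ j := fun h => hj (Fin.ext h.symm)
      simp [leafElts, List.getD_eq_getElem?_getD, hij]
    rw [this]
    exact LElt.Rel.refl _

/-- The terms of the differential of a tree. -/
def Tree2.diff (c : Tree2) : List (ℤ × Tree2) :=
  diffTop (genOf c.1).2.2 c.2 ++
    mulTerms (fun ch => (c.1, ch)) 1 (diffBots (genOf c.1).1 (genOf c.1).2.1 c.2)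

theorem d_eval2 {n : ℕ} {r : ℤ} {c : Tree2} (hc : c.Good k n r) :
    CompX.d (eval2 k n r c) = linComb (eval2 k n (r - 1)) c.diff := by
  refine (d_graft (M := LieD3 k) hc.fits (el (genOf c.1).2.2 1)).trans ?_
  rw [Tree2.diff, linComb_append, linComb_mulTerms, one_smul]
  congr 1
  · refine (congrArg _ ((freeD_el _ _).trans (freeAct_one _))).trans
      (graft_dGen _ _ ⟨hc.fits.1, ?_⟩)
    -- Lowering the degree of the vertex by `1` lowers the total degree by `1`.
    exact (sub_add_eq_add_sub _ _ _).trans (congrArg (· - 1) hc.fits.2)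
  · rw [diffBots, linComb_flatMap, ← Fin.sum_univ_def]
    refine Finset.sum_congr rfl fun i _ => ?_
    rw [linComb_mulTerms, prefixSign_eq_sgn]
    refine congrArg _ ?_
    exact graft_update_diff _ _ hc.length i (update_diff_fits hc.fits i)

/-! ### The two iterated decompositions -/

/-- The decomposition of the top generator, reassociated. -/
def Tree2.decompTop (c : Tree2) : List (ℤ × Tree3) :=
  (decompTerms (genOf c.1).2.2).map fun q =>
    (q.1 * sgn (koszulParity ((List.finRange (genOf q.2.1).1).flatMap fun i : Fin (genOf q.2.1).1 =>
        (degOf (q.2.child i).1, (0, (i : ℕ)), ((i : ℕ), 0)) ::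
          (List.finRange (genOf (q.2.child i).1).1).map fun t : Fin (genOf (q.2.child i).1).1 =>
            (degOf (c.child ((q.2.child i).2.getD t 0)).1, (1, (q.2.child i).2.getD t 0),
              ((i : ℕ), (t : ℕ) + 1)))),
      q.2.1, q.2.2.map fun x => (x.1, x.2.map c.child))

/-- A term of the decomposition of the top generator has as labels the places of the entries of `c`.
Reassociation thus replaces each label `j` by the `j`-th child of `c`, with the sign of
`associator_graft`. -/
theorem associator_eval2 {n : ℕ} {r : ℤ} {c : Tree2} (hc : c.Good k n r) :
    associator _ _ _ ((LieD3.decomp.comp (SHom.id (LieD3 k))).map (eval2 k n r c)) =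
      linComb (eval3 k n r) c.decompTop := by
  obtain ⟨h1, h2⟩ := decompGen_rep (k := k) (genOf c.1).2.2
  have e1 : (LieD3.decomp.comp (SHom.id (LieD3 k))).map (eval2 k n r c) =
      graft (M := (LieD3 k).comp (LieD3 k)) n r
        (fun i : Fin (genOf c.1).1 => leafElt k (c.child i))
        (LieD3.decompGen (genOf c.1).2.2) := by
    refine (map_graft LieD3.decomp (SHom.id (LieD3 k)) hc.fits (el (genOf c.1).2.2 1)).trans ?_
    refine congrArg _ ?_
    exact (LieD3.decompLin_el _ _).trans (CompX.act_one _)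
  rw [e1, h1, Tree2.decompTop]
  -- Grafting followed by the associator is additive in the top entry, so the terms can be treated
  -- one by one.
  refine (map_linComb ((associator _ _ _).toAddMonoidHom.comp (graft (M := (LieD3 k).comp (LieD3 k))
    n r fun i : Fin (genOf c.1).1 => leafElt k (c.child i)).toAddMonoidHom) _ _).trans ?_
  generalize decompTerms (genOf c.1).2.2 = L at h2
  induction L with
  | nil => rfl
  | cons q L ih =>
    rw [List.map_cons, linComb_cons, linComb_cons, ih fun q hq => h2 q (by simp [hq]), mul_smul]
    congr 2
    have hq := h2 q (by simp)
    obtain ⟨e, he⟩ := hq.fits.1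
    refine (associator_graft (M := LieD3 k) (N := LieD3 k) (el (genOf q.2.1).2.2 1) he hq.fits.2
      (y := fun j => leafElt k (c.child j)) hc.fits).trans ?_
    -- The values of `e` are the labels in the code; this makes the sign of the associator
    -- computable from the codes.
    have he' : ∀ (i : Fin (genOf q.2.1).1) (t : Fin (genOf (q.2.child i).1).1),
      (e ⟨i, t⟩ : ℕ) = (q.2.child i).2.getD t 0 := he
    rw [assocSign_eq_sgn]
    congr 1
    · congr 4
      funext i
      congr 1
      exact congrArg (fun f => List.map f _) (funext fun t => by rw [← he' i t]; rfl)
    · rw [eval3, graftGen]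
      congr 2
      funext i
      have hi : (i : ℕ) < q.2.2.length := by rw [hq.length]; exact i.2
      rw [getD_map_lt _ _ _ (0, []) _ hi]
      unfold corollaElt
      congr 1
      funext t
      have hl := hq.length_lab _ (hq.child_mem i)
      exact congrArg (leafElt k) (getD_map_lt c.child _ _ 0 (0, [])
        (by rw [hl]; exact t.2)).symm

/-- The decomposition of the bottom entries. -/
def Tree2.decompBots (c : Tree2) : List (ℤ × Tree3) :=
  mulTerms (fun l => (c.1, List.zipWith (fun x b => Tree2.relabel x.2 b) c.2 l)) 1
    (choices (fun x : Leaf => decompTerms (genOf x.1).2.2) c.2)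

/-- `Δ` has degree `0`, so applying it to all entries creates no sign. Multilinearity gives a sum
over the choices of one term per entry, and `graft_rel_corolla` replaces each chosen term by a
corolla carrying the labels of the entry. -/
theorem map_decomp_eval2 {n : ℕ} {r : ℤ} {c : Tree2} (hc : c.Good k n r) :
    ((SHom.id (LieD3 k)).comp LieD3.decomp).map (eval2 k n r c) =
      linComb (eval3 k n r) c.decompBots := by
  obtain ⟨⟨e, he⟩, hd⟩ := hc.fits
  have e1 : ((SHom.id (LieD3 k)).comp LieD3.decomp).map (eval2 k n r c) =
      node (M := LieD3 k) (N := (LieD3 k).comp (LieD3 k)) (el (genOf c.1).2.2 1) e hd fun i =>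
        linComb (eval2 k (genOf (c.child i).1).1 (genOf (c.child i).1).2.1)
          (decompTerms (genOf (c.child i).1).2.2) := by
    refine (congrArg _ (graft_eq he hd _)).trans ?_
    refine (map_node (SHom.id (LieD3 k)) LieD3.decomp _ _ _ _).trans ?_
    refine congrArg _ (funext fun i => ?_)
    refine (LieD3.decompLin_el _ _).trans ((CompX.act_one _).trans ?_)
    exact (decompGen_rep _).1
  rw [e1, Tree2.decompBots, linComb_mulTerms, one_smul]
  have key := multilinear_choices (k := k) (W := CompX (LieD3 k) ((LieD3 k).comp (LieD3 k)) n r)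
    (U := fun x : Leaf => ((LieD3 k).comp (LieD3 k)).X (genOf x.1).1 (genOf x.1).2.1)
    (fun x : Leaf => decompTerms (genOf x.1).2.2) (0, []) (0, [])
    (fun x => eval2 k (genOf x.1).1 (genOf x.1).2.1) c.2 hc.length
  refine (key (node (M := LieD3 k) (N := (LieD3 k).comp (LieD3 k)) (el (genOf c.1).2.2 1) e hd)).trans
    ?_
  refine linComb_congr fun q hq => ?_
  obtain ⟨hlen, hmem⟩ := choices_spec _ (0, []) (0, []) _ q hq
  refine (node_eq_graft (M := LieD3 k) (N := (LieD3 k).comp (LieD3 k)) _ e hd _).trans ?_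
  refine (graft_rel (fun i => ?_) (entries_fits e hd _) _).2
  have hi : (i : ℕ) < c.2.length := by rw [hc.length]; exact i.2
  obtain ⟨s, hs⟩ := hmem i hi
  have hg := (decompGen_rep (k := k) (genOf (c.child i).1).2.2).2 _ hs
  have hz : (List.zipWith (fun x b => Tree2.relabel x.2 b) c.2 q.2).getD i (0, []) =
      Tree2.relabel (c.child i).2 (q.2.getD i (0, [])) := by
    have hi' : (i : ℕ) < q.2.length := by rw [hlen]; exact hi
    simp [Tree2.child, List.getD_eq_getElem?_getD, hi, hi']
  have hr := graft_rel_corolla (N := LieD3 k) (el (genOf (q.2.getD i (0, [])).1).2.2 1) hg.fits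
    (fun t => (c.child i).2.getD t 0)
  have e2 : corollaElt k (Tree2.relabel (c.child i).2 (q.2.getD i (0, []))) =
      corolla (N := LieD3 k) (el (genOf (q.2.getD i (0, [])).1).2.2 1)
        fun t : Fin (genOf (q.2.getD i (0, [])).1).1 => (leafElt k
          (Tree2.child (q.2.getD i (0, [])) t)).relabel fun t => (c.child i).2.getD t 0 :=
    congrArg (corolla (N := LieD3 k) (el (genOf (q.2.getD i (0, [])).1).2.2 1))
      (funext fun t => hg.child_relabel _ t)
  -- The inputs of the `i`-th entry are labelled by `e`; this identifies the relabelling of the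
  -- chosen term with the labels of the tree.
  have e3 : (fun t : Fin (genOf (c.child i).1).1 => (c.child i).2.getD t 0) =
      fun t => (e ⟨i, t⟩ : ℕ) := (funext (he i)).symm
  rw [← e2, ← hz] at hr
  exact (congrArg (fun l => LElt.Rel (⟨_, _, _, l⟩ : LElt ((LieD3 k).comp (LieD3 k))) _) e3).mp hr

end Operations

/-! ### The finite verifications -/

section Checks

/-- A key by which two-level trees are sorted. -/
def Tree2.key (a : ℕ) (c : Tree2) : ℕ :=
  -- Base `16` accommodates the generator numbers, at most `15`, and the labels, at most `4`.
  c.2.foldl (fun a x => x.2.foldl (fun a t => 16 * a + t) (16 * a + x.1)) (16 * a + c.1)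

/-- A key by which three-level trees are sorted. -/
def Tree3.key (c : Tree3) : ℕ := c.2.foldl Tree2.key c.1

/-- The terms of the decomposition of the differential of a generator. -/
def diffDecomp {n : ℕ} {r : ℤ} (g : LieGen n r) : List (ℤ × Tree2) :=
  bindTerms (diffTerms g) fun x => mulTerms (Tree2.relabel x.2) 1 (decompTerms (genOf x.1).2.2)

/-- Both sums consist of codes whose vertices are bare generators, so no relation of the composite
product is left to apply: the terms cancel code by code. -/
theorem sameTerms_diff {n : ℕ} {r : ℤ} (g : LieGen n r) :
    sameTerms (Tree2.key 0) (diffDecomp g) (bindTerms (decompTerms g) Tree2.diff) = true := by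
  cases g <;> decide +kernel

/-- The same cancellation for three-level trees. Both sides are trees in `M ∘ (N ∘ P)`, the
associator sign being included in `decompTop`. -/
theorem sameTerms_decomp {n : ℕ} {r : ℤ} (g : LieGen n r) :
    sameTerms Tree3.key (bindTerms (decompTerms g) Tree2.decompTop)
      (bindTerms (decompTerms g) Tree2.decompBots) = true := by
  cases g <;> decide +kernel

end Checks

/-! ### The cooperad axioms on generators and their extension -/

section Cooperad

variable {k : Type u} [CommRing k]

/-- Equivariant linear maps out of `LieD[3]` agree if they agree on the generators. -/
theorem freeX_ext {n : ℕ} {r : ℤ} {V : Type*} [AddCommGroup V] [Module k V]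
    {A B : FreeX k n r →ₗ[k] V} (T : Perm (Fin n) → V → V)
    (hA : ∀ σ x, A (freeAct σ x) = T σ (A x)) (hB : ∀ σ x, B (freeAct σ x) = T σ (B x))
    (h : ∀ g, A (el g 1) = B (el g 1)) : A = B := by
  refine Finsupp.lhom_ext' fun ⟨g, σ⟩ => LinearMap.ext_ring ?_
  change A (el g σ) = B (el g σ)
  rw [← one_mul σ, ← freeAct_el, hA, hB, h]

/-- `S_n` only changes the labels of the inputs; the associator carries these along, and its sign
does not depend on them. -/
theorem associator_act {M N P : DGSMod k} {n : ℕ} {r : ℤ} (σ : Perm (Fin n))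
    (x : ((M.comp N).comp P).X n r) :
    associator M N P (CompX.act σ x) = CompX.act σ (associator M N P x) := by
  suffices h : associator M N P ∘ₗ CompX.act σ =
      (CompX.act σ ∘ₗ associator M N P : ((M.comp N).comp P).X n r →ₗ[k] _) from
    LinearMap.congr_fun h x
  refine hom_ext fun t => ?_
  obtain ⟨m, p, y, a, q, ρ, lab, h⟩ := t
  rw [LinearMap.comp_apply, LinearMap.comp_apply, act_mk]
  refine (lift_mk _ assocInner_respects _).trans
    (Eq.trans ?_ (congrArg (CompX.act σ) (lift_mk _ assocInner_respects _).symm))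
  suffices h' : assocInner (lab.trans σ.symm) h ρ = CompX.act σ ∘ₗ
      (assocInner lab h ρ : CompX M N m p →ₗ[k] CompX M (N.comp P) n r) from
    LinearMap.congr_fun h' y
  refine hom_ext fun s => ?_
  rw [LinearMap.comp_apply, assocInner, assocInner, lift_mk, lift_mk, assocTree, assocTree, map_smul,
    assocNode, assocNode, act_node]
  rfl

theorem decomp_diff_generator {n : ℕ} {r : ℤ} (g : LieGen n r) :
    LieD3.decomp.map (dGen g : FreeX k n (r - 1)) =
      CompX.d (LieD3.decompGen g : CompX (LieD3 k) (LieD3 k) n r) := by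
  obtain ⟨h1, h2⟩ := dGen_rep (k := k) g
  obtain ⟨h3, h4⟩ := decompGen_rep (k := k) g
  have e1 : LieD3.decomp.map (dGen g : FreeX k n (r - 1)) =
      linComb (eval2 k n (r - 1)) (diffDecomp g) := by
    rw [h1, diffDecomp, linComb_bindTerms]
    refine (map_linComb (LieD3.decomp (k := k)).map.toAddMonoidHom _ _).trans
      (linComb_congr fun q hq => ?_)
    obtain ⟨g', σ, hx⟩ := h2 q hq
    obtain ⟨h5, h6⟩ := decompGen_rep (k := k) g'
    rw [hx, leafVal_eq, linComb_mulTerms, one_smul, genOf_idx]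
    refine (LieD3.decompLin_el g' σ).trans ?_
    rw [h5]
    refine (map_linComb (CompX.act σ).toAddMonoidHom _ _).trans (linComb_congr fun q hq => ?_)
    exact act_eval2 (h6 q hq) σ
  rw [e1, h3, linComb_eq_of_sameTerms _ _ (sameTerms_diff g), linComb_bindTerms]
  exact ((map_linComb CompX.d.toAddMonoidHom _ _).trans
    (linComb_congr fun q hq => d_eval2 (h4 q hq))).symm

theorem coassoc_generator {n : ℕ} {r : ℤ} (g : LieGen n r) :
    associator _ _ _ ((LieD3.decomp.comp (SHom.id (LieD3 k))).map (LieD3.decompGen g)) =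
      ((SHom.id (LieD3 k)).comp LieD3.decomp).map (LieD3.decompGen g) := by
  obtain ⟨h3, h4⟩ := decompGen_rep (k := k) g
  rw [h3]
  refine (map_linComb ((associator _ _ _).toAddMonoidHom.comp
    (LieD3.decomp.comp (SHom.id (LieD3 k))).map.toAddMonoidHom) _ _).trans ?_
  refine (linComb_congr (g := fun c => linComb (eval3 k n r) c.decompTop) fun q hq =>
    associator_eval2 (h4 q hq)).trans ?_
  rw [← linComb_bindTerms, linComb_eq_of_sameTerms _ _ (sameTerms_decomp g), linComb_bindTerms]
  exact ((map_linComb ((SHom.id (LieD3 k)).comp LieD3.decomp).map.toAddMonoidHom _ _).trans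
    (linComb_congr fun q hq => map_decomp_eval2 (h4 q hq))).symm

/-! ### The counit -/

theorem unit_eq_zero {n : ℕ} {r : ℤ} (h : n ≠ 1) (x : (unit k).X n r) : x = 0 := by
  have hs : (if n = 1 ∧ r = 0 then ⊤ else ⊥ : Submodule k k) = ⊥ := if_neg fun h' => h h'.1
  exact Subtype.ext ((Submodule.mem_bot k).1 ((le_of_eq hs) x.2))

/-- The differential preserves the arity, and `I` vanishes outside arity `1`, where `d 1 = 0`. -/
theorem counit_dGen {n : ℕ} {r : ℤ} (g : LieGen n r) :
    LieD3.counit.map (dGen g : FreeX k n (r - 1)) = 0 := by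
  cases g
  case l1 => exact map_zero _
  all_goals exact unit_eq_zero (by decide) _

theorem map_tm {N N' : DGSMod k} (f : SHom (LieD3 k) N) (f' : SHom (LieD3 k) N') {n m : ℕ} {p r : ℤ}
    (μ : LieGen m p) (ν : Fin m → Σ (n : ℕ) (r : ℤ), LieGen n r)
    (σ : Perm (Fin n)) (hn : ∑ i, (ν i).1 = n) (hr : p + ∑ i, (ν i).2.1 = r) :
    (f.comp f').map (LieD3.tm μ ν σ hn hr : CompX (LieD3 k) (LieD3 k) n r) =
      CompX.act σ (node (M := N) (N := N') (f.map (el μ 1)) (ar := fun i => (ν i).1)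
        (q := fun i => (ν i).2.1) (finSigmaFinEquiv.trans (finCongr hn)) hr fun i =>
          f'.map (el (ν i).2.2 1)) :=
  ((f.comp f').map_act σ _).trans (congrArg _ (map_node f f' _ _ _ _))

theorem counit_tm {n m : ℕ} {p r : ℤ} (μ : LieGen m p)
    (ν : Fin m → Σ (n : ℕ) (r : ℤ), LieGen n r) (σ : Perm (Fin n)) (hn : ∑ i, (ν i).1 = n)
    (hr : p + ∑ i, (ν i).2.1 = r) (hm : m ≠ 1) :
    (LieD3.counit.comp (SHom.id (LieD3 k))).map (LieD3.tm μ ν σ hn hr) = 0 := by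
  rw [map_tm, unit_eq_zero hm (LieD3.counit.map _), node_zero, map_zero]

theorem tm_counit {n m : ℕ} {p r : ℤ} (μ : LieGen m p)
    (ν : Fin m → Σ (n : ℕ) (r : ℤ), LieGen n r) (σ : Perm (Fin n)) (hn : ∑ i, (ν i).1 = n)
    (hr : p + ∑ i, (ν i).2.1 = r) (hm : m ≠ n) :
    ((SHom.id (LieD3 k)).comp LieD3.counit).map (LieD3.tm μ ν σ hn hr) = 0 := by
  -- If all entries had arity `1`, their arities would add up to `m`, and not to `n`.
  obtain ⟨i, hi⟩ : ∃ i, (ν i).1 ≠ 1 := by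
    by_contra! h
    exact hm (by simpa [h] using hn)
  rw [map_tm, MultilinearMap.map_coord_zero _ i (unit_eq_zero hi _), map_zero]

-- No term of the reduced decomposition has a top vertex of arity `1` or `n`. Phrased for a
-- submodule `K`, this serves both counit axioms, with `K` the kernel of `ε ∘ id` or of `id ∘ ε`.
set_option maxHeartbeats 2000000 in
theorem redDecomp_mem {n : ℕ} {r : ℤ} (g : LieGen n r)
    (K : Submodule k (CompX (LieD3 k) (LieD3 k) n r))
    (hK : ∀ {m : ℕ} {p : ℤ} (μ : LieGen m p) (ν : Fin m → Σ (n : ℕ) (r : ℤ), LieGen n r)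
      (σ : Perm (Fin n)) (hn : ∑ i, (ν i).1 = n) (hr : p + ∑ i, (ν i).2.1 = r), m ≠ 1 → m ≠ n →
      LieD3.tm μ ν σ hn hr ∈ K) : LieD3.redDecomp g ∈ K := by
  cases g <;> delta LieD3.redDecomp <;> dsimp only
  all_goals
    repeat first
      | with_reducible apply zero_mem | with_reducible apply add_mem
      | with_reducible apply sub_mem | with_reducible apply neg_mem
      | (with_reducible apply hK <;> decide)

theorem decompGen_eq {n : ℕ} {r : ℤ} (g : LieGen n r) (h : n ≠ 1) :
    (LieD3.decompGen g : CompX (LieD3 k) (LieD3 k) n r) =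
      LieD3.tm .l1 (fun _ => LieD3.S g) 1 (by simp [LieD3.S]) (by simp [LieD3.S]) +
        LieD3.redDecomp g +
        LieD3.tm g (fun _ => LieD3.S .l1) 1 (by simp [LieD3.S]) (by simp [LieD3.S]) := by
  cases g
  case l1 => exact absurd rfl h
  all_goals rfl

theorem decompGen_l1 : (LieD3.decompGen .l1 : CompX (LieD3 k) (LieD3 k) 1 0) =
    LieD3.tm .l1 (fun _ => LieD3.S .l1) 1 (by simp [LieD3.S]) (by simp [LieD3.S]) := by
  have h : ∀ ν ν' : Fin 1 → Σ (n : ℕ) (r : ℤ), LieGen n r, ν = ν' → ∀ hn hr hn' hr',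
      (LieD3.tm .l1 ν 1 hn hr : CompX (LieD3 k) (LieD3 k) 1 0) = LieD3.tm .l1 ν' 1 hn' hr' := by
    rintro ν _ rfl _ _ _ _
    rfl
  exact h _ _ (funext fun i => by rw [Subsingleton.elim i 0]; rfl) _ _ _ _

theorem eq_l1 : ∀ {n : ℕ} {r : ℤ} (g : LieGen n r), n = 1 → (⟨n, r, g⟩ : Σ (n : ℕ) (r : ℤ), LieGen n r) =
    ⟨1, 0, .l1⟩ := by
  intro n r g h
  cases g <;> first | rfl | exact absurd h (by decide)

theorem counit_tm_l1 {n : ℕ} {r : ℤ} (g : LieGen n r) (hn : ∑ _i : Fin 1, n = n)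
    (hr : 0 + ∑ _i : Fin 1, r = r) :
    (LieD3.counit.comp (SHom.id (LieD3 k))).map (LieD3.tm .l1 (fun _ => LieD3.S g) 1 hn hr) =
      leftUnitorInv (LieD3 k) (el g 1) := by
  refine (map_tm LieD3.counit (SHom.id (LieD3 k)) _ _ 1 hn hr).trans ?_
  refine (CompX.act_one _).trans ?_
  have h1 : (LieD3.counit.map (el .l1 1 : FreeX k 1 0)) = unit.one := by
    simp [LieD3.counit, el, LieD3.counitGen]
  rw [h1]
  refine node_lab_congr _ _ _ ?_
  rintro ⟨i, t⟩
  obtain rfl : i = default := Subsingleton.elim _ _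
  exact Fin.ext ((finSigmaFinEquiv_apply _).trans (zero_add _))

theorem tm_counit_l1 {n : ℕ} {r : ℤ} (g : LieGen n r) (hn : ∑ _i : Fin n, 1 = n)
    (hr : r + ∑ _i : Fin n, 0 = r) :
    ((SHom.id (LieD3 k)).comp LieD3.counit).map (LieD3.tm g (fun _ => LieD3.S .l1) 1 hn hr) =
      rightUnitorInv (LieD3 k) (el g 1) := by
  refine (map_tm (SHom.id (LieD3 k)) LieD3.counit _ _ 1 hn hr).trans ?_
  refine (CompX.act_one _).trans ?_
  have h1 : (LieD3.counit.map (el .l1 1 : FreeX k 1 0)) = unit.one := by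
    simp [LieD3.counit, el, LieD3.counitGen]
  refine (congrArg _ (funext fun i => h1)).trans ?_
  refine node_lab_congr _ _ _ ?_
  rintro ⟨i, t : Fin 1⟩
  obtain rfl : t = 0 := Subsingleton.elim _ _
  -- The unique input of the `i`-th entry has as its number the sum of `i` arities equal to `1`.
  refine Fin.ext ((finSigmaFinEquiv_apply _).trans ?_)
  simp [LieD3.S]
  rfl

/-- Outside arity `1`, the terms of the reduced decomposition and `g ∘ (1, …, 1)` have a top vertex
killed by `ε`, and `1 ∘ (g)` survives. In arity `1` there is only the term `1 ∘ (1)`. -/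
theorem counit_left_generator {n : ℕ} {r : ℤ} (g : LieGen n r) :
    (LieD3.counit.comp (SHom.id (LieD3 k))).map (LieD3.decompGen g) =
      leftUnitorInv (LieD3 k) (el g 1) := by
  by_cases h : n = 1
  · obtain ⟨rfl, h⟩ := Sigma.mk.inj (eq_l1 g h)
    obtain ⟨rfl, h⟩ := Sigma.mk.inj (eq_of_heq h)
    obtain rfl := eq_of_heq h
    exact (congrArg _ decompGen_l1).trans (counit_tm_l1 .l1 _ _)
  · have e2 := redDecomp_mem g (LinearMap.ker (LieD3.counit.comp (SHom.id (LieD3 k))).map)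
      fun μ ν σ hn hr h1 _ => counit_tm μ ν σ hn hr h1
    refine (congrArg _ (decompGen_eq g h)).trans ?_
    rw [map_add, map_add, LinearMap.mem_ker.1 e2, add_zero]
    refine (congrArg₂ _ (counit_tm_l1 g _ _) (counit_tm _ _ _ _ _ h)).trans (add_zero _)

/-- The mirror image: every term other than `g ∘ (1, …, 1)` has an entry of arity different from
`1`, which `ε` kills. -/
theorem counit_right_generator {n : ℕ} {r : ℤ} (g : LieGen n r) :
    ((SHom.id (LieD3 k)).comp LieD3.counit).map (LieD3.decompGen g) =
      rightUnitorInv (LieD3 k) (el g 1) := by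
  by_cases h : n = 1
  · obtain ⟨rfl, h⟩ := Sigma.mk.inj (eq_l1 g h)
    obtain ⟨rfl, h⟩ := Sigma.mk.inj (eq_of_heq h)
    obtain rfl := eq_of_heq h
    exact (congrArg _ decompGen_l1).trans (tm_counit_l1 .l1 _ _)
  · have e2 := redDecomp_mem g (LinearMap.ker ((SHom.id (LieD3 k)).comp LieD3.counit).map)
      fun μ ν σ hn hr _ h1 => tm_counit μ ν σ hn hr h1
    refine (congrArg _ (decompGen_eq g h)).trans ?_
    rw [map_add, map_add, LinearMap.mem_ker.1 e2, add_zero]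
    refine (congrArg₂ _ (tm_counit _ _ _ _ _ (Ne.symm h)) (tm_counit_l1 g _ _)).trans (zero_add _)

/-- The left unit isomorphism as a linear map. -/
noncomputable def leftUnitorLin (M : DGSMod k) (n : ℕ) (r : ℤ) :
    M.X n r →ₗ[k] ((unit k).comp M).X n r where
  toFun := leftUnitorInv M
  map_add' x y := by
    -- A family indexed by `Fin 1` is an update at its only index, so linearity is multilinearity in
    -- that place.
    have h : ∀ z : M.X n r, (fun _ : Fin 1 => z) = Function.update (fun _ => x) 0 z := fun z =>
      funext fun i => by rw [Subsingleton.elim i 0, Function.update_self]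
    unfold leftUnitorInv
    rw [h (x + y), h y, MultilinearMap.map_update_add, ← h x, ← h y]
  map_smul' c x := by
    have h : ∀ z : M.X n r, (fun _ : Fin 1 => z) = Function.update (fun _ => x) 0 z := fun z =>
      funext fun i => by rw [Subsingleton.elim i 0, Function.update_self]
    unfold leftUnitorInv
    rw [h (c • x), MultilinearMap.map_update_smul, ← h x]
    rfl

/-- The right unit isomorphism as a linear map. -/
noncomputable def rightUnitorLin (M : DGSMod k) (n : ℕ) (r : ℤ) :
    M.X n r →ₗ[k] (M.comp (unit k)).X n r :=
  nodeTop (N := unit k) (ar := fun _ => 1) (q := fun _ => 0)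
    (Equiv.sigmaUnique (Fin n) fun _ => Fin 1) (by simp) fun _ => unit.one

theorem leftUnitorInv_act (M : DGSMod k) {n : ℕ} {r : ℤ} (σ : Perm (Fin n)) (x : M.X n r) :
    leftUnitorInv M (M.act σ x) = CompX.act σ (leftUnitorInv M x) := by
  unfold leftUnitorInv
  rw [act_node]
  refine (node_bot_act (M := unit k) (N := M) _ _ _ (fun _ => x) fun _ => σ).trans ?_
  refine node_lab_congr _ _ _ ?_
  rintro ⟨i, t⟩
  obtain rfl : i = default := Subsingleton.elim _ _
  rfl

theorem rightUnitorInv_act (M : DGSMod k) {n : ℕ} {r : ℤ} (σ : Perm (Fin n)) (x : M.X n r) :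
    rightUnitorInv M (M.act σ x) = CompX.act σ (rightUnitorInv M x) := by
  unfold rightUnitorInv
  rw [act_node, node_top_act]
  -- The entries all have degree `0`, so permuting them costs no sign.
  have h : koszulSign (fun _ : Fin n => (0 : ℤ)) (fun i => i) (fun i => σ i) = 1 := by
    simp [koszulSign]
  rw [h, Units.val_one, Int.cast_one, one_smul]
  exact node_lab_congr _ _ _ fun _ => rfl

theorem isDGCooperad_LieD3 : IsDGCooperad (LieD3 k) LieD3.decomp LieD3.counit where
  decomp_d {n r} x := by
    suffices h : (LieD3.decomp (k := k)).map ∘ₗ freeD = CompX.d ∘ₗ (LieD3.decomp (k := k)).map from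
      LinearMap.congr_fun h x
    refine freeX_ext (n := n) (r := r) (fun σ => CompX.act σ) (fun σ x => ?_) (fun σ x => ?_)
      fun g => ?_
    · exact (congrArg _ (freeD_act σ x)).trans (LieD3.decomp.map_act σ _)
    · exact (congrArg CompX.d (LieD3.decomp.map_act σ x)).trans (CompX.d_act σ _)
    · refine (congrArg LieD3.decomp.map ((freeD_el g 1).trans (freeAct_one _))).trans
        ((decomp_diff_generator g).trans (congrArg CompX.d ?_))
      exact ((LieD3.decompLin_el g 1).trans (CompX.act_one _)).symm
  counit_d {n r} x := by
    -- The differential of `I` is zero, so the counit must vanish on boundaries.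
    suffices h : (LieD3.counit (k := k)).map ∘ₗ freeD = 0 from LinearMap.congr_fun h x
    -- `S_n` acts trivially on `I`.
    refine freeX_ext (n := n) (r := r) (fun _ => _root_.id) (fun σ x => ?_) (fun σ x => rfl)
      fun g => ?_
    · exact (congrArg _ (freeD_act σ x)).trans (LieD3.counit.map_act σ _)
    · exact (congrArg LieD3.counit.map ((freeD_el g 1).trans (freeAct_one _))).trans (counit_dGen g)
  coassoc {n r} x := by
    suffices h : associator _ _ _ ∘ₗ (LieD3.decomp.comp (SHom.id (LieD3 k))).map ∘ₗ
        (LieD3.decomp (k := k)).map =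
        ((SHom.id (LieD3 k)).comp LieD3.decomp).map ∘ₗ (LieD3.decomp (k := k)).map from
      LinearMap.congr_fun h x
    refine freeX_ext (n := n) (r := r) (fun σ => CompX.act σ) (fun σ x => ?_) (fun σ x => ?_)
      fun g => ?_
    · refine (congrArg (fun z => associator _ _ _
        ((LieD3.decomp.comp (SHom.id (LieD3 k))).map z)) (LieD3.decomp.map_act σ x)).trans ?_
      exact (congrArg _ (SHom.map_act _ σ _)).trans (associator_act σ _)
    · exact (congrArg ((SHom.id (LieD3 k)).comp LieD3.decomp).map
        (LieD3.decomp.map_act σ x)).trans (SHom.map_act _ σ _)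
    · have h := (LieD3.decompLin_el (k := k) g 1).trans (CompX.act_one _)
      exact (congrArg (fun z => associator _ _ _
        ((LieD3.decomp.comp (SHom.id (LieD3 k))).map z)) h).trans
        ((coassoc_generator g).trans (congrArg _ h.symm))
  counit_left {n r} x := by
    suffices h : (LieD3.counit.comp (SHom.id (LieD3 k))).map ∘ₗ (LieD3.decomp (k := k)).map =
        leftUnitorLin (LieD3 k) n r from LinearMap.congr_fun h x
    refine freeX_ext (n := n) (r := r) (fun σ => CompX.act σ) (fun σ x => ?_) (fun σ x => ?_)
      fun g => ?_
    · exact (congrArg (LieD3.counit.comp (SHom.id (LieD3 k))).map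
        (LieD3.decomp.map_act σ x)).trans (SHom.map_act _ σ _)
    · exact leftUnitorInv_act (LieD3 k) σ x
    · exact (congrArg _ ((LieD3.decompLin_el g 1).trans (CompX.act_one _))).trans
        (counit_left_generator g)
  counit_right {n r} x := by
    suffices h : ((SHom.id (LieD3 k)).comp LieD3.counit).map ∘ₗ (LieD3.decomp (k := k)).map =
        rightUnitorLin (LieD3 k) n r from LinearMap.congr_fun h x
    refine freeX_ext (n := n) (r := r) (fun σ => CompX.act σ) (fun σ x => ?_) (fun σ x => ?_)
      fun g => ?_
    · exact (congrArg ((SHom.id (LieD3 k)).comp LieD3.counit).map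
        (LieD3.decomp.map_act σ x)).trans (SHom.map_act _ σ _)
    · exact rightUnitorInv_act (LieD3 k) σ x
    · exact (congrArg _ ((LieD3.decompLin_el g 1).trans (CompX.act_one _))).trans
        (counit_right_generator g)

end Cooperad

theorem isSFree_LieD3 (k : Type u) [CommRing k] : IsSFree (LieD3 k) := fun n r =>
  ⟨LieGen n r, Finsupp.basisSingleOne, fun i σ τ => by
    rw [Finsupp.coe_basisSingleOne]
    exact freeAct_el τ σ i⟩

end DGSMod

theorem mainTheorem4 {k : Type u} [CommRing k] :
    DGSMod.IsSFree (DGSMod.LieD3 k) ∧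
      DGSMod.IsDGCooperad (DGSMod.LieD3 k) DGSMod.LieD3.decomp DGSMod.LieD3.counit :=
  ⟨DGSMod.isSFree_LieD3 k, DGSMod.isDGCooperad_LieD3⟩
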